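/- \textbf{Conventions.} Varieties are irreducible, reduced and quasi-projective over $\mathbb C$. A \emph{pair} $(X,B)$ consists of a normal variety $X$ and a $\mathbb Q$-divisor $B$ with coefficients in $[0,1]$ such that $K_X+B$ is $\mathbb Q$-Cartier. For a birational morphism $q\colon V\to X$ of normal varieties write $K_V=q^*(K_X+B)+A$ with $q_*K_V=K_X$; the \emph{discrepancy} $d(E,X,B)$ of a prime divisor $E$ on $V$ is the coefficient of $E$ in $A$ (it depends only on the valuation given by $E$). The pair is \emph{log canonical} (lc) if $d(E,X,B)\ge -1$ for every prime divisor $E$ on every normal variety $V$ with a projective birational morphism $V\to X$. For an integral divisor $D$ on a normal projective variety $X$ with $h^0(X,mD)\neq 0$ let $\phi_{mD}$ be the rational map to projective space given by a basis of $H^0(X,mD)$. Put $\kappa(D)=\max\{\dim\phi_{mD}(X)\mid m\ge 1,\ h^0(X,mD)\ne 0\}$, and $\kappa(D)=-\infty$ if $h^0(X,mD)=0$ for all $m\ge 1$. For a $\mathbb Q$-divisor $D$ put $\kappa(D)=\kappa(lD)$, where $l\geq 1$ and $lD$ is integral, and for a pair put $\kappa(X,B)=\kappa(K_X+B)$. For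 a projective variety $Y$ let $N_1(Y)$ be the space of real $1$-cycles modulo numerical equivalence and $\overline{NE}(Y)\subset N_1(Y)$ the closed cone of curves. An \emph{extremal ray} is a one-dimensional subcone $R\subseteq \overline{NE}(Y)$ such that $x,y\in\overline{NE}(Y)$ and $x+y\in R$ imply $x,y\in R$. A \emph{contraction} is a projective morphism $g\colon Y\to Z$ of varieties with $g_*\mathcal O_Y=\mathcal O_Z$; it is the contraction of $R$ if, for every curve $C\subset Y$, $g(C)$ is a point if and only if $[C]\in R$. Let $(X,B)$ be an lc pair. A \emph{Mori fibre space for} $(X,B)$ consists of a projective lc pair $(Y,B_Y)$, a birational map $f\colon X\dashrightarrow Y$ whose inverse does not contract any divisors and which satisfies $B_Y=f_*B$, and a morphism $g\colon Y\to Z$ to a variety $Z$ with $\dim Z<\dim Y$, such that $g$ is the contraction of an extremal ray $R$ of $\overline{NE}(Y)$ with $(K_Y+B_Y)\cdot R<0$, and $d(E,X,B)<d(E,Y,B_Y)$ for every prime divisor $E$ on $X$ that is contracted by $f$. \textbf{Theorem.} Let $(X,B)$ be a pair with $X$ projective. If $(X,B)$ has a Mori fibre space, then $\kappa(X,B)=-\infty$.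 -/

import Mathlib

open CategoryTheory CategoryTheory.Limits AlgebraicGeometry Order

namespace MoriFibre

noncomputable section

/-! ## Differential forms on a field and on its subrings -/

section Forms

variable (k K L : Type) [Field k] [Field K] [Field L] [Algebra k K] [Algebra k L]
  [Algebra K L] [IsScalarTower k K L] (n : ℕ)

/-- The `K`-vector space of differential `n`-forms of `K` over `k`. -/
abbrev Form : Type := ⋀[K]^n (Ω[K⁄k])

/-- The `A`-module of regular `n`-forms of a subring `A` of `K` (with `k ⊆ A`): the image in the
`n`-forms of `K` of the `n`-th exterior power of the Kähler differentials of `A` over `k`,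
that is, the `A`-span of the forms `da₁ ∧ ⋯ ∧ daₙ` with `aᵢ ∈ A`. -/
def regularForms (A : Subring K) : Submodule A (Form k K n) :=
  Submodule.span A (Set.range fun a : Fin n → A =>
    exteriorPower.ιMulti K n fun i => KaehlerDifferential.D k K (a i : K))

/-- Pull-back of `n`-forms along a `k`-extension `K → L`: it sends `f · da₁ ∧ ⋯ ∧ daₙ` to
`f · da₁ ∧ ⋯ ∧ daₙ`. -/
def formMap : Form k K n →ₗ[K] Form k L n :=
  exteriorPower.alternatingMapLinearEquiv
    { toFun := fun m => exteriorPower.ιMulti L n fun i => KaehlerDifferential.map k k K L (m i)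
      map_update_add' := by
        intro _ m i x y
        have h : ∀ z, (fun j => KaehlerDifferential.map k k K L (Function.update m i z j)) =
            Function.update (fun j => KaehlerDifferential.map k k K L (m j)) i
              (KaehlerDifferential.map k k K L z) := by
          intro z
          ext1 j
          by_cases hj : j = i
          · subst hj; simp
          · simp [hj]
        simp only [h, map_add, AlternatingMap.map_update_add]
      map_update_smul' := by
        intro _ m i c x
        have h : ∀ z, (fun j => KaehlerDifferential.map k k K L (Function.update m i z j)) =
            Function.update (fun j => KaehlerDifferential.map k k K L (m j)) i
              (KaehlerDifferential.map k k K L z) := by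
          intro z
          ext1 j
          by_cases hj : j = i
          · subst hj; simp
          · simp [hj]
        simp only [h, map_smul]
        rw [← algebraMap_smul L c, AlternatingMap.map_update_smul, algebraMap_smul]
      map_eq_zero_of_eq' := by
        intro m i j hij hne
        exact AlternatingMap.map_eq_zero_of_eq _ _ (by simp [hij]) hne }

end Forms

/-! ## Varieties over the complex numbers -/

attribute [local instance] MvPolynomial.gradedAlgebra

/-- Projective `n`-space over `ℂ`. -/
def projSpace (n : ℕ) : Scheme.{0} :=
  Proj (MvPolynomial.homogeneousSubmodule (Fin (n + 1)) ℂ)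

/-- The structure morphism of projective `n`-space. -/
def projSpaceStr (n : ℕ) : projSpace n ⟶ Spec (.of ℂ) :=
  Proj.toSpecZero (MvPolynomial.homogeneousSubmodule (Fin (n + 1)) ℂ) ≫
    Spec.map (CommRingCat.ofHom
      (algebraMap ℂ (MvPolynomial.homogeneousSubmodule (Fin (n + 1)) ℂ 0)))

/-- A variety: an irreducible (and reduced) quasi-projective scheme over `ℂ`. -/
structure Variety where
  /-- the underlying scheme -/
  X : Scheme.{0}
  /-- the structure morphism -/
  str : X ⟶ Spec (.of ℂ)
  integral : IsIntegral X
  separated : IsSeparated str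
  finiteType : LocallyOfFiniteType str
  quasiProjective : ∃ (n : ℕ) (i : X ⟶ projSpace n), IsImmersion i ∧ i ≫ projSpaceStr n = str

attribute [instance] Variety.integral Variety.separated Variety.finiteType

namespace Variety

instance (X : Variety) : IsLocallyNoetherian X.X :=
  LocallyOfFiniteType.isLocallyNoetherian X.str

instance (X : Variety) : X.X.IsSeparated := by
  have h : terminal.from X.X = X.str ≫ terminal.from _ := Subsingleton.elim _ _
  refine ⟨?_⟩
  rw [h]
  infer_instance

/-- A morphism of varieties: a morphism of schemes over `ℂ`. -/
structure Hom (X Y : Variety) where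
  /-- the underlying morphism of schemes -/
  f : X.X ⟶ Y.X
  comm : f ≫ Y.str = X.str

/-- `X` is projective: it is a closed subscheme of some projective space over `ℂ`. -/
def IsProjective (X : Variety) : Prop :=
  ∃ (n : ℕ) (i : X.X ⟶ projSpace n), IsClosedImmersion i ∧ i ≫ projSpaceStr n = X.str

/-- `X` is normal: all its local rings are integrally closed. -/
def IsNormal (X : Variety) : Prop := ∀ x : X.X, IsIntegrallyClosed (X.X.presheaf.stalk x)

/-- The function field. -/
abbrev K (X : Variety) : Type := X.X.functionField

/-- The inclusion of the constants in the local rings. -/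
def constants (X : Variety) (x : X.X) : ℂ →+* X.X.presheaf.stalk x :=
  ((Scheme.ΓSpecIso (.of ℂ)).inv ≫ X.str.appTop ≫ X.X.presheaf.germ ⊤ x (TopologicalSpace.Opens.mem_top x)).hom

instance (X : Variety) : Algebra ℂ X.K := (X.constants (genericPoint X.X)).toAlgebra

/-- The dimension. -/
def dim (X : Variety) : WithBot ℕ∞ := topologicalKrullDim X.X

/-- The local ring of `X` at `x`, as a subring of the function field. -/
def localRing (X : Variety) (x : X.X) : Subring X.K :=
  (algebraMap (X.X.presheaf.stalk x) X.K).range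

/-- A nonempty open subset of a variety, as a variety. -/
def opens (X : Variety) (U : X.X.Opens) [Nonempty U] : Variety where
  X := U
  str := U.ι ≫ X.str
  integral := inferInstance
  separated := inferInstance
  finiteType := inferInstance
  quasiProjective := by
    obtain ⟨n, i, hi, h⟩ := X.quasiProjective
    exact ⟨n, U.ι ≫ i, inferInstance, by rw [Category.assoc, h]⟩

namespace Hom

variable {X Y : Variety}

/-- A projective morphism: it factors through a closed immersion into `Y × ℙⁿ`. -/
def IsProjective (f : Hom X Y) : Prop :=
  ∃ (n : ℕ) (i : X.X ⟶ pullback Y.str (projSpaceStr n)),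
    IsClosedImmersion i ∧ i ≫ pullback.fst Y.str (projSpaceStr n) = f.f

/-- A contraction: a projective morphism with `f_* 𝒪_X = 𝒪_Y`. -/
def IsContraction (f : Hom X Y) : Prop :=
  f.IsProjective ∧ ∀ U : Y.X.Opens, IsIso (f.f.app U)

theorem generic (f : Hom X Y) [IsDominant f.f] :
    f.f (genericPoint X.X) = genericPoint Y.X := by
  have h := (genericPoint_spec X.X).image f.f.continuous
  rw [Set.image_univ, f.f.denseRange.closure_range] at h
  exact h.eq (genericPoint_spec Y.X)

/-- Pull-back of rational functions along a dominant morphism. -/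
def fieldMap (f : Hom X Y) [IsDominant f.f] : Y.K →+* X.K :=
  (Y.X.presheaf.stalkSpecializes (specializes_of_eq f.generic) ≫
    f.f.stalkMap (genericPoint X.X)).hom

theorem fieldMap_algebraMap (f : Hom X Y) [IsDominant f.f] (c : ℂ) :
    f.fieldMap (algebraMap ℂ Y.K c) = algebraMap ℂ X.K c := by
  have h : (Y.X.presheaf.germ ⊤ (genericPoint Y.X) (TopologicalSpace.Opens.mem_top _) ≫
      Y.X.presheaf.stalkSpecializes (specializes_of_eq f.generic) ≫
        f.f.stalkMap (genericPoint X.X)) =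
      f.f.appTop ≫ X.X.presheaf.germ ⊤ (genericPoint X.X) (TopologicalSpace.Opens.mem_top _) := by
    rw [← Category.assoc]
    erw [TopCat.Presheaf.germ_stalkSpecializes]
    exact Scheme.Hom.germ_stalkMap f.f ⊤ _ (TopologicalSpace.Opens.mem_top _)
  have h2 : Y.str.appTop ≫ f.f.appTop = X.str.appTop := by
    rw [← Scheme.Hom.comp_appTop, f.comm]
  have h3 : (((Scheme.ΓSpecIso (.of ℂ)).inv ≫ Y.str.appTop ≫
      Y.X.presheaf.germ ⊤ (genericPoint Y.X) (TopologicalSpace.Opens.mem_top _)) ≫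
      Y.X.presheaf.stalkSpecializes (specializes_of_eq f.generic) ≫
        f.f.stalkMap (genericPoint X.X)) =
      (Scheme.ΓSpecIso (.of ℂ)).inv ≫ X.str.appTop ≫
        X.X.presheaf.germ ⊤ (genericPoint X.X) (TopologicalSpace.Opens.mem_top _) := by
    rw [Category.assoc, Category.assoc, h, ← h2, Category.assoc]
  exact congrArg (fun g => g.hom c) h3

/-- Pull-back of rational differential forms along a dominant morphism. -/
def pullbackForm (f : Hom X Y) [IsDominant f.f] (n : ℕ) (ω : Form ℂ Y.K n) : Form ℂ X.K n :=
  letI : Algebra Y.K X.K := f.fieldMap.toAlgebra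
  haveI : IsScalarTower ℂ Y.K X.K :=
    IsScalarTower.of_algebraMap_eq fun c => (f.fieldMap_algebraMap c).symm
  formMap ℂ Y.K X.K n ω

/-- A birational morphism: an isomorphism over a nonempty open subset of the target. -/
def IsBirational (f : Hom X Y) : Prop :=
  ∃ U : Y.X.Opens, (U : Set Y.X).Nonempty ∧ IsIso (f.f ∣_ U)

end Hom

/-! ## Divisors -/

/-- Prime divisors, given by their generic points: the points of codimension one. -/
abbrev PrimeDivisor (X : Variety) : Type := {x : X.X // coheight x = 1}

/-- `φ` is a local equation of the divisor `D` (given by its coefficients) near the point `y`. -/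
def IsLocalEquation (X : Variety) (D : X.PrimeDivisor → ℚ) (y : X.X) (φ : X.K) : Prop :=
  φ ≠ 0 ∧ ∃ U : X.X.Opens, y ∈ U ∧
    ∀ x : X.PrimeDivisor, x.1 ∈ U → (Scheme.ord φ x.1 : ℚ) = D x

/-- `D` is an (integral) Cartier divisor: it is locally principal. -/
def IsCartier (X : Variety) (D : X.PrimeDivisor → ℚ) : Prop :=
  ∀ y : X.X, ∃ φ : X.K, X.IsLocalEquation D y φ

/-- `D` is `ℚ`-Cartier: some positive multiple of it is Cartier. Such a `D` has only finitely many
nonzero coefficients, because `X` is quasi-compact. -/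
def IsQCartier (X : Variety) (D : X.PrimeDivisor → ℚ) : Prop :=
  ∃ m : ℕ, 0 < m ∧ X.IsCartier (m • D)

/-- The least positive `m` with `m D` Cartier (for a `ℚ`-Cartier divisor `D`). -/
def cartierIndex (X : Variety) (D : X.PrimeDivisor → ℚ) : ℕ :=
  sInf {m : ℕ | 0 < m ∧ X.IsCartier (m • D)}

/-- A local equation of a Cartier divisor near a point; it is unique up to a unit of the local ring
if `X` is normal. -/
def localEquation (X : Variety) (D : X.PrimeDivisor → ℚ) (y : X.X) : X.K :=
  Classical.epsilon fun φ => X.IsLocalEquation D y φ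

/-! ## The canonical divisor -/

/-- The order along `x` of a rational form `ω` of top degree: the order of `g`, where `ω = g θ`
with a generator `θ` of the regular forms at `x`. -/
def formOrd (X : Variety) {n : ℕ} (ω : Form ℂ X.K n) (x : X.PrimeDivisor) : ℤ :=
  Scheme.ord (Classical.epsilon fun g : X.K =>
    ∃ θ : Form ℂ X.K n,
      regularForms ℂ X.K n (X.localRing x.1) = Submodule.span (X.localRing x.1) {θ} ∧ ω = g • θ) x.1

/-- The degree of the top forms, that is, the dimension of `X`. -/
def formDegree (X : Variety) : ℕ := Module.finrank X.K (Ω[X.K⁄ℂ])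

/-- A chosen nonzero rational form of top degree. -/
def canonicalForm (X : Variety) : Form ℂ X.K X.formDegree := Classical.epsilon fun ω => ω ≠ 0

/-- The canonical divisor `K_X`: the divisor of a nonzero rational form of top degree. Another
choice of the form changes it by a principal divisor. -/
def canonicalDivisor (X : Variety) (x : X.PrimeDivisor) : ℚ := X.formOrd X.canonicalForm x

/-- The divisor `K_X + B`. -/
def logDivisor (X : Variety) (B : X.PrimeDivisor →₀ ℚ) (x : X.PrimeDivisor) : ℚ :=
  X.canonicalDivisor x + B x

/-- `(X, B)` is a pair. -/
structure IsPair (X : Variety) (B : X.PrimeDivisor →₀ ℚ) : Prop where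
  normal : X.IsNormal
  coeff : ∀ x, B x ∈ Set.Icc (0 : ℚ) 1
  qCartier : X.IsQCartier (X.logDivisor B)

/-! ## Kodaira dimension -/

/-- The rational functions in `H⁰(X, 𝒪_X(D))`, for an integral divisor `D` on a normal variety. -/
def sections (X : Variety) (D : X.PrimeDivisor → ℚ) : Set X.K :=
  {f | f ≠ 0 → ∀ x : X.PrimeDivisor, 0 ≤ (Scheme.ord f x.1 : ℚ) + D x}

/-- The dimension of the image of the rational map `φ_D` given by the sections of `D`: its function
field is generated over `ℂ` by the quotients of sections. -/
def imageDim (X : Variety) (D : X.PrimeDivisor → ℚ) : ℕ∞ :=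
  Cardinal.toENat (Algebra.trdeg ℂ (IntermediateField.adjoin ℂ
    {h : X.K | ∃ f ∈ X.sections D, ∃ g ∈ X.sections D, g ≠ 0 ∧ h = f / g}))

/-- The Kodaira dimension of an integral divisor; it is `⊥ = -∞` if no positive multiple of the
divisor has a nonzero section. -/
def kodairaDimInt (X : Variety) (D : X.PrimeDivisor → ℚ) : WithBot ℕ∞ :=
  ⨆ (m : ℕ) (_ : 0 < m ∧ ∃ f ∈ X.sections (m • D), f ≠ 0), (X.imageDim (m • D) : WithBot ℕ∞)

/-- The least positive `l` such that `l D` is integral. -/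
def denominator (X : Variety) (D : X.PrimeDivisor → ℚ) : ℕ :=
  sInf {l : ℕ | 0 < l ∧ ∀ x, ∃ z : ℤ, (l • D) x = z}

/-- The Kodaira dimension of a `ℚ`-divisor. -/
def kodairaDim (X : Variety) (D : X.PrimeDivisor → ℚ) : WithBot ℕ∞ :=
  X.kodairaDimInt (X.denominator D • D)

/-! ## Discrepancies -/

/-- For a dominant (birational) morphism `q : V → X` and a prime divisor `E` on `V`: the coefficient
of `E` in `A`, where `K_V = q^*(K_X + B) + A` and `K_V` is the divisor of the pull-back of the form
that defines `K_X`. -/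
def discrepancy {V X : Variety} (q : Hom V X) [IsDominant q.f] (B : X.PrimeDivisor →₀ ℚ)
    (E : V.PrimeDivisor) : ℚ :=
  let m := X.cartierIndex (X.logDivisor B)
  (V.formOrd (q.pullbackForm _ X.canonicalForm) E : ℚ) -
    (Scheme.ord (q.fieldMap (X.localEquation (m • X.logDivisor B) (q.f E.1))) E.1 : ℚ) / m

/-- `(X, B)` is a log canonical pair: every prime divisor over `X` has discrepancy at least `-1`. -/
def IsLC (X : Variety) (B : X.PrimeDivisor →₀ ℚ) : Prop :=
  X.IsPair B ∧ ∀ (V : Variety) (q : Hom V X) [IsDominant q.f], V.IsNormal → q.IsProjective →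
    q.IsBirational → ∀ E : V.PrimeDivisor, -1 ≤ discrepancy q B E

/-! ## Curves and the cone of curves -/

/-- A curve on `Y`: a one-dimensional closed subvariety. -/
structure Curve (Y : Variety) where
  /-- the curve -/
  C : Variety
  /-- its inclusion -/
  ι : Hom C Y
  closed : IsClosedImmersion ι.f
  dim_eq : C.dim = 1

/-- The restriction to a curve of a rational function that is regular at the generic point of the
curve. -/
def Curve.restrict {Y : Variety} (C : Curve Y) (φ : Y.K) : C.C.K :=
  (C.ι.f.stalkMap (genericPoint C.C.X)).hom (Classical.epsilon fun u =>
    algebraMap (Y.X.presheaf.stalk (C.ι.f (genericPoint C.C.X))) Y.K u = φ)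

/-- The degree of a Cartier divisor `D` on a curve `C`. With a local equation `φ` of `D` at the
generic point of `C`, the linearly equivalent divisor `D - div φ` does not contain `C`; its
restriction to `C` has, near a point `p`, the restriction of `φ_p / φ` as a local equation. -/
def cartierDegree {Y : Variety} (D : Y.PrimeDivisor → ℚ) (C : Curve Y) : ℤ :=
  ∑ᶠ p : C.C.X, Scheme.ord (C.restrict
    (Y.localEquation D (C.ι.f p) / Y.localEquation D (C.ι.f (genericPoint C.C.X)))) p

/-- The intersection number `D · C` of a `ℚ`-Cartier divisor and a curve. -/
def intersection {Y : Variety} (D : Y.PrimeDivisor → ℚ) (C : Curve Y) : ℚ :=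
  (cartierDegree (Y.cartierIndex D • D) C : ℚ) / Y.cartierIndex D

/-- The `ℚ`-Cartier divisors. -/
abbrev QCartierDivisor (Y : Variety) : Type := {D : Y.PrimeDivisor → ℚ // Y.IsQCartier D}

/-- The real one-cycle `∑ aᵢ Cᵢ` is sent to the function `D ↦ ∑ aᵢ (D · Cᵢ)` on `ℚ`-Cartier
divisors; its kernel consists of the cycles that are numerically trivial. -/
def numericalClass (Y : Variety) : (Curve Y →₀ ℝ) →ₗ[ℝ] (Y.QCartierDivisor → ℝ) :=
  Finsupp.linearCombination ℝ fun C D => (intersection D.1 C : ℝ)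

/-- `N₁(Y)`: real one-cycles modulo numerical equivalence, realised as the image of
`numericalClass`. Its topology is induced by pointwise convergence, which is the usual topology of
this finite-dimensional space. -/
abbrev N1 (Y : Variety) : Submodule ℝ (Y.QCartierDivisor → ℝ) := LinearMap.range Y.numericalClass

/-- The class of a curve. -/
def Curve.cls {Y : Variety} (C : Curve Y) : Y.N1 :=
  ⟨Y.numericalClass (Finsupp.single C 1), LinearMap.mem_range_self _ _⟩

/-- The closed cone of curves. -/
def NEbar (Y : Variety) : PointedCone ℝ Y.N1 :=
  (PointedCone.hull ℝ (Set.range (Curve.cls (Y := Y)))).closure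

/-- An extremal ray of the closed cone of curves: a one-dimensional extremal face. -/
structure IsExtremalRay (Y : Variety) (R : PointedCone ℝ Y.N1) : Prop where
  le : R ≤ Y.NEbar
  extremal : ∀ x ∈ Y.NEbar, ∀ y ∈ Y.NEbar, x + y ∈ R → x ∈ R ∧ y ∈ R
  dim_eq : Module.finrank ℝ (Submodule.span ℝ (R : Set Y.N1)) = 1

/-- `f` is the contraction of the extremal ray `R`: it is a contraction, and it maps a curve to a
point exactly if the class of the curve is in `R`. -/
def IsContractionOf {Y Z : Variety} (f : Hom Y Z) (R : PointedCone ℝ Y.N1) : Prop :=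
  f.IsContraction ∧
    ∀ C : Curve Y, (∃ z : Z.X, ∀ p : C.C.X, f.f (C.ι.f p) = z) ↔ C.cls ∈ R

/-! ## Mori fibre spaces -/

/-- `g : Y → Z` is a `(K_Y + B_Y)`-negative extremal contraction of fibre type, where `(Y, B_Y)` is
a projective log canonical pair. -/
structure IsMoriFibration {Y Z : Variety} (B : Y.PrimeDivisor →₀ ℚ) (g : Hom Y Z) : Prop where
  projective : Y.IsProjective
  lc : Y.IsLC B
  extremal : ∃ R : PointedCone ℝ Y.N1, Y.IsExtremalRay R ∧
    (∀ z ∈ R, z ≠ 0 → z.1 ⟨Y.logDivisor B, lc.1.qCartier⟩ < 0) ∧ IsContractionOf g R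
  dim_lt : Z.dim < Y.dim

section BirationalMap

variable {X Y : Variety} (f : X.X.PartialIso Y.X)

/-- The domain of definition of the rational map given by `f`. -/
def domain : X.X.Opens := f.toRationalMap.domain

/-- The morphism on the domain of definition of the rational map given by `f`. -/
def onDomain : (domain f).toScheme ⟶ Y.X := f.toRationalMap.toPartialMap.hom

instance : Nonempty (domain f) := by
  obtain ⟨x, hx⟩ := f.toRationalMap.dense_domain.nonempty
  exact ⟨⟨x, hx⟩⟩

instance : IsDominant (onDomain f) := by
  have h1 : IsDominant f.toPartialMap.hom := by
    have := Opens.isDominant_ι f.dense_target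
    dsimp only [Scheme.PartialIso.toPartialMap]
    infer_instance
  have h2 : f.toRationalMap.toPartialMap.toRationalMap.IsDominant := by
    rw [Scheme.RationalMap.toRationalMap_toPartialMap]
    infer_instance
  exact (Scheme.PartialMap.isDominant_toRationalMap_iff _).1 h2

/-- The rational map given by `f` is regular at `x` and maps `x` to `y`. -/
def Sends (x : X.X) (y : Y.X) : Prop := ∃ h : x ∈ domain f, onDomain f ⟨x, h⟩ = y

/-- The inclusion of the domain of definition. -/
def domainIncl : Hom (X.opens (domain f)) X  where
  f := (domain f).ι
  comm := rfl

theorem onDomain_over (hf : f.IsOver X.str Y.str) :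
    onDomain f ≫ Y.str = (X.opens (domain f)).str := by
  let : X.X.Over (Spec (.of ℂ)) := ⟨X.str⟩
  let : Y.X.Over (Spec (.of ℂ)) := ⟨Y.str⟩
  have h1 : f.toPartialMap.IsOver (Spec (.of ℂ)) := by
    constructor
    change (f.iso.hom ≫ f.target.ι) ≫ Y.str = f.source.ι ≫ X.str
    rw [Category.assoc]
    exact hf
  have h2 : f.toRationalMap.IsOver (Spec (.of ℂ)) := inferInstance
  have h3 : f.toRationalMap.toPartialMap.IsOver (Spec (.of ℂ)) := inferInstance
  exact h3.comp_over

/-- The birational map `f`, as a morphism of varieties on its domain of definition. -/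
def domainHom (hf : f.IsOver X.str Y.str) : Hom (X.opens (domain f)) Y where
  f := onDomain f
  comm := onDomain_over f hf

instance : IsDominant (domainIncl f).f := by
  exact Opens.isDominant_ι f.toRationalMap.dense_domain

instance (hf : f.IsOver X.str Y.str) : IsDominant (domainHom f hf).f :=
  inferInstanceAs (IsDominant (onDomain f))

end BirationalMap

/-- `g : Y → Z`, with the birational map `f : X ⇢ Y` over `ℂ`, is a Mori fibre space for `(X, B)`.
* `lc`: `(X, B)` is log canonical.
* `fibration`: `g` is a `(K_Y + B_Y)`-negative extremal contraction of fibre type.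
* `inv_noContract`: the inverse of `f` does not contract any divisors.
* `push`: `B_Y = f_* B`, that is, the coefficient of `B_Y` at a prime divisor of `Y` is the
  coefficient of `B` at the birational transform of this divisor on `X`.
* `discrepancy_lt`: `d(E, X, B) < d(E, Y, B_Y)` for each prime divisor `E` on `X` contracted by `f`
  (the domain of definition of `f` contains all points of codimension one of `X`). -/
structure IsMoriFibreSpaceFor {X Y Z : Variety} (B : X.PrimeDivisor →₀ ℚ)
    (BY : Y.PrimeDivisor →₀ ℚ) (f : X.X.PartialIso Y.X) (g : Hom Y Z) : Prop where
  lc : X.IsLC B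
  fibration : IsMoriFibration BY g
  isOver : f.IsOver X.str Y.str
  inv_noContract : ∀ y : Y.PrimeDivisor, ∃ x : X.PrimeDivisor, Sends f.symm y.1 x.1
  push : ∀ (y : Y.PrimeDivisor) (x : X.PrimeDivisor), Sends f.symm y.1 x.1 → BY y = B x
  discrepancy_lt : ∀ E : (X.opens (domain f)).PrimeDivisor, coheight (onDomain f E.1) ≠ 1 →
    discrepancy (domainIncl f) B E < discrepancy (domainHom f isOver) BY E

/-- `(X, B)` has a Mori fibre space. -/
def HasMoriFibreSpace (X : Variety) (B : X.PrimeDivisor →₀ ℚ) : Prop :=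
  ∃ (Y Z : Variety) (BY : Y.PrimeDivisor →₀ ℚ) (f : X.X.PartialIso Y.X) (g : Hom Y Z),
    IsMoriFibreSpaceFor B BY f g

end Variety

end

end MoriFibre

/-! Suppose that `N(K_X + B)` with `N > 0` has a nonzero section `s`. Each prime divisor of `Y` is
the birational transform of a prime divisor of `X` with the same valuation. At such pairs of
divisors `K_X` and `K_Y` differ by the divisor of one rational function `k`. Since `B_Y = f_* B`,
the function `s / k ^ N` is a nonzero section of `N(K_Y + B_Y)`
(`IsMoriFibreSpaceFor.exists_section`).

On `Y`, the inequality `dim Z < dim Y` yields a curve `C` in a fibre of `g` whose generic point lies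
in a prescribed neighbourhood of the generic point of `Y` (`exists_curve_in_fibre`), so `C` can be
kept out of the zero divisor of the section. Restricting the section to `C` gives `(K_Y + B_Y) · C ≥
0` (`IsNormal.exists_curve_intersection_nonneg`). But the class of `C` lies in the ray `R` and is
nonzero, which forces a negative number (`IsMoriFibration.sections_eq_zero`).

Three facts support this. Principal divisors on a projective, possibly singular, curve have degree
zero (`sum_ord_eq_zero`), because the zeros of `u` and those of `u⁻¹` both number `[K : ℂ(u)]`. The
class of a curve is not zero (`Curve.cls_ne_zero`), because some hypersurface meets it properly. At
a codimension one point of a normal variety the regular top forms are free of rank one over the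
local ring (`IsNormal.exists_regularForms_eq_span`), so the order of a form does not depend on the
chosen generator. -/

/-! ### Commutative algebra: Hartogs, dimension, lengths and ranks. -/

/-- Algebraic Hartogs. If `f ∉ R`, the denominators of `f` lie in an associated prime `P` of `K /
R`, the annihilator of some class `t`. Integral closedness forces `P` to have height one, and then a
denominator of `f` outside `P` is a contradiction. -/
theorem mem_range_algebraMap_of_height_one {R K : Type*} [CommRing R] [IsDomain R]
    [IsNoetherianRing R] [IsIntegrallyClosed R] [Field K] [Algebra R K] [IsFractionRing R K]
    (f : K) (hf : ∀ q : Ideal R, q.IsPrime → q.height = 1 →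
      ∃ r s : R, s ∉ q ∧ f * algebraMap R K s = algebraMap R K r) :
    ∃ r, algebraMap R K r = f := by
  by_contra hne
  let N : Submodule R K := LinearMap.range (Algebra.linearMap R K)
  have hx : (Submodule.Quotient.mk f : K ⧸ N) ≠ 0 := by
    rw [Ne, Submodule.Quotient.mk_eq_zero]
    rintro ⟨r, hr⟩
    exact hne ⟨r, hr⟩
  obtain ⟨P, hP, hle⟩ := exists_le_isAssociatedPrime_of_isNoetherianRing R _ hx
  have hprime := hP.isPrime
  obtain ⟨-, m, hm⟩ := isAssociatedPrime_iff.1 hP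
  obtain ⟨t, rfl⟩ := Submodule.Quotient.mk_surjective _ m
  have hPt : ∀ r, r ∈ P ↔ ∃ a, algebraMap R K a = algebraMap R K r * t := by
    intro r
    rw [hm, Submodule.mem_colon_singleton, ← Submodule.Quotient.mk_smul, Submodule.mem_bot, Submodule.Quotient.mk_eq_zero,
      Algebra.smul_def]
    exact Iff.rfl
  have hPf : ∀ r, (∃ a, algebraMap R K a = algebraMap R K r * f) → r ∈ P := by
    intro r ⟨a, ha⟩
    apply hle
    rw [Submodule.mem_colon_singleton, ← Submodule.Quotient.mk_smul, Submodule.mem_bot, Submodule.Quotient.mk_eq_zero,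
      Algebra.smul_def]
    exact ⟨a, ha⟩
  have ht : ¬ ∃ a, algebraMap R K a = t := by
    rintro ⟨a, ha⟩
    exact hprime.one_notMem ((hPt 1).2 ⟨a, by simpa using ha⟩)
  obtain ⟨c, b, hb, hcb⟩ := IsFractionRing.div_surjective (A := R) t
  have hb0 : b ≠ 0 := nonZeroDivisors.ne_zero hb
  have hbK : algebraMap R K b ≠ 0 := by simpa using hb0
  have hbP : b ∈ P := (hPt b).2 ⟨c, by rw [← hcb]; field_simp⟩
  -- Every `π * t` with `π ∈ P` lies in `R`. If all of them were in `P`, then `t` would stabilise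
  -- the nonzero finitely generated module `P`, hence be integral over `R`.
  have key : ∃ π ∈ P, ∃ s ∉ P, algebraMap R K s = algebraMap R K π * t := by
    by_contra! h
    apply ht
    have : IsIntegral R t := by
      refine isIntegral_of_smul_mem_submodule (Submodule.map (Algebra.linearMap R K) P) ?_ ?_ t ?_
      · rw [Submodule.ne_bot_iff]
        exact ⟨_, ⟨b, hbP, rfl⟩, hbK⟩
      · exact Submodule.FG.map _ (IsNoetherian.noetherian _)
      · rintro _ ⟨r, hr, rfl⟩
        obtain ⟨a, ha⟩ := (hPt r).1 hr
        refine ⟨a, by_contra fun h' => h r hr a h' ha, ?_⟩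
        simp [ha, mul_comm]
    exact IsIntegrallyClosed.algebraMap_eq_of_integral this
  obtain ⟨π, hπ, s, hs, hst⟩ := key
  -- For `z ∈ P` one has `s z = (z t) π`; a prime `Q ≤ P` containing `π` contains `s z` but not `s`.
  -- Krull's principal ideal theorem then bounds the height of `P`.
  have hmin : P ∈ (Ideal.span {π}).minimalPrimes := by
    refine ⟨⟨hprime, by simpa [Ideal.span_le] using hπ⟩, ?_⟩
    rintro Q ⟨hQ, hQπ⟩ hQP z hz
    obtain ⟨a, ha⟩ := (hPt z).1 hz
    have : s * z = a * π := by
      apply IsFractionRing.injective R K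
      rw [map_mul, map_mul, ha, hst]; ring
    have h2 : s * z ∈ Q := this ▸ Q.mul_mem_left _ (hQπ (Ideal.mem_span_singleton_self _))
    exact (hQ.mem_or_mem h2).resolve_left fun h => hs (hQP h)
  have h1 : P.height ≤ 1 := Ideal.height_le_one_of_isPrincipal_of_mem_minimalPrimes _ _ hmin
  have h2 : P.height ≠ 0 := by
    intro h
    rw [Ideal.height_eq_zero_iff_eq_bot] at h
    rw [h] at hbP
    exact hb0 hbP
  obtain ⟨r, s', hs', h⟩ := hf P hprime (le_antisymm h1 (Order.one_le_iff_ne_zero.2 h2))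
  exact hs' (hPf s' ⟨r, by rw [← h, mul_comm]⟩)

/-- Incomparability keeps chains of primes strict under contraction; lying over and going up lift
chains. -/
theorem ringKrullDim_eq_of_isIntegral {R S : Type*} [CommRing R] [CommRing S] [IsDomain S] [Algebra R S]
    [Algebra.IsIntegral R S] [FaithfulSMul R S] : ringKrullDim S = ringKrullDim R := by
  apply le_antisymm
  · refine Order.krullDim_le_of_strictMono (PrimeSpectrum.comap (algebraMap R S)) ?_
    intro I J h
    exact Ideal.IsIntegral.comap_lt_comap (R := R) h
  · rw [ringKrullDim, Order.krullDim]
    refine iSup_le fun l => ?_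
    obtain ⟨Q, hQ, hQ'⟩ := Ideal.exists_ideal_over_prime_of_isIntegral_of_isDomain (S := S) l.head.asIdeal (by
      rw [(RingHom.injective_iff_ker_eq_bot _).1 (FaithfulSMul.algebraMap_injective R S)]
      exact bot_le)
    have : Q.LiesOver (RelSeries.head l).asIdeal := ⟨hQ'.symm⟩
    obtain ⟨L, hL, -⟩ := Ideal.exists_ltSeries_of_hasGoingUp l Q
    rw [← hL]
    exact L.length_le_krullDim

open Algebra in
-- Noether normalization: both invariants equal the number of variables of the polynomial ring.
theorem ringKrullDim_eq_trdeg (k A K : Type) [Field k] [CommRing A] [IsDomain A] [Algebra k A]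
    [Algebra.FiniteType k A] [Field K] [Algebra k K] [Algebra A K] [IsScalarTower k A K] [IsFractionRing A K] :
    ∃ n : ℕ, ringKrullDim A = n ∧ Algebra.trdeg k K = n := by
  obtain ⟨s, g, hg, hf⟩ := exists_integral_inj_algHom_of_fg k A
  refine ⟨s, ?_, ?_⟩
  · algebraize [g.toRingHom]
    have : FaithfulSMul (MvPolynomial (Fin s) k) A := (faithfulSMul_iff_algebraMap_injective _ _).2 hg
    have : Algebra.IsIntegral (MvPolynomial (Fin s) k) A := ⟨hf⟩
    rw [ringKrullDim_eq_of_isIntegral (R := MvPolynomial (Fin s) k), MvPolynomial.ringKrullDim_of_isNoetherianRing]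
    simp
  · algebraize [g.toRingHom]
    have : FaithfulSMul (MvPolynomial (Fin s) k) A := (faithfulSMul_iff_algebraMap_injective _ _).2 hg
    have : Algebra.IsIntegral (MvPolynomial (Fin s) k) A := ⟨hf⟩
    have : IsScalarTower k (MvPolynomial (Fin s) k) A := IsScalarTower.of_algebraMap_eq fun x => (g.commutes x).symm
    have : FaithfulSMul k A := inferInstance
    have h1 := trdeg_add_eq k (MvPolynomial (Fin s) k) (A := A)
    have : FaithfulSMul A K := inferInstance
    have h2 := trdeg_add_eq k A (A := K)
    have : Algebra.IsAlgebraic A K := IsLocalization.isAlgebraic K (nonZeroDivisors A)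
    rw [← h2, ← h1, MvPolynomial.trdeg_of_isDomain, trdeg_eq_zero, trdeg_eq_zero]
    simp

/-- The affine form of finding a curve in a fibre. For a maximal ideal `m` of `B` of full height,
the fibre through `m` has positive dimension because the base is too small to account for the height
of `m`. A non-maximal prime of that fibre, as large as possible, defines a curve. -/
theorem exists_isPrime_ringKrullDim_quotient_eq_one (k A B : Type) [Field k] [CommRing A]
    [CommRing B] [IsDomain B] [Algebra k A] [Algebra k B] [Algebra.FiniteType k A]
    [Algebra.FiniteType k B] [Algebra A B] [IsScalarTower k A B]
    (h : ringKrullDim A < ringKrullDim B) :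
    ∃ P : Ideal B, P.IsPrime ∧ (P.under A).IsMaximal ∧ ringKrullDim (B ⧸ P) = 1 := by
  have hA : IsNoetherianRing A := Algebra.FiniteType.isNoetherianRing k A
  have hB : IsNoetherianRing B := Algebra.FiniteType.isNoetherianRing k B
  have : Algebra.FiniteType A B := Algebra.FiniteType.of_restrictScalars_finiteType k A B
  have : IsJacobsonRing A := isJacobsonRing_of_finiteType (A := k)
  obtain ⟨n, hn, -⟩ := ringKrullDim_eq_trdeg k B (FractionRing B)
  have : FiniteRingKrullDim B := by
    rw [finiteRingKrullDim_iff_ne_bot_and_top, hn]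
    exact ⟨by simp, fun h => ENat.natCast_ne_top n (WithBot.coe_injective h)⟩
  obtain ⟨m, hm, hmd⟩ := Ideal.exists_isMaximal_height (R := B)
  have hn0 : (m.under A).IsMaximal := by
    let := Ideal.Quotient.field m
    have : Algebra.FiniteType A (B ⧸ m) := .trans (S := B) inferInstance inferInstance
    have := finite_of_finite_type_of_isJacobsonRing A (B ⧸ m)
    have h2 := Ideal.isMaximal_comap_of_isIntegral_of_isMaximal (R := A) (⊥ : Ideal (B ⧸ m))
    convert! h2
    ext x
    rw [Ideal.mem_comap, Ideal.mem_comap, IsScalarTower.algebraMap_apply A B (B ⧸ m), Ideal.mem_bot,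
      Ideal.Quotient.algebraMap_eq, Ideal.Quotient.eq_zero_iff_mem]
  have hle := Ideal.height_le_height_add_of_liesOver (m.under A) m
  have hlt : (m.under A).height < m.height := by
    have h1 : ((m.under A).height : WithBot ℕ∞) < m.height := by
      rw [hmd]
      exact (Ideal.height_le_ringKrullDim_of_ne_top hn0.ne_top).trans_lt h
    exact_mod_cast h1
  set I := (m.under A).map (algebraMap A B) with hI
  have hIm : I ≤ m := Ideal.map_comap_le
  -- Otherwise `m` is minimal over `I`, and the fibre term in `hle` vanishes, contrary to `hlt`.
  obtain ⟨P0, hP0, hIP0, hP0m⟩ : ∃ P : Ideal B, P.IsPrime ∧ I ≤ P ∧ P < m := by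
    by_contra! hc
    have hmin : m.map (Ideal.Quotient.mk I) ∈ minimalPrimes (B ⧸ I) := by
      have : m ∈ I.minimalPrimes := by
        refine ⟨⟨hm.isPrime, hIm⟩, fun Q hQ hQm => ?_⟩
        exact (eq_of_le_of_not_lt hQm (hc Q hQ.1 hQ.2)).ge
      rw [Ideal.minimalPrimes_eq_comap] at this
      obtain ⟨q, hq, hqm⟩ := this
      rw [← hqm, Ideal.map_comap_of_surjective _ Ideal.Quotient.mk_surjective]
      exact hq
    have := hmin.1.1
    rw [Ideal.height_eq_zero_iff.2 hmin, add_zero] at hle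
    exact absurd hlt hle.not_gt
  let S : Set (Ideal B) := {P | P.IsPrime ∧ I ≤ P ∧ ¬ P.IsMaximal}
  obtain ⟨P, ⟨hP, hIP, hPm⟩, hmax⟩ := set_has_maximal_iff_noetherian.2 hB S
    ⟨P0, hP0, hIP0, fun h' => hm.ne_top (h'.1.2 _ hP0m)⟩
  refine ⟨P, hP, ?_, ?_⟩
  · have : Ideal.under A m ≤ Ideal.under A P := Ideal.map_le_iff_le_comap.1 hIP
    have e : Ideal.under A m = Ideal.under A P :=
      hn0.eq_of_le (Ideal.comap_ne_top _ hP.ne_top) this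
    exact e ▸ hn0
  · have h1 : Ring.KrullDimLE 1 (B ⧸ P) := by
      have : (⊥ : Ideal (B ⧸ P)).IsPrime := Ideal.isPrime_bot
      refine Ring.krullDimLE_one_iff_of_isPrime_bot.2 fun Q hQ0 hQ => ?_
      have hc : ((Q.comap (Ideal.Quotient.mk P))).IsMaximal := by
        by_contra hc
        refine hmax _ ⟨inferInstance, ?_, hc⟩ ?_
        · refine hIP.trans ?_
          intro x hx
          simp [Ideal.mem_comap, Ideal.Quotient.eq_zero_iff_mem.2 hx]
        · refine lt_of_le_of_ne (fun x hx => by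
            simp [Ideal.mem_comap, Ideal.Quotient.eq_zero_iff_mem.2 hx]) fun he => hQ0 ?_
          rw [eq_bot_iff]
          intro y hy
          obtain ⟨y, rfl⟩ := Ideal.Quotient.mk_surjective y
          have : y ∈ Q.comap (Ideal.Quotient.mk P) := hy
          rw [← he] at this
          exact Ideal.Quotient.eq_zero_iff_mem.2 this
      rw [← Ideal.map_comap_of_surjective _ Ideal.Quotient.mk_surjective Q]
      exact (Ideal.map_eq_top_or_isMaximal_of_surjective _ Ideal.Quotient.mk_surjective hc).resolve_left
        (by rw [Ideal.map_comap_of_surjective _ Ideal.Quotient.mk_surjective]; exact hQ.ne_top)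
    refine le_antisymm (by simpa using Ring.krullDimLE_iff.1 h1) ?_
    by_contra hlt
    have h0 : Ring.KrullDimLE 0 (B ⧸ P) := by
      rw [Ring.krullDimLE_iff]
      exact ENat.WithBot.lt_add_one_iff.mp (by simpa using hlt)
    exact hPm (Ideal.Quotient.maximal_of_isField _ Ring.KrullDimLE.isField_of_isDomain)

/-- The length of the quotient of a localization as a local factor of the quotient. -/
theorem ord_localization_eq_length {A : Type*} [CommRing A] (u : A)
    (m : Ideal (A ⧸ Ideal.span {u})) [m.IsPrime] (Ap : Type*) [CommRing Ap] [Algebra A Ap]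
    [IsLocalization.AtPrime Ap (m.comap (Ideal.Quotient.mk (Ideal.span {u})))] :
    Ring.ord Ap (algebraMap A Ap u) =
      Module.length (Localization.AtPrime m) (Localization.AtPrime m) := by
  set p := m.comap (Ideal.Quotient.mk (Ideal.span {u})) with hp
  let g : A →+* Localization.AtPrime m :=
    (algebraMap (A ⧸ Ideal.span {u}) (Localization.AtPrime m)).comp (Ideal.Quotient.mk _)
  let f : Ap →+* Localization.AtPrime m := IsLocalization.lift (M := p.primeCompl) (g := g) fun s =>
    IsLocalization.map_units (M := m.primeCompl) (Localization.AtPrime m) ⟨Ideal.Quotient.mk _ s.1, s.2⟩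
  have hfa : ∀ a, f (algebraMap A Ap a) = g a := fun a => IsLocalization.lift_eq _ _
  have hf : Function.Surjective f := by
    intro x
    obtain ⟨b, t, rfl⟩ := IsLocalization.exists_mk'_eq m.primeCompl x
    obtain ⟨a, rfl⟩ := Ideal.Quotient.mk_surjective b
    obtain ⟨t, ht⟩ := t
    obtain ⟨s, rfl⟩ := Ideal.Quotient.mk_surjective t
    refine ⟨IsLocalization.mk' Ap a (⟨s, ht⟩ : p.primeCompl), ?_⟩
    rw [IsLocalization.eq_mk'_iff_mul_eq]
    have := congrArg f (IsLocalization.mk'_spec Ap a (⟨s, ht⟩ : p.primeCompl))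
    rw [map_mul, hfa, hfa] at this
    exact this
  have hk : RingHom.ker f = Ideal.span {algebraMap A Ap u} := by
    apply le_antisymm
    · intro x hx
      obtain ⟨a, s, rfl⟩ := IsLocalization.exists_mk'_eq p.primeCompl x
      have h1 : g a = 0 := by
        rw [← hfa, ← IsLocalization.mk'_spec Ap a s, map_mul, (RingHom.mem_ker).1 hx, zero_mul]
      obtain ⟨⟨t, ht⟩, h2⟩ := (IsLocalization.map_eq_zero_iff m.primeCompl (Localization.AtPrime m) _).1 h1
      obtain ⟨t, rfl⟩ := Ideal.Quotient.mk_surjective t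
      have h3 : t * a ∈ Ideal.span {u} := by
        rw [← Ideal.Quotient.eq_zero_iff_mem, map_mul]; exact h2
      obtain ⟨c, hc⟩ := Ideal.mem_span_singleton'.1 h3
      have htu : IsUnit (algebraMap A Ap t) :=
        IsLocalization.map_units (M := p.primeCompl) Ap ⟨t, ht⟩
      have hsu : IsUnit (algebraMap A Ap s) := IsLocalization.map_units (M := p.primeCompl) Ap s
      rw [← (Ideal.span {algebraMap A Ap u}).unit_mul_mem_iff_mem htu,
        ← (Ideal.span {algebraMap A Ap u}).unit_mul_mem_iff_mem hsu]
      have : algebraMap A Ap s * (algebraMap A Ap t * IsLocalization.mk' Ap a s) =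
          algebraMap A Ap c * algebraMap A Ap u := by
        rw [mul_left_comm, IsLocalization.mk'_spec', ← map_mul, ← map_mul, hc]
      rw [this]
      exact Ideal.mul_mem_left _ _ (Ideal.mem_span_singleton_self _)
    · rw [Ideal.span_le, Set.singleton_subset_iff, SetLike.mem_coe, RingHom.mem_ker, hfa]
      simp [g]
  algebraize [f]
  have e : (Ap ⧸ Ideal.span {algebraMap A Ap u}) ≃ₗ[Ap] Localization.AtPrime m :=
    (Submodule.quotEquivOfEq _ _ hk.symm) ≪≫ₗ
      (LinearMap.quotKerEquivOfSurjective (Algebra.linearMap Ap (Localization.AtPrime m)) hf)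
  rw [Ring.ord, e.length_eq, Module.length_eq_of_surjective (R := Localization.AtPrime m) hf]

/-- The residue field of `R` is `k` itself. This turns orders, which are lengths over local rings,
into vector space dimensions. -/
theorem length_self_eq_length_of_isAlgClosed (k R : Type) [Field k] [IsAlgClosed k] [CommRing R]
    [IsLocalRing R] [Algebra k R] [Module.Finite k R] :
    Module.length R R = Module.length k R := by
  have hloc : IsLocalHom (algebraMap k R) := inferInstance
  rw [IsLocalRing.length_restrictScalars k R R]
  have h1 : Function.Surjective (algebraMap k (IsLocalRing.ResidueField k)) :=
    IsLocalRing.residue_surjective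
  have h3 : Module.Finite k (IsLocalRing.ResidueField R) :=
    Module.Finite.of_surjective (IsScalarTower.toAlgHom k R (IsLocalRing.ResidueField R)).toLinearMap
      IsLocalRing.residue_surjective
  have h2 : Function.Bijective (algebraMap k (IsLocalRing.ResidueField R)) :=
    IsAlgClosed.algebraMap_bijective_of_isIntegral
  have : Module.length (IsLocalRing.ResidueField k) (IsLocalRing.ResidueField R) = 1 := by
    rw [← Module.length_eq_of_surjective (S := k) h1,
      ← (LinearEquiv.ofBijective (Algebra.linearMap k (IsLocalRing.ResidueField R)) h2).length_eq,
      Module.length_eq_finrank]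
    simp
  rw [this, mul_one]

/-- In dimension at most one the quotient by `u ≠ 0` is Artinian, hence the product of its
localizations at maximal ideals. -/
theorem length_quotient_eq_sum_ord (k A : Type) [Field k] [IsAlgClosed k] [CommRing A] [IsDomain A]
    [Algebra k A] [Algebra.FiniteType k A] [Ring.KrullDimLE 1 A] {u : A} (hu : u ≠ 0) :
    Finite (MaximalSpectrum (A ⧸ Ideal.span {u})) ∧ Module.Finite k (A ⧸ Ideal.span {u}) ∧
    Module.length k (A ⧸ Ideal.span {u}) =
      ∑ᶠ m : MaximalSpectrum (A ⧸ Ideal.span {u}), Module.length (Localization.AtPrime m.asIdeal) (Localization.AtPrime m.asIdeal) := by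
  have hA : IsNoetherianRing A := Algebra.FiniteType.isNoetherianRing k A
  set B := A ⧸ Ideal.span {u}
  have : IsArtinianRing B := by
    have h := isFiniteLength_quotient_span_singleton A (mem_nonZeroDivisors_of_ne_zero hu)
    rw [isFiniteLength_iff_isNoetherian_isArtinian] at h
    exact isArtinian_of_tower A h.2
  have hfin : Module.Finite k B := (Module.finite_iff_isArtinianRing k B).2 this
  have hM : Finite (MaximalSpectrum B) := inferInstance
  refine ⟨hM, hfin, ?_⟩
  cases nonempty_fintype (MaximalSpectrum B)
  let e := (MaximalSpectrum.toPiLocalizationEquiv B).toLinearEquiv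
  have : ∀ m : MaximalSpectrum B, Module.Finite k (Localization.AtPrime m.asIdeal) := fun m =>
    Module.Finite.of_surjective (IsScalarTower.toAlgHom k B (Localization.AtPrime m.asIdeal)).toLinearMap (by
      intro x
      classical
      obtain ⟨b, hb⟩ := e.surjective (Pi.single m x)
      refine ⟨b, ?_⟩
      have := congrFun hb m
      rw [Pi.single_eq_same] at this
      exact this)
  rw [finsum_eq_sum_of_fintype, (e.restrictScalars k).length_eq, Module.length_pi_of_fintype]
  exact Finset.sum_congr rfl fun m _ => (length_self_eq_length_of_isAlgClosed k _).symm

open Polynomial in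
-- By `hint`, `A` is finite over the polynomial ring `k[u]`; being torsion-free over a principal
-- ideal domain it is free. Its rank can be read off both at `u = 0` and at the generic point.
theorem finrank_quotient_eq_finrank_adjoin (k A K : Type) [Field k] [CommRing A] [IsDomain A]
    [Algebra k A] [Algebra.FiniteType k A] [Field K] [Algebra k K] [Algebra A K]
    [IsScalarTower k A K] [IsFractionRing A K] (u : A)
    (hu : Transcendental k (algebraMap A K u))
    (hint : ∀ a : A, IsIntegral (Algebra.adjoin k {algebraMap A K u}) (algebraMap A K a)) :
    Module.finrank k (A ⧸ Ideal.span {u}) =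
      Module.finrank (IntermediateField.adjoin k {algebraMap A K u}) K := by
  have hinjAK : Function.Injective (algebraMap A K) := IsFractionRing.injective A K
  have huA : Transcendental k u := fun h => hu (h.algebraMap)
  let _ : Algebra k[X] A := (aeval (R := k) u).toAlgebra
  have : IsScalarTower k k[X] A := IsScalarTower.of_algebraMap_eq fun x => by
    change _ = aeval u (C x); simp
  have hXu : algebraMap k[X] A X = u := aeval_X u
  have hinj : Function.Injective (algebraMap k[X] A) := transcendental_iff_injective.1 huA
  have : FaithfulSMul k[X] A := (faithfulSMul_iff_algebraMap_injective _ _).2 hinj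
  have : Module.IsTorsionFree k[X] A := inferInstance
  let _ : Algebra k[X] K := (aeval (R := k) (algebraMap A K u)).toAlgebra
  have : IsScalarTower k[X] A K := IsScalarTower.of_algebraMap_eq fun x => by
    change aeval _ x = algebraMap A K (aeval u x)
    rw [aeval_algebraMap_apply]
  have hI : Algebra.IsIntegral k[X] A := by
    refine ⟨fun a => ?_⟩
    have h1 := hint a
    have h3 : IsIntegral k[X] (algebraMap A K a) := by
      obtain ⟨p, hp, hp0⟩ := h1
      let φ : k[X] →+* Algebra.adjoin k {algebraMap A K u} :=
        ((aeval (R := k) (algebraMap A K u)).codRestrict (Algebra.adjoin k {algebraMap A K u})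
          fun x => aeval_mem_adjoin_singleton k (algebraMap A K u)).toRingHom
      have hφ : Function.Surjective φ := by
        rintro ⟨z, hz⟩
        have hz' := hz
        rw [Algebra.adjoin_singleton_eq_range_aeval] at hz'
        obtain ⟨q, hq⟩ := hz'
        exact ⟨q, Subtype.ext hq⟩
      obtain ⟨q, hq, -, hqm⟩ := Polynomial.lifts_and_natDegree_eq_and_monic
        ((Polynomial.mem_lifts p).2 (Polynomial.map_surjective φ hφ p)) hp
      refine ⟨q, hqm, ?_⟩
      rw [← hq, eval₂_map] at hp0
      exact hp0
    exact (isIntegral_algebraMap_iff hinjAK).1 h3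
  have : Algebra.FiniteType k[X] A := Algebra.FiniteType.of_restrictScalars_finiteType k k[X] A
  have : Module.Finite k[X] A := Algebra.IsIntegral.finite
  have : Module.Free k[X] A := inferInstance
  have e1 : Module.finrank k (A ⧸ Ideal.span {u}) = Module.finrank k[X] A := by
    let I : Ideal k[X] := Ideal.span {X}
    have hIu : I.map (algebraMap k[X] A) = Ideal.span {u} := by
      rw [Ideal.map_span, Set.image_singleton, hXu]
    have hsm : (I • ⊤ : Submodule k[X] A) = (Ideal.span {u}).restrictScalars k[X] := by
      rw [← hIu, Ideal.smul_top_eq_map]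
    let e : (TensorProduct k[X] (k[X] ⧸ I) A) ≃ₗ[k[X]] (A ⧸ Ideal.span {u}) :=
      (TensorProduct.quotTensorEquivQuotSMul A I) ≪≫ₗ
        (Submodule.quotEquivOfEq _ _ hsm) ≪≫ₗ (Submodule.Quotient.restrictScalarsEquiv k[X] _)
    have e0 := (Polynomial.quotientSpanXSubCAlgEquiv (0 : k)).toLinearEquiv
    rw [map_zero, sub_zero] at e0
    have : Nontrivial (k[X] ⧸ I) := e0.toEquiv.nontrivial
    rw [← (e.restrictScalars k).finrank_eq, ← Module.finrank_mul_finrank k (k[X] ⧸ I),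
      Module.finrank_baseChange]
    have : Module.finrank k (k[X] ⧸ I) = 1 := by
      rw [e0.finrank_eq, Module.finrank_self]
    rw [this, one_mul]
  rw [e1]
  set v := algebraMap A K u with hv
  let _ : Algebra k[X] (IntermediateField.adjoin k {v}) :=
    (aeval (R := k) (IntermediateField.AdjoinSimple.gen k v)).toAlgebra
  have hcoe : ∀ p : k[X], ((algebraMap k[X] (IntermediateField.adjoin k {v}) p : IntermediateField.adjoin k {v}) : K) = aeval v p := by
    intro p
    change ((aeval (IntermediateField.AdjoinSimple.gen k v) p : IntermediateField.adjoin k {v}) : K) = _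
    exact (aeval_algebraMap_apply K (IntermediateField.AdjoinSimple.gen k v) p).symm
  have : IsScalarTower k[X] (IntermediateField.adjoin k {v}) K :=
    IsScalarTower.of_algebraMap_eq fun x => (hcoe x).symm
  have : FaithfulSMul k[X] (IntermediateField.adjoin k {v}) := by
    refine (faithfulSMul_iff_algebraMap_injective _ _).2 fun p q h => ?_
    have := congrArg (fun z : IntermediateField.adjoin k {v} => (z : K)) h
    simp only [hcoe] at this
    exact transcendental_iff_injective.1 hu this
  have : IsFractionRing k[X] (IntermediateField.adjoin k {v}) := by
    refine .of_field _ _ fun ⟨z, hz⟩ => ?_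
    obtain ⟨r, s, h⟩ := (IntermediateField.mem_adjoin_simple_iff k z).1 hz
    refine ⟨r, s, Subtype.ext ?_⟩
    change z = ((algebraMap k[X] (IntermediateField.adjoin k {v}) r : IntermediateField.adjoin k {v}) : K) /
      ((algebraMap k[X] (IntermediateField.adjoin k {v}) s : IntermediateField.adjoin k {v}) : K)
    rw [hcoe, hcoe]
    exact h
  exact (IsFractionRing.finrank_eq k[X] (IntermediateField.adjoin k {v}) A K).symm

/-! ### Local rings inside the function field, and orders of vanishing. -/

namespace MoriFibre.Variety

variable {X : Variety}

theorem localRing_mono {x y : X.X} (h : x ⤳ y) : X.localRing y ≤ X.localRing x := by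
  rintro _ ⟨a, rfl⟩
  refine ⟨(X.X.presheaf.stalkSpecializes h).hom a, ?_⟩
  change (X.X.presheaf.stalkSpecializes h ≫ X.X.presheaf.stalkSpecializes _).hom a = _
  rw [TopCat.Presheaf.stalkSpecializes_comp]
  rfl

theorem localRing_generic : X.localRing (genericPoint X.X) = ⊤ := by
  refine eq_top_iff.2 fun f _ => ⟨f, ?_⟩
  change (X.X.presheaf.stalkSpecializes (specializes_rfl (x := genericPoint X.X))).hom f = f
  rw [TopCat.Presheaf.stalkSpecializes_refl]
  rfl

theorem germ_mem_localRing {U : X.X.Opens} [Nonempty U] {x : X.X} (hx : x ∈ U) (a : Γ(X.X, U)) :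
    X.X.germToFunctionField U a ∈ X.localRing x :=
  ⟨X.X.presheaf.germ U x hx a, Scheme.algebraMap_germ_eq_germToFunctionField X.X hx a⟩

theorem exists_germ_of_mem_localRing {x : X.X} {f : X.K} (hf : f ∈ X.localRing x) :
    ∃ (U : X.X.Opens) (_ : x ∈ U) (_ : Nonempty U) (a : Γ(X.X, U)),
      X.X.germToFunctionField U a = f := by
  obtain ⟨g, rfl⟩ := hf
  obtain ⟨U, hU, a, rfl⟩ := X.X.presheaf.exists_germ_eq g
  have : Nonempty U := ⟨⟨x, hU⟩⟩
  exact ⟨U, hU, this, a, (Scheme.algebraMap_germ_eq_germToFunctionField X.X hU a).symm⟩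

theorem exists_opens_mem_localRing {x : X.X} {f : X.K} (hf : f ∈ X.localRing x) :
    ∃ U : X.X.Opens, x ∈ U ∧ ∀ y ∈ U, f ∈ X.localRing y := by
  obtain ⟨U, hU, _, a, rfl⟩ := exists_germ_of_mem_localRing hf
  exact ⟨U, hU, fun y hy => germ_mem_localRing hy a⟩

theorem algebraMap_mem_localRing (x : X.X) (c : ℂ) : algebraMap ℂ X.K c ∈ X.localRing x := by
  have : Nonempty (⊤ : X.X.Opens) := ⟨⟨x, trivial⟩⟩
  exact germ_mem_localRing (U := ⊤) (x := x) trivial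
    (((Scheme.ΓSpecIso (.of ℂ)).inv ≫ X.str.appTop).hom c)

theorem mem_localRing_iff_of_isAffineOpen {U : X.X.Opens} (hU : IsAffineOpen U) [Nonempty U]
    {x : X.X} (hx : x ∈ U) {f : X.K} :
    f ∈ X.localRing x ↔ ∃ a s : Γ(X.X, U), s ∉ (hU.primeIdealOf ⟨x, hx⟩).asIdeal ∧
      f * X.X.germToFunctionField U s = X.X.germToFunctionField U a := by
  let := X.X.presheaf.algebra_section_stalk ⟨x, hx⟩
  have hloc := hU.isLocalization_stalk ⟨x, hx⟩
  have hT := functionField_isScalarTower X.X U ⟨x, hx⟩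
  have hger (a : Γ(X.X, U)) : algebraMap (X.X.presheaf.stalk x) X.K (algebraMap Γ(X.X, U) (X.X.presheaf.stalk x) a) = X.X.germToFunctionField U a :=
    Scheme.algebraMap_germ_eq_germToFunctionField X.X hx a
  constructor
  · rintro ⟨g, rfl⟩
    obtain ⟨⟨a, s⟩, h⟩ := IsLocalization.surj (hU.primeIdealOf ⟨x, hx⟩).asIdeal.primeCompl g
    refine ⟨a, s, s.2, ?_⟩
    rw [← hger, ← hger, ← map_mul, h]
  · rintro ⟨a, s, hs, h⟩
    have hu := IsLocalization.map_units (X.X.presheaf.stalk x) (⟨s, hs⟩ : (hU.primeIdealOf ⟨x, hx⟩).asIdeal.primeCompl)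
    obtain ⟨u, hu⟩ := hu
    refine ⟨algebraMap _ _ a * ↑u⁻¹, ?_⟩
    rw [map_mul, hger, ← h, ← hger]
    change _ * algebraMap _ _ (algebraMap Γ(X.X, U) (X.X.presheaf.stalk x) s) * _ = _
    have hu' : (u : X.X.presheaf.stalk x) = algebraMap Γ(X.X, U) (X.X.presheaf.stalk x) s := hu
    rw [← hu', mul_assoc, ← map_mul, Units.mul_inv, map_one, mul_one]

theorem inv_germ_mem_localRing_iff {U : X.X.Opens} (hU : IsAffineOpen U) [Nonempty U]
    {x : X.X} (hx : x ∈ U) {s : Γ(X.X, U)} (hs : s ≠ 0) :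
    (X.X.germToFunctionField U s)⁻¹ ∈ X.localRing x ↔ s ∉ (hU.primeIdealOf ⟨x, hx⟩).asIdeal := by
  have hne : X.X.germToFunctionField U s ≠ 0 :=
    (map_ne_zero_iff _ (Scheme.germToFunctionField_injective X.X U)).2 hs
  rw [mem_localRing_iff_of_isAffineOpen hU hx]
  constructor
  · rintro ⟨a, t, ht, h⟩ hs'
    rw [inv_mul_eq_iff_eq_mul₀ hne, ← map_mul] at h
    rw [Scheme.germToFunctionField_injective X.X U h] at ht
    exact ht (Ideal.mul_mem_right _ _ hs')
  · intro h
    exact ⟨1, s, h, by rw [inv_mul_cancel₀ hne, map_one]⟩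

theorem ord_nonneg {x : X.X} {f : X.K} (hf : f ∈ X.localRing x) : 0 ≤ Scheme.ord f x := by
  by_cases hx : coheight x = 1
  · by_cases h0 : f = 0
    · simp [h0]
    rw [Scheme.le_ord_iff hx h0]
    obtain ⟨g, rfl⟩ := hf
    have : Ring.KrullDimLE 1 (X.X.presheaf.stalk x) := krullDimLE_of_coheight_le hx.le
    exact Ring.ordFrac_ge_one_of_ne_zero (fun h => h0 (by rw [h, map_zero]))
  · rw [Scheme.ord_eq_zero_of_coheight_neq_one hx]

theorem ord_one (x : X.X) : Scheme.ord (1 : X.K) x = 0 := by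
  have := Scheme.ord_mul (x := x) (one_ne_zero (α := X.K)) one_ne_zero
  rw [mul_one] at this
  omega

theorem ord_inv (x : X.X) (f : X.K) : Scheme.ord f⁻¹ x = - Scheme.ord f x := by
  by_cases h : f = 0
  · simp [h]
  have := Scheme.ord_mul (x := x) h (inv_ne_zero h)
  rw [mul_inv_cancel₀ h, ord_one] at this
  omega

theorem ord_div {x : X.X} {f g : X.K} (hf : f ≠ 0) (hg : g ≠ 0) :
    Scheme.ord (f / g) x = Scheme.ord f x - Scheme.ord g x := by
  rw [div_eq_mul_inv, Scheme.ord_mul hf (inv_ne_zero hg), ord_inv]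
  ring

theorem ord_pow (x : X.X) (f : X.K) (n : ℕ) : Scheme.ord (f ^ n) x = n * Scheme.ord f x := by
  by_cases h : f = 0
  · rcases n with _ | n
    · simp [ord_one]
    · simp [h]
  induction n with
  | zero => simp [ord_one]
  | succ n ih => rw [pow_succ, Scheme.ord_mul (pow_ne_zero _ h) h, ih]; push_cast; ring

theorem ord_eq_zero {x : X.X} {f : X.K} (hf : f ∈ X.localRing x) (hf' : f⁻¹ ∈ X.localRing x) :
    Scheme.ord f x = 0 := by
  have h1 := ord_nonneg hf
  have h2 := ord_nonneg hf'
  rw [ord_inv] at h2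
  omega

theorem isUnit_of_inv_mem {x : X.X} {a : X.X.presheaf.stalk x} (ha : a ≠ 0)
    (h : (algebraMap (X.X.presheaf.stalk x) X.K a)⁻¹ ∈ X.localRing x) : IsUnit a := by
  obtain ⟨b, hb⟩ := h
  have hne : algebraMap (X.X.presheaf.stalk x) X.K a ≠ 0 :=
    (map_ne_zero_iff _ (IsFractionRing.injective _ _)).2 ha
  refine IsUnit.of_mul_eq_one b (IsFractionRing.injective (X.X.presheaf.stalk x) X.K ?_)
  rw [map_mul, hb, mul_inv_cancel₀ hne, map_one]

theorem ord_algebraMap {x : X.X} (hx : coheight x = 1) {a : X.X.presheaf.stalk x} (ha : a ≠ 0) :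
    Ring.ord (X.X.presheaf.stalk x) a =
      ((Scheme.ord (algebraMap (X.X.presheaf.stalk x) X.K a) x).toNat : ℕ∞) := by
  have : Ring.KrullDimLE 1 (X.X.presheaf.stalk x) := krullDimLE_of_coheight_le hx.le
  have hne : algebraMap (X.X.presheaf.stalk x) X.K a ≠ 0 :=
    (map_ne_zero_iff _ (IsFractionRing.injective _ _)).2 ha
  obtain ⟨m, hm⟩ := ENat.ne_top_iff_exists.mp
    (Ring.ord_ne_top (mem_nonZeroDivisors_of_ne_zero ha))
  have h2 : Scheme.ord (algebraMap (X.X.presheaf.stalk x) X.K a) x = m := by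
    rw [Scheme.ord_eq_iff hx hne]
    change Ring.ordFrac (X.X.presheaf.stalk x) _ = _
    rw [Ring.ordFrac_eq_ord _ ha, Ring.ordMonoidWithZeroHom_eq_coe _ (mem_nonZeroDivisors_of_ne_zero ha) hm.symm]
  rw [h2, ← hm]
  simp

/-- The order is the length of a quotient, which vanishes only for units. Normality plays no role,
so this applies to singular curves. -/
theorem ord_pos {x : X.X} (hx : coheight x = 1) {f : X.K} (h0 : f ≠ 0) (hf : f ∈ X.localRing x)
    (hf' : f⁻¹ ∉ X.localRing x) : 0 < Scheme.ord f x := by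
  obtain ⟨a, rfl⟩ := hf
  have ha : a ≠ 0 := fun h => h0 (by rw [h, map_zero])
  have h1 := ord_algebraMap hx ha
  by_contra hle
  have h2 : (Scheme.ord (algebraMap (X.X.presheaf.stalk x) X.K a) x).toNat = 0 := by omega
  rw [h2, Nat.cast_zero, Ring.ord, Module.length_eq_zero_iff, Ideal.Quotient.subsingleton_iff,
    Ideal.span_singleton_eq_top] at h1
  apply hf'
  obtain ⟨b, hb⟩ := h1.exists_right_inv
  refine ⟨b, ?_⟩
  refine eq_inv_of_mul_eq_one_right ?_
  rw [← map_mul, hb, map_one]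

theorem IsNormal.isDiscreteValuationRing (hX : X.IsNormal) {x : X.X} (hx : coheight x = 1) :
    IsDiscreteValuationRing (X.X.presheaf.stalk x) := by
  have h1 := hX x
  have h2 : Ring.KrullDimLE 1 (X.X.presheaf.stalk x) := krullDimLE_of_coheight_le hx.le
  have hnf : ¬ IsField (X.X.presheaf.stalk x) := by
    intro h
    have h3 := ringKrullDim_stalk_eq_coheight x
    rw [ringKrullDim_eq_zero_of_isField h, hx] at h3
    exact absurd h3 (by simp)
  have h3 : Ring.DimensionLEOne (X.X.presheaf.stalk x) := by
    refine ⟨fun {p} hp0 hp => ?_⟩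
    exact hp.isMaximal_of_ne_bot hp0
  have h4 : IsDedekindRing (X.X.presheaf.stalk x) := {  }
  have h5 : IsDedekindDomain (X.X.presheaf.stalk x) := { }
  exact ((IsDiscreteValuationRing.TFAE (X.X.presheaf.stalk x) hnf).out 0 2).2 h5

theorem IsNormal.mem_localRing_iff (hX : X.IsNormal) {x : X.X} (hx : coheight x = 1) {f : X.K} :
    f ∈ X.localRing x ↔ 0 ≤ Scheme.ord f x := by
  refine ⟨ord_nonneg, fun h => ?_⟩
  by_cases h0 : f = 0
  · rw [h0]; exact zero_mem _
  have := hX.isDiscreteValuationRing hx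
  by_cases hf : f ∈ X.localRing x
  · exact hf
  have h3 : f⁻¹ ∈ X.localRing x := by
    rcases ValuationRing.isInteger_or_isInteger (X.X.presheaf.stalk x) f with h | h
    · exact absurd h hf
    · exact h
  have := ord_pos hx (inv_ne_zero h0) h3 (by rwa [inv_inv])
  rw [ord_inv] at this
  omega

/-- The dictionary between height one primes of the local ring at `y` and prime divisors through
`y`, read off in an affine chart. -/
theorem exists_specializes_of_height_one (y : X.X) (q : Ideal (X.X.presheaf.stalk y)) [q.IsPrime]
    (hq : q.height = 1) : ∃ x : X.X, coheight x = 1 ∧ x ⤳ y ∧ ∀ f ∈ X.localRing x,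
      ∃ r s : X.X.presheaf.stalk y, s ∉ q ∧ f * algebraMap _ X.K s = algebraMap _ X.K r := by
  obtain ⟨_, ⟨U, hU, rfl⟩, hyU, -⟩ :=
    X.X.isBasis_affineOpens.exists_subset_of_mem_open (Set.mem_univ y) isOpen_univ
  have hU : IsAffineOpen U := hU
  have : Nonempty U := ⟨⟨y, hyU⟩⟩
  let := X.X.presheaf.algebra_section_stalk ⟨y, hyU⟩
  have hloc := hU.isLocalization_stalk ⟨y, hyU⟩
  let p : Spec Γ(X.X, U) := ⟨q.comap (algebraMap Γ(X.X, U) (X.X.presheaf.stalk y)), inferInstance⟩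
  let x := hU.fromSpec p
  have hxU : x ∈ U := by
    have : x ∈ Set.range hU.fromSpec := ⟨p, rfl⟩
    rwa [hU.range_fromSpec] at this
  have hp : hU.primeIdealOf ⟨x, hxU⟩ = p := by
    apply hU.fromSpec.isOpenEmbedding.injective
    exact hU.fromSpec_primeIdealOf ⟨x, hxU⟩
  refine ⟨x, ?_, ?_, ?_⟩
  · rw [show coheight x = coheight p from coheight_eq_of_isOpenImmersion hU.fromSpec, ← idealHeight_eq_coheight, ← hq]
    exact IsLocalization.height_under (hU.primeIdealOf ⟨y, hyU⟩).asIdeal.primeCompl q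
  · have h1 : p ⤳ hU.primeIdealOf ⟨y, hyU⟩ := by
      refine (PrimeSpectrum.le_iff_specializes p (hU.primeIdealOf ⟨y, hyU⟩)).1 ?_
      have := IsLocalization.AtPrime.isLocalRing (X.X.presheaf.stalk y) (hU.primeIdealOf ⟨y, hyU⟩).asIdeal
      change q.comap _ ≤ _
      refine (Ideal.comap_mono (IsLocalRing.le_maximalIdeal (Ideal.IsPrime.ne_top inferInstance))).trans ?_
      exact (IsLocalization.AtPrime.under_maximalIdeal (X.X.presheaf.stalk y) (hU.primeIdealOf ⟨y, hyU⟩).asIdeal).le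
    have h2 := h1.map hU.fromSpec.continuous
    rw [hU.fromSpec_primeIdealOf] at h2
    exact h2
  · intro f hf
    obtain ⟨a, s, hs, h⟩ := (mem_localRing_iff_of_isAffineOpen hU hxU).1 hf
    rw [hp] at hs
    refine ⟨algebraMap _ _ a, algebraMap _ _ s, hs, ?_⟩
    erw [Scheme.algebraMap_germ_eq_germToFunctionField X.X hyU a,
      Scheme.algebraMap_germ_eq_germToFunctionField X.X hyU s]
    exact h

/-- `mem_range_algebraMap_of_height_one` in geometric form. It makes local equations unique up to
units and turns sections of divisors into regular functions. -/
theorem IsNormal.mem_localRing_of_ord_nonneg (hX : X.IsNormal) (y : X.X) {f : X.K}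
    (hf : ∀ x : X.X, coheight x = 1 → x ⤳ y → 0 ≤ Scheme.ord f x) : f ∈ X.localRing y := by
  have := hX y
  refine mem_range_algebraMap_of_height_one (R := X.X.presheaf.stalk y) f fun q hq hq1 => ?_
  obtain ⟨x, hx, hxy, h⟩ := exists_specializes_of_height_one y q hq1
  exact h f ((hX.mem_localRing_iff hx).2 (hf x hx hxy))

end MoriFibre.Variety

/-! ### Dimension, affine charts over the complex numbers, and points of curves. -/

namespace MoriFibre.Variety

/-- The inclusion of the constants in the sections over an open subset. -/
noncomputable abbrev sectionsAlgebra (X : Variety) (U : X.X.Opens) : Algebra ℂ Γ(X.X, U) :=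
  ((Scheme.ΓSpecIso (.of ℂ)).inv ≫ X.str.appTop ≫ X.X.presheaf.map (homOfLE le_top).op).hom.toAlgebra

attribute [local instance] sectionsAlgebra

variable {X : Variety}

instance (U : X.X.Opens) [Nonempty U] : IsScalarTower ℂ Γ(X.X, U) X.K := by
  refine IsScalarTower.of_algebraMap_eq fun c => ?_
  have h : X.X.presheaf.map (homOfLE (le_top : U ≤ ⊤)).op ≫ X.X.germToFunctionField U =
      X.X.presheaf.germ ⊤ (genericPoint X.X) trivial := by
    rw [Scheme.germToFunctionField, TopCat.Presheaf.germ_res]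
  change _ = ((Scheme.ΓSpecIso (.of ℂ)).inv ≫ X.str.appTop ≫ X.X.presheaf.map (homOfLE le_top).op ≫ X.X.germToFunctionField U).hom c
  rw [h]
  rfl

theorem finiteType_sections {U : X.X.Opens} (hU : IsAffineOpen U) :
    Algebra.FiniteType ℂ Γ(X.X, U) := by
  have h := LocallyOfFiniteType.finiteType_appLE X.str (isAffineOpen_top (Spec (.of ℂ))) hU (by simp)
  have h2 := h.comp (RingHom.FiniteType.of_surjective (Scheme.ΓSpecIso (.of ℂ)).inv.hom
    (Scheme.ΓSpecIso (.of ℂ)).commRingCatIsoToRingEquiv.symm.surjective)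
  exact h2

theorem exists_isAffineOpen_mem (x : X.X) : ∃ U : X.X.Opens, IsAffineOpen U ∧ x ∈ U := by
  obtain ⟨_, ⟨U, hU, rfl⟩, hyU, -⟩ :=
    X.X.isBasis_affineOpens.exists_subset_of_mem_open (Set.mem_univ x) isOpen_univ
  exact ⟨U, hU, hyU⟩

theorem topologicalKrullDim_eq_iSup_stalk (S : Scheme) : topologicalKrullDim S =
    ⨆ x : S, ringKrullDim (S.presheaf.stalk x) := by
  rw [topologicalKrullDim, Order.krullDim_eq_of_orderIso (irreducibleSetEquivPoints (α := S)),
    Order.krullDim_eq_iSup_coheight]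
  exact iSup_congr fun x => (ringKrullDim_stalk_eq_coheight x).symm

/-- All nonempty affine charts share one function field, so by `ringKrullDim_eq_trdeg` they have the
same dimension. -/
theorem exists_dim_eq (X : Variety) : ∃ n : ℕ, X.dim = n ∧ Algebra.trdeg ℂ X.K = n ∧
    ∀ U : X.X.Opens, IsAffineOpen U → Nonempty U → ringKrullDim Γ(X.X, U) = n := by
  have key : ∀ U : X.X.Opens, IsAffineOpen U → Nonempty U → ∃ n : ℕ,
      ringKrullDim Γ(X.X, U) = n ∧ Algebra.trdeg ℂ X.K = n := by
    intro U hU hne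
    have := finiteType_sections hU
    have := functionField_isFractionRing_of_isAffineOpen X.X U hU
    exact ringKrullDim_eq_trdeg ℂ Γ(X.X, U) X.K
  obtain ⟨U, hU, hxU⟩ := X.exists_isAffineOpen_mem (genericPoint X.X)
  obtain ⟨n, h1, h2⟩ := key U hU ⟨_, hxU⟩
  have h3 : ∀ U : X.X.Opens, IsAffineOpen U → Nonempty U → ringKrullDim Γ(X.X, U) = n := by
    intro V hV hne
    obtain ⟨m, h3, h4⟩ := key V hV hne
    rw [h2, Nat.cast_inj] at h4
    rw [h3, h4]
  refine ⟨n, le_antisymm ?_ ?_, h2, h3⟩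
  · rw [dim, topologicalKrullDim_eq_iSup_stalk]
    refine iSup_le fun x => ?_
    obtain ⟨V, hV, hxV⟩ := X.exists_isAffineOpen_mem x
    let := X.X.presheaf.algebra_section_stalk ⟨x, hxV⟩
    have hloc := hV.isLocalization_stalk ⟨x, hxV⟩
    rw [← h3 V hV ⟨_, hxV⟩]
    rw [IsLocalization.AtPrime.ringKrullDim_eq_height (hV.primeIdealOf ⟨x, hxV⟩).asIdeal]
    exact Ideal.height_le_ringKrullDim_of_ne_top (Ideal.IsPrime.ne_top inferInstance)
  · rw [← h1, ← PrimeSpectrum.topologicalKrullDim_eq_ringKrullDim]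
    exact hU.fromSpec.isOpenEmbedding.isInducing.topologicalKrullDim_le

theorem coheight_le_dim (x : X.X) : (coheight x : WithBot ℕ∞) ≤ X.dim := by
  rw [dim, topologicalKrullDim_eq_iSup_stalk, ← ringKrullDim_stalk_eq_coheight]
  exact le_iSup (fun x => ringKrullDim (X.X.presheaf.stalk x)) x

theorem coheight_eq_zero_iff {x : X.X} : coheight x = 0 ↔ x = genericPoint X.X := by
  rw [coheight_eq_zero]
  constructor
  · intro h
    exact (Specializes.antisymm (h (b := genericPoint X.X) (genericPoint_specializes x))
      (genericPoint_specializes x)).eq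
  · rintro rfl
    exact fun b hb => (genericPoint_specializes b)

theorem coheight_eq_one_of_dim_eq_one (hX : X.dim = 1) {x : X.X} (hx : x ≠ genericPoint X.X) :
    coheight x = 1 := by
  have h1 := coheight_le_dim x
  rw [hX] at h1
  have h1' : coheight x ≤ 1 := by exact_mod_cast h1
  refine le_antisymm h1' ?_
  rw [Order.one_le_iff_ne_zero]
  exact fun h => hx (coheight_eq_zero_iff.1 h)

theorem isClosed_singleton_of_dim_eq_one (hX : X.dim = 1) {x : X.X} (hx : x ≠ genericPoint X.X) :
    IsClosed {x} := by
  rw [← closure_subset_iff_isClosed]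
  intro y hy
  have hxy : x ⤳ y := specializes_iff_mem_closure.2 hy
  by_contra hne
  have hlt : y < x := lt_of_le_not_ge hxy fun h => hne (Specializes.antisymm h hxy).eq
  have h1 := coheight_eq_one_of_dim_eq_one hX hx
  have h2 := coheight_le_dim y
  rw [hX] at h2
  have h2' : coheight y ≤ 1 := by exact_mod_cast h2
  have h3 := Order.coheight_add_one_le hlt
  rw [h1] at h3
  exact absurd (h3.trans h2') (by decide)

theorem exists_algebraMap_eq_of_isAlgebraic {f : X.K} (hf : IsAlgebraic ℂ f) :
    ∃ c : ℂ, algebraMap ℂ X.K c = f := by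
  have : Algebra.IsAlgebraic ℂ (IntermediateField.adjoin ℂ {f}) :=
    IntermediateField.isAlgebraic_adjoin_simple hf.isIntegral
  have h := IntermediateField.eq_bot_of_isAlgClosed_of_isAlgebraic (IntermediateField.adjoin ℂ {f})
  have h2 := IntermediateField.mem_adjoin_simple_self ℂ f
  rw [h] at h2
  exact h2

end MoriFibre.Variety

/-! ### Morphisms to projective space in homogeneous coordinates. -/

namespace MoriFibre

attribute [local instance] MvPolynomial.gradedAlgebra Variety.sectionsAlgebra

/-- Used to match the constants of projective space with those of the function field of `X`. -/
theorem toSpecZero_appTop_map {A : Type} [CommRing A] [Algebra ℂ A] (𝒜 : ℕ → Submodule ℂ A)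
    [GradedAlgebra 𝒜] (f : A) {m : ℕ} (hf : f ∈ 𝒜 m) (hm : 0 < m) :
    (Proj.toSpecZero 𝒜).appTop ≫ (Proj 𝒜).presheaf.map
      (homOfLE (le_top : Proj.basicOpen 𝒜 f ≤ ⊤)).op =
    (Scheme.ΓSpecIso _).hom ≫
      CommRingCat.ofHom (HomogeneousLocalization.fromZeroRingHom 𝒜 (Submonoid.powers f)) ≫
        Proj.awayToSection 𝒜 f := by
  have h1 : (Proj.basicOpen 𝒜 f).ι ≫ Proj.toSpecZero 𝒜 = (Proj.basicOpen 𝒜 f).toSpecΓ ≫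
      Spec.map (CommRingCat.ofHom (HomogeneousLocalization.fromZeroRingHom 𝒜 (Submonoid.powers f)) ≫
        Proj.awayToSection 𝒜 f) := by
    have h := Proj.awayι_toSpecZero 𝒜 f hf hm
    rw [← Proj.basicOpenIsoSpec_inv_ι, Category.assoc, Iso.inv_comp_eq,
      Proj.basicOpenIsoSpec_hom, Proj.basicOpenToSpec, Category.assoc, ← Spec.map_comp] at h
    exact h
  have h2 := congrArg (fun φ => Scheme.Hom.appTop φ ≫ (Proj.basicOpen 𝒜 f).topIso.hom) h1
  simp only [Scheme.Hom.comp_appTop, Scheme.Opens.toSpecΓ_appTop, Category.assoc, Iso.inv_hom_id,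
    Category.comp_id, Scheme.ΓSpecIso_naturality] at h2
  rw [← h2]
  congr 1

/-- The homogeneous coordinate functions of degree `d`. -/
noncomputable abbrev forms (n d : ℕ) : Submodule ℂ (MvPolynomial (Fin (n + 1)) ℂ) :=
  MvPolynomial.homogeneousSubmodule (Fin (n + 1)) ℂ d

namespace Variety

/-- The inclusion of a local ring in the function field. -/
noncomputable abbrev stalkToK (X : Variety) (x : X.X) : X.X.presheaf.stalk x →+* X.K :=
  algebraMap (X.X.presheaf.stalk x) X.K

variable {X : Variety} {n : ℕ} (i : X.X ⟶ projSpace n)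

/-- The homogeneous prime ideal of the image of a point. -/
noncomputable def primeOf (x : X.X) : Ideal (MvPolynomial (Fin (n + 1)) ℂ) :=
  ProjectiveSpectrum.asHomogeneousIdeal (𝒜 := forms n) (i x) |>.toIdeal

instance (x : X.X) : (primeOf i x).IsPrime :=
  ProjectiveSpectrum.isPrime (𝒜 := forms n) (i x)

/-- The map on local rings induced by a morphism to projective space. -/
noncomputable def stalkHom (x : X.X) :
    HomogeneousLocalization.AtPrime (forms n) (primeOf i x) →+* X.X.presheaf.stalk x :=
  ((Proj.stalkIso (forms n) (i x)).inv ≫ i.stalkMap x).hom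

instance (x : X.X) : IsLocalHom (stalkHom i x) := by
  have h1 : IsLocalHom (Proj.stalkIso (forms n) (i x)).inv.hom := isLocalHom_of_isIso _
  have h2 : IsLocalHom (i.stalkMap x).hom := inferInstance
  exact @RingHom.isLocalHom_comp _ _ _ _ _ _ (i.stalkMap x).hom
    (Proj.stalkIso (forms n) (i x)).inv.hom h2 h1

theorem stalkHom_surjective [SurjectiveOnStalks i] (x : X.X) :
    Function.Surjective (stalkHom i x) := by
  intro z
  obtain ⟨y, rfl⟩ := i.stalkMap_surjective x z
  refine ⟨(Proj.stalkIso (forms n) (i x)).hom y, ?_⟩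
  change (i.stalkMap x).hom (((Proj.stalkIso (forms n) (i x)).hom ≫ (Proj.stalkIso (forms n) (i x)).inv).hom y) = _
  rw [Iso.hom_inv_id]
  rfl

theorem stalkHom_mapId {G : MvPolynomial (Fin (n + 1)) ℂ} {x : X.X} (hG : G ∉ primeOf i x)
    (z : HomogeneousLocalization.Away (forms n) G) :
    stalkHom i x (HomogeneousLocalization.mapId (forms n) (Submonoid.powers_le.mpr hG) z) =
      X.X.presheaf.germ (i ⁻¹ᵁ Proj.basicOpen (forms n) G) x hG
        ((i.app (Proj.basicOpen (forms n) G)).hom ((Proj.awayToSection (forms n) G).hom z)) := by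
  have h := ProjectiveSpectrum.Proj.awayToSection_germ (forms n) G (i x) hG
  have h2 := congrArg (fun φ => (i.stalkMap x).hom (φ.hom z)) h
  refine h2.symm.trans ?_
  exact Scheme.Hom.germ_stalkMap_apply i (Proj.basicOpen (forms n) G) x hG _

/-- Both sides come from germs of a single section over the preimage of the locus `G ≠ 0`. -/
theorem algebraMap_stalkHom_mapId {G : MvPolynomial (Fin (n + 1)) ℂ} {x y : X.X} (hG : G ∉ primeOf i x)
    (hG' : G ∉ primeOf i y) (z : HomogeneousLocalization.Away (forms n) G) :
    algebraMap (X.X.presheaf.stalk x) X.K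
      (stalkHom i x (HomogeneousLocalization.mapId (forms n) (Submonoid.powers_le.mpr hG) z)) =
    algebraMap (X.X.presheaf.stalk y) X.K
      (stalkHom i y (HomogeneousLocalization.mapId (forms n) (Submonoid.powers_le.mpr hG') z)) := by
  have hne : Nonempty (i ⁻¹ᵁ Proj.basicOpen (forms n) G) := ⟨⟨x, hG⟩⟩
  rw [stalkHom_mapId i hG, stalkHom_mapId i hG']
  erw [Scheme.algebraMap_germ_eq_germToFunctionField X.X (x := x) hG,
    Scheme.algebraMap_germ_eq_germToFunctionField X.X (x := y) hG']

theorem exists_X_notMem_primeOf (x : X.X) :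
    ∃ j, (MvPolynomial.X j : MvPolynomial (Fin (n + 1)) ℂ) ∉ primeOf i x := by
  by_contra h
  push Not at h
  apply ProjectiveSpectrum.not_irrelevant_le (𝒜 := forms n) (i x)
  rw [HomogeneousIdeal.irrelevant_le]
  intro e he F hF
  change F ∈ primeOf i x
  have hle : Ideal.span (MvPolynomial.X '' Set.univ) ≤ primeOf i x := by
    rw [Ideal.span_le]
    rintro _ ⟨j, -, rfl⟩
    exact h j
  refine hle (MvPolynomial.mem_ideal_span_X_image.2 fun m hm => ?_)
  have h2 := MvPolynomial.IsHomogeneous.degree_eq_sum_deg_support (n := e) hF hm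
  by_contra! hcon
  rw [Finset.sum_eq_zero fun j _ => hcon j trivial] at h2
  omega

theorem notMem_primeOf_of_specializes {x y : X.X} (h : x ⤳ y) {G : MvPolynomial (Fin (n + 1)) ℂ}
    (hG : G ∉ primeOf i y) : G ∉ primeOf i x :=
  h.mem_open (i ⁻¹ᵁ Proj.basicOpen (forms n) G).isOpen hG

/-- The element `F / G` of the homogeneous local ring of the image of a point. -/
noncomputable def fracAt (x : X.X) {d : ℕ} {F G : MvPolynomial (Fin (n + 1)) ℂ} (hF : F ∈ forms n d)
    (hG : G ∈ forms n d) (h : G ∉ primeOf i x) :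
    HomogeneousLocalization.AtPrime (forms n) (primeOf i x) :=
  .mk ⟨d, ⟨F, hF⟩, ⟨G, hG⟩, h⟩

theorem algebraMap_stalkHom_fracAt {x y : X.X} {d : ℕ} {F G : MvPolynomial (Fin (n + 1)) ℂ}
    (hF : F ∈ forms n d) (hG : G ∈ forms n d) (h : G ∉ primeOf i x) (h' : G ∉ primeOf i y) :
    algebraMap (X.X.presheaf.stalk x) X.K (stalkHom i x (fracAt i x hF hG h)) =
    algebraMap (X.X.presheaf.stalk y) X.K (stalkHom i y (fracAt i y hF hG h')) :=
  algebraMap_stalkHom_mapId i h h' (HomogeneousLocalization.mk ⟨d, ⟨F, hF⟩, ⟨G, hG⟩, ⟨1, pow_one G⟩⟩)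

theorem fracAt_mul_fracAt (x : X.X) {d e : ℕ} {F G F' G' : MvPolynomial (Fin (n + 1)) ℂ}
    (hF : F ∈ forms n d) (hG : G ∈ forms n d) (h : G ∉ primeOf i x)
    (hF' : F' ∈ forms n e) (hG' : G' ∈ forms n e) (h' : G' ∉ primeOf i x) {e' : ℕ}
    {P Q : MvPolynomial (Fin (n + 1)) ℂ}
    (hP : P ∈ forms n e') (hQ : Q ∈ forms n e') (hQ' : Q ∉ primeOf i x)
    (heq : F * F' * Q = P * (G * G')) :
    fracAt i x hF hG h * fracAt i x hF' hG' h' = fracAt i x hP hQ hQ' := by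
  apply HomogeneousLocalization.val_injective
  rw [HomogeneousLocalization.val_mul]
  simp only [fracAt, HomogeneousLocalization.val_mk]
  rw [Localization.mk_mul, Localization.mk_eq_mk_iff, Localization.r_iff_exists]
  refine ⟨1, ?_⟩
  simp only [OneMemClass.coe_one, one_mul, Submonoid.coe_mul]
  rw [mul_comm, heq, mul_comm]

theorem _root_.MvPolynomial.IsHomogeneous.eval₂_mul {σ R S : Type*} [CommSemiring R]
    [CommSemiring S] {F : MvPolynomial σ R} {d : ℕ} (hF : F.IsHomogeneous d) (f : R →+* S) (c : S)
    (g : σ → S) :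
    MvPolynomial.eval₂ f (fun i => c * g i) F = c ^ d * MvPolynomial.eval₂ f g F := by
  rw [MvPolynomial.eval₂_eq, MvPolynomial.eval₂_eq, Finset.mul_sum]
  refine Finset.sum_congr rfl fun m hm => ?_
  have h := hF.degree_eq_sum_deg_support hm
  simp only [mul_pow, Finset.prod_mul_distrib, Finset.prod_pow_eq_pow_sum]
  rw [h]
  ring

/-- Dehomogenization with respect to `X j`: it reduces all fractions of forms to the `X k / X j`. -/
theorem val_eval₂_fracAt (x : X.X) {j : Fin (n + 1)} (hj : MvPolynomial.X j ∉ primeOf i x) {d : ℕ}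
    {F : MvPolynomial (Fin (n + 1)) ℂ} (hF : F ∈ forms n d)
    (hG : MvPolynomial.X j ^ d ∈ forms n d) (hj' : MvPolynomial.X j ^ d ∉ primeOf i x) :
    fracAt i x hF hG hj' = MvPolynomial.eval₂
      ((HomogeneousLocalization.fromZeroRingHom (forms n) _).comp (algebraMap ℂ (forms n 0)))
      (fun k => fracAt i x (MvPolynomial.isHomogeneous_X ℂ k) (MvPolynomial.isHomogeneous_X ℂ j) hj)
      F := by
  apply HomogeneousLocalization.val_injective
  change _ = algebraMap (HomogeneousLocalization.AtPrime (forms n) (primeOf i x)) (Localization (primeOf i x).primeCompl) _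
  have hc : (algebraMap (HomogeneousLocalization.AtPrime (forms n) (primeOf i x))
      (Localization (primeOf i x).primeCompl)).comp
      ((HomogeneousLocalization.fromZeroRingHom (forms n) _).comp (algebraMap ℂ (forms n 0))) =
      (algebraMap (MvPolynomial (Fin (n + 1)) ℂ) (Localization (primeOf i x).primeCompl)).comp
        MvPolynomial.C := by
    ext c
    rfl
  have hev : algebraMap (MvPolynomial (Fin (n + 1)) ℂ) (Localization (primeOf i x).primeCompl) F = MvPolynomial.eval₂ ((algebraMap (MvPolynomial (Fin (n + 1)) ℂ) (Localization (primeOf i x).primeCompl)).comp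
        MvPolynomial.C) (fun k => algebraMap (MvPolynomial (Fin (n + 1)) ℂ) _ (MvPolynomial.X k)) F := by
    conv_lhs => rw [← MvPolynomial.eval₂_eta F]
    rw [MvPolynomial.hom_eval₂]
  rw [MvPolynomial.hom_eval₂, hc]
  have hx (k) : algebraMap (MvPolynomial (Fin (n + 1)) ℂ) (Localization (primeOf i x).primeCompl) (MvPolynomial.X k) =
      algebraMap (MvPolynomial (Fin (n + 1)) ℂ) _ (MvPolynomial.X j) * algebraMap _ (Localization (primeOf i x).primeCompl) (fracAt i x (MvPolynomial.isHomogeneous_X ℂ k) (MvPolynomial.isHomogeneous_X ℂ j) hj) := by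
    rw [HomogeneousLocalization.algebraMap_apply]
    simp only [fracAt, HomogeneousLocalization.val_mk]
    rw [Localization.mk_eq_mk', IsLocalization.mul_mk'_eq_mk'_of_mul, IsLocalization.eq_mk'_iff_mul_eq, ← map_mul, mul_comm]
  rw [funext hx, MvPolynomial.IsHomogeneous.eval₂_mul hF] at hev
  simp only [fracAt, HomogeneousLocalization.val_mk]
  rw [Localization.mk_eq_mk', IsLocalization.mk'_eq_iff_eq_mul, hev, map_pow, mul_comm]
  rfl

theorem _root_.CategoryTheory.comp_eq_of_squares {C : Type*} [Category* C]
    {A B A' B' X Y U V W : C} {a : A ⟶ A'} {s : A' ⟶ B'} {t : B' ⟶ X} {p : X ⟶ Y} {q : Y ⟶ V}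
    {l : A ⟶ B} {b : B ⟶ B'} {m : X ⟶ U} {z : B ⟶ W} {w : W ⟶ U} {r : U ⟶ V}
    (h1 : a ≫ s = l ≫ b) (h2 : b ≫ t ≫ m = z ≫ w) (h4 : p ≫ q = m ≫ r) :
    a ≫ (s ≫ t ≫ p) ≫ q = l ≫ z ≫ w ≫ r := by
  simp only [Category.assoc, h4, reassoc_of% h1]
  simp only [reassoc_of% h2]

theorem stalkHom_fromZeroRingHom (hi : i ≫ projSpaceStr n = X.str) {j : Fin (n + 1)}
    (hj : MvPolynomial.X j ∉ primeOf i (genericPoint X.X)) :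
    ((X.stalkToK (genericPoint X.X)).comp (stalkHom i _)).comp
      ((HomogeneousLocalization.fromZeroRingHom (forms n) _).comp (algebraMap ℂ (forms n 0))) =
      algebraMap ℂ X.K := by
  ext c
  let D := Proj.basicOpen (forms n) (MvPolynomial.X j)
  have : Nonempty (i ⁻¹ᵁ D) := ⟨⟨_, hj⟩⟩
  have h1 := stalkHom_mapId i hj (HomogeneousLocalization.fromZeroRingHom (forms n)
    (Submonoid.powers (MvPolynomial.X j)) (algebraMap ℂ (forms n 0) c))
  have h2 := toSpecZero_appTop_map (forms n) (MvPolynomial.X j : MvPolynomial (Fin (n + 1)) ℂ)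
    (MvPolynomial.isHomogeneous_X ℂ j) one_pos
  rw [← Iso.inv_comp_eq] at h2
  have h3 : X.str.appTop = (Scheme.Hom.appTop (Spec.map (CommRingCat.ofHom
      (algebraMap ℂ (forms n 0))))) ≫ (Proj.toSpecZero (forms n)).appTop ≫ i.appTop := by
    rw [← hi]
    rfl
  have h4 : i.appTop ≫ X.X.presheaf.map (homOfLE (le_top : i ⁻¹ᵁ D ≤ ⊤)).op =
      (projSpace n).presheaf.map (homOfLE (le_top : D ≤ ⊤)).op ≫ i.app D := by
    exact (i.naturality (homOfLE (le_top : D ≤ ⊤)).op).symm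
  have h5 : (Scheme.ΓSpecIso (.of ℂ)).inv ≫ X.str.appTop ≫
      X.X.presheaf.map (homOfLE (le_top : i ⁻¹ᵁ D ≤ ⊤)).op =
      CommRingCat.ofHom (algebraMap ℂ (forms n 0)) ≫ CommRingCat.ofHom
        (HomogeneousLocalization.fromZeroRingHom (forms n) (Submonoid.powers (MvPolynomial.X j))) ≫
        Proj.awayToSection (forms n) (MvPolynomial.X j) ≫ i.app D := by
    rw [h3]
    exact comp_eq_of_squares (Scheme.ΓSpecIso_inv_naturality _).symm h2 h4
  have h6 : algebraMap ℂ X.K c = X.X.germToFunctionField (i ⁻¹ᵁ D) (algebraMap ℂ Γ(X.X, i ⁻¹ᵁ D) c) :=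
    IsScalarTower.algebraMap_apply ℂ Γ(X.X, i ⁻¹ᵁ D) X.K c
  rw [h6]
  have h7 : algebraMap ℂ Γ(X.X, i ⁻¹ᵁ D) c = (i.app D).hom ((Proj.awayToSection (forms n) (MvPolynomial.X j)).hom
    (HomogeneousLocalization.fromZeroRingHom (forms n)
    (Submonoid.powers (MvPolynomial.X j)) (algebraMap ℂ (forms n 0) c))) :=
    congrArg (fun φ => φ.hom c) h5
  rw [h7, ← Scheme.algebraMap_germ_eq_germToFunctionField X.X (x := genericPoint X.X) hj]
  exact congrArg (X.stalkToK (genericPoint X.X)) h1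

/-- The homogeneous coordinates of the generic point. -/
theorem exists_coordinates (hi : i ≫ projSpaceStr n = X.str) :
    ∃ t : Fin (n + 1) → X.K, ∀ (x : X.X) (d : ℕ) (F G : MvPolynomial (Fin (n + 1)) ℂ)
      (hF : F ∈ forms n d) (hG : G ∈ forms n d) (h : G ∉ primeOf i x),
      MvPolynomial.aeval t G ≠ 0 ∧
      algebraMap (X.X.presheaf.stalk x) X.K (stalkHom i x (fracAt i x hF hG h)) =
        MvPolynomial.aeval t F / MvPolynomial.aeval t G := by
  obtain ⟨j, hj⟩ := exists_X_notMem_primeOf i (genericPoint X.X)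
  let ρ : HomogeneousLocalization.AtPrime (forms n) (primeOf i (genericPoint X.X)) →+* X.K :=
    (X.stalkToK (genericPoint X.X)).comp (stalkHom i _)
  -- The coordinates are normalised by `t j = 1`; a common factor in `t` would not affect quotients
  -- of forms of equal degree.
  let t : Fin (n + 1) → X.K := fun k => ρ (fracAt i _ (MvPolynomial.isHomogeneous_X ℂ k)
    (MvPolynomial.isHomogeneous_X ℂ j) hj)
  have hC : ρ.comp ((HomogeneousLocalization.fromZeroRingHom (forms n) _).comp
      (algebraMap ℂ (forms n 0))) = algebraMap ℂ X.K := stalkHom_fromZeroRingHom i hi hj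
  have hpow (d : ℕ) : MvPolynomial.X j ^ d ∉ primeOf i (genericPoint X.X) := fun h =>
    hj (Ideal.IsPrime.mem_of_pow_mem inferInstance d h)
  have hpow' (d : ℕ) : MvPolynomial.X j ^ d ∈ forms n d := by
    exact MvPolynomial.isHomogeneous_X_pow j d
  have hev (d : ℕ) {F : MvPolynomial (Fin (n + 1)) ℂ} (hF : F ∈ forms n d) :
      ρ (fracAt i _ hF (hpow' d) (hpow d)) = MvPolynomial.aeval t F := by
    rw [val_eval₂_fracAt i _ hj hF (hpow' d) (hpow d), MvPolynomial.hom_eval₂, hC]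
    rfl
  refine ⟨t, fun x d F G hF hG h => ?_⟩
  have hg := notMem_primeOf_of_specializes i (genericPoint_specializes x) h
  have hne : MvPolynomial.aeval t G ≠ 0 := by
    rw [← hev d hG]
    have h1 : fracAt i (genericPoint X.X) hG (hpow' d) (hpow d) * fracAt i _ (hpow' d) hG hg = 1 := by
      rw [fracAt_mul_fracAt i _ hG (hpow' d) (hpow d) (hpow' d) hG hg (e' := 0)
        (P := 1) (Q := 1) (MvPolynomial.isHomogeneous_one _ _) (MvPolynomial.isHomogeneous_one _ _)
        ((Ideal.ne_top_iff_one _).1 (Ideal.IsPrime.ne_top inferInstance)) (by ring)]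
      rfl
    intro h0
    have := congrArg ρ h1
    rw [map_mul, h0, zero_mul, map_one] at this
    exact zero_ne_one this
  have key : ρ (fracAt i _ hF hG hg) = MvPolynomial.aeval t F / MvPolynomial.aeval t G := by
    rw [eq_div_iff hne, ← hev d hG, ← hev d hF, ← map_mul]
    exact congrArg ρ (fracAt_mul_fracAt i _ hF hG hg hG (hpow' d) (hpow d) hF (hpow' d)
      (hpow d) (by ring))
  exact ⟨hne, (algebraMap_stalkHom_fracAt i hF hG h hg).trans key⟩

end Variety
end MoriFibre

/-! ### Regular functions as quotients of forms, and centres of valuations. -/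

namespace MoriFibre

attribute [local instance] MvPolynomial.gradedAlgebra Variety.sectionsAlgebra

namespace Variety

variable {X : Variety} {n : ℕ} {i : X.X ⟶ projSpace n}

/-- `t` are homogeneous coordinates of the generic point of `X` with respect to `i`. -/
def IsCoordinates (i : X.X ⟶ projSpace n) (t : Fin (n + 1) → X.K) : Prop :=
  ∀ (x : X.X) (d : ℕ) (F G : MvPolynomial (Fin (n + 1)) ℂ)
      (hF : F ∈ forms n d) (hG : G ∈ forms n d) (h : G ∉ primeOf i x),
      MvPolynomial.aeval t G ≠ 0 ∧
      algebraMap (X.X.presheaf.stalk x) X.K (stalkHom i x (fracAt i x hF hG h)) =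
        MvPolynomial.aeval t F / MvPolynomial.aeval t G

theorem isAffineOpen_preimage_basicOpen [IsClosedImmersion i] {d : ℕ}
    {F : MvPolynomial (Fin (n + 1)) ℂ} (hF : F ∈ forms n d) (hd : 0 < d) :
    IsAffineOpen (i ⁻¹ᵁ Proj.basicOpen (forms n) F) :=
  IsAffineOpen.preimage (Y := projSpace n) (Proj.isAffineOpen_basicOpen (forms n) F hF hd) i

namespace IsCoordinates

variable {t : Fin (n + 1) → X.K} (ht : IsCoordinates i t)
include ht

theorem aeval_ne_zero {x : X.X} {d : ℕ} {G : MvPolynomial (Fin (n + 1)) ℂ} (hG : G ∈ forms n d)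
    (h : G ∉ primeOf i x) : MvPolynomial.aeval t G ≠ 0 :=
  (ht x d G G hG hG h).1

theorem div_mem_localRing {x : X.X} {d : ℕ} {F G : MvPolynomial (Fin (n + 1)) ℂ}
    (hF : F ∈ forms n d) (hG : G ∈ forms n d) (h : G ∉ primeOf i x) :
    MvPolynomial.aeval t F / MvPolynomial.aeval t G ∈ X.localRing x :=
  ⟨_, (ht x d F G hF hG h).2⟩

/-- `stalkHom` is a local homomorphism, so a fraction whose numerator vanishes at the image point
cannot become a unit. -/
theorem inv_div_notMem_localRing {x : X.X} {d : ℕ} {F G : MvPolynomial (Fin (n + 1)) ℂ}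
    (hF : F ∈ forms n d) (hG : G ∈ forms n d) (h : G ∉ primeOf i x) (h' : F ∈ primeOf i x)
    (h0 : MvPolynomial.aeval t F ≠ 0) :
    (MvPolynomial.aeval t F / MvPolynomial.aeval t G)⁻¹ ∉ X.localRing x := by
  intro hmem
  have h1 := ht x d F G hF hG h
  rw [← h1.2] at hmem
  have h2 := isUnit_of_inv_mem (fun h0' => div_ne_zero h0 h1.1 (by rw [← h1.2, h0', map_zero])) hmem
  have h3 := IsLocalHom.map_nonunit _ h2
  rw [← HomogeneousLocalization.isUnit_iff_isUnit_val, fracAt, HomogeneousLocalization.val_mk,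
    Localization.mk_eq_mk', IsLocalization.AtPrime.isUnit_mk'_iff (Localization (primeOf i x).primeCompl) (primeOf i x)] at h3
  exact h3 h'

theorem exists_eq_div [SurjectiveOnStalks i] {x : X.X} {f : X.K} (hf : f ∈ X.localRing x) :
    ∃ (d : ℕ) (F G : MvPolynomial (Fin (n + 1)) ℂ), 0 < d ∧ F ∈ forms n d ∧ G ∈ forms n d ∧
      G ∉ primeOf i x ∧ f = MvPolynomial.aeval t F / MvPolynomial.aeval t G := by
  obtain ⟨g, rfl⟩ := hf
  obtain ⟨z, rfl⟩ := stalkHom_surjective i x g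
  obtain ⟨⟨d, ⟨F, hF⟩, ⟨G, hG'⟩, hG⟩, rfl⟩ := HomogeneousLocalization.mk_surjective z
  obtain ⟨j, hj⟩ := exists_X_notMem_primeOf i x
  have h1 := ht x d F G hF hG' hG
  -- The extra factor `X j` makes the degree positive, which is needed for the loci `F ≠ 0` and `G ≠
  -- 0` to be affine.
  refine ⟨d + 1, F * MvPolynomial.X j, G * MvPolynomial.X j, d.succ_pos,
    hF.mul (MvPolynomial.isHomogeneous_X ℂ j), hG'.mul (MvPolynomial.isHomogeneous_X ℂ j),
    fun h => (Ideal.IsPrime.mem_or_mem inferInstance h).elim hG hj, ?_⟩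
  rw [map_mul, map_mul, mul_div_mul_right _ _ (ht.aeval_ne_zero (MvPolynomial.isHomogeneous_X ℂ j) hj)]
  exact h1.2

theorem germToFunctionField_eq [IsClosedImmersion i] (k : Fin (n + 1))
    [Nonempty (i ⁻¹ᵁ Proj.basicOpen (forms n) (MvPolynomial.X k))]
    (a : Γ(X.X, i ⁻¹ᵁ Proj.basicOpen (forms n) (MvPolynomial.X k))) :
    ∃ (d : ℕ) (F : MvPolynomial (Fin (n + 1)) ℂ), F ∈ forms n d ∧
      X.X.germToFunctionField _ a = MvPolynomial.aeval t F / (t k) ^ d := by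
  obtain ⟨x, hx⟩ := ‹Nonempty (i ⁻¹ᵁ Proj.basicOpen (forms n) (MvPolynomial.X k))›
  have h1 : Function.Surjective (i.app (Proj.basicOpen (forms n) (MvPolynomial.X k))).hom :=
    Scheme.Hom.app_surjective i _ (Proj.isAffineOpen_basicOpen (forms n) (MvPolynomial.X k)
      (MvPolynomial.isHomogeneous_X ℂ k) one_pos)
  obtain ⟨b, rfl⟩ := h1 a
  obtain ⟨z, rfl⟩ : ∃ z, (Proj.awayToSection (forms n) (MvPolynomial.X k)).hom z = b := by
    refine ⟨(Proj.basicOpenIsoAway (forms n) (MvPolynomial.X k)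
      (MvPolynomial.isHomogeneous_X ℂ k) one_pos).inv.hom b, ?_⟩
    exact congrArg (fun φ => φ.hom b) (Proj.basicOpenIsoAway (forms n) (MvPolynomial.X k)
      (MvPolynomial.isHomogeneous_X ℂ k) one_pos).inv_hom_id
  obtain ⟨d, F, hF, rfl⟩ := HomogeneousLocalization.Away.mk_surjective (forms n)
    (MvPolynomial.isHomogeneous_X ℂ k) z
  have h2 := stalkHom_mapId i hx (HomogeneousLocalization.Away.mk (forms n)
    (MvPolynomial.isHomogeneous_X ℂ k) d F hF)
  refine ⟨d • 1, F, hF, ?_⟩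
  rw [← Scheme.algebraMap_germ_eq_germToFunctionField X.X (x := x) hx]
  have h3 := (ht x (d • 1) F (MvPolynomial.X k ^ d) hF (SetLike.pow_mem_graded d
    (MvPolynomial.isHomogeneous_X ℂ k)) (fun h => hx ((inferInstance : (primeOf i x).IsPrime).mem_of_pow_mem d h))).2
  rw [map_pow, MvPolynomial.aeval_X] at h3
  rw [smul_eq_mul, mul_one] at *
  rw [← h3]
  exact (congrArg _ h2).symm

end IsCoordinates

/-- The existence part of the valuative criterion. Dividing by the coordinate `t k` of largest value
puts the ring of the `k`-th chart inside `V`; the centre is the contraction of the maximal ideal.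
The second clause says that `V` dominates the local ring. -/
theorem exists_center (hX : X.IsProjective) (V : ValuationSubring X.K)
    (hV : ∀ c : ℂ, algebraMap ℂ X.K c ∈ V) :
    ∃ x : X.X, ∀ f ∈ X.localRing x, f ∈ V ∧ (f⁻¹ ∉ X.localRing x → V.valuation f < 1) := by
  obtain ⟨n, i, hi, hstr⟩ := hX
  obtain ⟨t, ht⟩ := exists_coordinates i hstr
  have ht : IsCoordinates i t := ht
  obtain ⟨j, hj⟩ := exists_X_notMem_primeOf i (genericPoint X.X)
  obtain ⟨k, -, hk⟩ := Finset.exists_max_image Finset.univ (fun k => V.valuation (t k)) ⟨j, Finset.mem_univ j⟩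
  have hj0 : t j ≠ 0 := by
    have := ht.aeval_ne_zero (MvPolynomial.isHomogeneous_X ℂ j) hj
    rwa [MvPolynomial.aeval_X] at this
  have hk0 : t k ≠ 0 := by
    intro h
    have := hk j (Finset.mem_univ j)
    rw [h, map_zero, le_zero_iff, map_eq_zero] at this
    exact hj0 this
  -- Otherwise `t k / t j` would be a nonzero nonunit in the function field.
  have hkη : MvPolynomial.X k ∉ primeOf i (genericPoint X.X) := by
    intro h
    refine ht.inv_div_notMem_localRing (MvPolynomial.isHomogeneous_X ℂ k)
      (MvPolynomial.isHomogeneous_X ℂ j) hj h (by rwa [MvPolynomial.aeval_X]) ?_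
    rw [localRing_generic]
    trivial
  have hle (l) : t l / t k ∈ V := by
    rw [← ValuationSubring.valuation_le_one_iff, map_div₀]
    exact div_le_one_of_le₀ (hk l (Finset.mem_univ l)) zero_le
  have hev {d : ℕ} {F : MvPolynomial (Fin (n + 1)) ℂ} (hF : F ∈ forms n d) :
      MvPolynomial.aeval t F / t k ^ d ∈ V := by
    have h1 := MvPolynomial.IsHomogeneous.eval₂_mul hF (algebraMap ℂ X.K) (t k) (fun l => t l / t k)
    have h2 : (fun l => t k * (t l / t k)) = t := funext fun l => mul_div_cancel₀ _ hk0
    rw [h2] at h1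
    rw [MvPolynomial.aeval_def, h1, mul_div_cancel_left₀ _ (pow_ne_zero d hk0)]
    exact MvPolynomial.eval₂_mem (s := V) (fun m _ => hV _) hle
  let U := i ⁻¹ᵁ Proj.basicOpen (forms n) (MvPolynomial.X k)
  have hU : IsAffineOpen U := isAffineOpen_preimage_basicOpen (MvPolynomial.isHomogeneous_X ℂ k) one_pos
  have : Nonempty U := ⟨⟨_, hkη⟩⟩
  have hUV (a : Γ(X.X, U)) : X.X.germToFunctionField U a ∈ V := by
    obtain ⟨d, F, hF, h⟩ := ht.germToFunctionField_eq k a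
    rw [h]
    exact hev hF
  let φ : Γ(X.X, U) →+* V := (X.X.germToFunctionField U).hom.codRestrict V.toSubring hUV
  let p : Spec Γ(X.X, U) := ⟨(IsLocalRing.maximalIdeal V).comap φ, inferInstance⟩
  let x := hU.fromSpec p
  have hxU : x ∈ U := by
    have : x ∈ Set.range hU.fromSpec := ⟨p, rfl⟩
    rwa [hU.range_fromSpec] at this
  have hp : hU.primeIdealOf ⟨x, hxU⟩ = p := by
    apply hU.fromSpec.isOpenEmbedding.injective
    exact hU.fromSpec_primeIdealOf ⟨x, hxU⟩
  have hps (s : Γ(X.X, U)) : s ∉ (hU.primeIdealOf ⟨x, hxU⟩).asIdeal ↔ V.valuation (X.X.germToFunctionField U s) = 1 := by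
    rw [hp]
    change ¬ (φ s ∈ IsLocalRing.maximalIdeal V) ↔ _
    rw [IsLocalRing.mem_maximalIdeal, mem_nonunits_iff, not_not]
    exact (ValuationSubring.valuation_eq_one_iff V (φ s))
  refine ⟨x, fun f hf => ?_⟩
  obtain ⟨a, s, hs, h⟩ := (mem_localRing_iff_of_isAffineOpen hU hxU).1 hf
  have hs1 := (hps s).1 hs
  have hval : V.valuation f = V.valuation (X.X.germToFunctionField U a) := by
    rw [← h, map_mul, hs1, mul_one]
  have hfV : f ∈ V := by
    rw [← ValuationSubring.valuation_le_one_iff, hval, ValuationSubring.valuation_le_one_iff]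
    exact hUV a
  refine ⟨hfV, fun hf' => ?_⟩
  rw [lt_iff_le_and_ne, ValuationSubring.valuation_le_one_iff]
  refine ⟨hfV, fun h1 => hf' ?_⟩
  rw [mem_localRing_iff_of_isAffineOpen hU hxU]
  refine ⟨s, a, (hps a).2 (hval.symm.trans h1), ?_⟩
  have hf0 : f ≠ 0 := by
    rintro rfl
    rw [map_zero] at h1
    exact zero_ne_one h1
  rw [inv_mul_eq_iff_eq_mul₀ hf0, h]

end Variety
end MoriFibre

/-! ### Counting the zeros of a function on a projective curve. -/

namespace MoriFibre.Variety

attribute [local instance] sectionsAlgebra MvPolynomial.gradedAlgebra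

variable {X : Variety}

/-- The integral closure of `ℂ[u]` is an intersection of valuation rings. Let `V` contain `ℂ[u]` but
not `f`. If its centre is in `U`, then `f ∈ V`; if not, `u⁻¹` lies in the maximal ideal of `V`
although `u ∈ V`. Both are absurd. -/
theorem isIntegral_of_mem (hX : X.IsProjective) {u f : X.K} {U : Set X.X}
    (hf : ∀ x ∈ U, f ∈ X.localRing x)
    (hU : ∀ x ∉ U, u⁻¹ ∈ X.localRing x ∧ u ∉ X.localRing x) :
    IsIntegral (Algebra.adjoin ℂ {u}) f := by
  by_contra hne
  let R : Subring X.K := (integralClosure (Algebra.adjoin ℂ {u}) X.K).toSubring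
  have : IsIntegrallyClosedIn R X.K :=
    inferInstanceAs (IsIntegrallyClosedIn (integralClosure (Algebra.adjoin ℂ {u}) X.K) X.K)
  obtain ⟨V, hRV, hfV⟩ := Subring.exists_le_valuationSubring_of_isIntegrallyClosedIn
    (R := R) (x := f) hne
  have hadj : ∀ g ∈ Algebra.adjoin ℂ {u}, g ∈ V := fun g hg =>
    hRV (isIntegral_algebraMap (x := (⟨g, hg⟩ : Algebra.adjoin ℂ {u})))
  obtain ⟨x, hx⟩ := exists_center hX V fun c => hadj _ (Subalgebra.algebraMap_mem _ c)
  by_cases hxU : x ∈ U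
  · exact hfV (hx f (hf x hxU)).1
  · obtain ⟨h1, h2⟩ := hU x hxU
    have h3 := (hx _ h1).2 (by rwa [inv_inv])
    have h4 := (ValuationSubring.valuation_le_one_iff V u).2
      (hadj u (Algebra.self_mem_adjoin_singleton ℂ u))
    rw [map_inv₀] at h3
    have hu0 : u ≠ 0 := by
      rintro rfl
      exact h2 (zero_mem _)
    have h5 := (inv_lt_one₀ (zero_lt_iff.2 ((map_ne_zero V.valuation).2 hu0))).1 h3
    exact absurd h4 (not_le.2 h5)

theorem IsProjective.compactSpace (hX : X.IsProjective) : CompactSpace X.X := by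
  obtain ⟨n, i, hi, hstr⟩ := hX
  constructor
  have h : (Set.univ : Set X.X) = ⋃ j : Fin (n + 1), (i ⁻¹ᵁ Proj.basicOpen (forms n) (MvPolynomial.X j) : Set X.X) := by
    refine (Set.eq_univ_of_forall fun x => ?_).symm
    obtain ⟨j, hj⟩ := exists_X_notMem_primeOf i x
    exact Set.mem_iUnion.2 ⟨j, hj⟩
  rw [h]
  exact isCompact_iUnion fun j => (isAffineOpen_preimage_basicOpen (i := i) (MvPolynomial.isHomogeneous_X ℂ j) one_pos).isCompact

/-- The complement has finitely many irreducible components, and the generic point of each is a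
closed point. -/
theorem finite_compl_of_dim_eq_one (hX : X.IsProjective) (hdim : X.dim = 1) {U : X.X.Opens}
    (hU : (U : Set X.X).Nonempty) : ((U : Set X.X)ᶜ).Finite := by
  have := hX.compactSpace
  have hN : IsNoetherian X.X := {}
  obtain ⟨S, hS, hirr, hsup⟩ := TopologicalSpace.NoetherianSpace.exists_finite_set_closeds_irreducible
    U.compl
  have hη : genericPoint X.X ∈ U := ((genericPoint_spec X.X).mem_open_set_iff U.isOpen).2 (by simpa using hU)
  have h1 : ((U : Set X.X)ᶜ) = ⋃ t ∈ S, (t : Set X.X) := by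
    have := congrArg (fun c : TopologicalSpace.Closeds X.X => (c : Set X.X)) hsup
    rw [TopologicalSpace.Closeds.coe_sSup, Set.sUnion_image, closure_eq_iff_isClosed.2] at this
    · exact this
    · exact hS.isClosed_biUnion fun t _ => t.isClosed
  rw [h1]
  refine hS.biUnion fun t ht => ?_
  have h2 := (hirr t ht).isGenericPoint_genericPoint t.isClosed
  have h3 : (hirr t ht).genericPoint ≠ genericPoint X.X := by
    intro h
    have h4 : (hirr t ht).genericPoint ∈ (U : Set X.X)ᶜ := by
      rw [h1]
      exact Set.mem_biUnion ht h2.mem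
    rw [h] at h4
    exact h4 hη
  rw [← h2.def, (isClosed_singleton_of_dim_eq_one hdim h3).closure_eq]
  exact Set.finite_singleton _

theorem finite_setOf_notMem_localRing (hX : X.IsProjective) (hdim : X.dim = 1) (f : X.K) :
    {x | f ∉ X.localRing x}.Finite := by
  obtain ⟨U, hU, h⟩ := exists_opens_mem_localRing (X := X) (x := genericPoint X.X) (f := f)
    (by rw [localRing_generic]; trivial)
  refine (finite_compl_of_dim_eq_one hX hdim ⟨_, hU⟩).subset fun x hx hxU => hx (h x hxU)

theorem finite_setOf_ord_ne_zero (hX : X.IsProjective) (hdim : X.dim = 1) (f : X.K) :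
    {x | Scheme.ord f x ≠ 0}.Finite := by
  refine ((finite_setOf_notMem_localRing hX hdim f).union
    (finite_setOf_notMem_localRing hX hdim f⁻¹)).subset fun x hx => ?_
  by_contra h
  simp only [Set.mem_union, Set.mem_ofPred_eq, not_or, not_not] at h
  exact hx (ord_eq_zero h.1 h.2)

/-- By `hout` and `isIntegral_of_mem` the coordinate ring of `U` is integral over `ℂ[u]`. Hence the
dimension of its quotient by `a` is the field degree, while `length_quotient_eq_sum_ord` splits that
dimension into local orders. -/
theorem sum_ord_eq_finrank (hX : X.IsProjective) (hdim : X.dim = 1) {U : X.X.Opens}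
    (hU : IsAffineOpen U) [Nonempty U] (a : Γ(X.X, U))
    (htr : Transcendental ℂ (X.X.germToFunctionField U a))
    (hout : ∀ x ∉ U, (X.X.germToFunctionField U a)⁻¹ ∈ X.localRing x ∧
      X.X.germToFunctionField U a ∉ X.localRing x) :
    ∑ᶠ x ∈ (U : Set X.X), Scheme.ord (X.X.germToFunctionField U a) x =
      Module.finrank (IntermediateField.adjoin ℂ {X.X.germToFunctionField U a}) X.K := by
  set u := X.X.germToFunctionField U a with hu
  have hu0 : u ≠ 0 := by
    intro h
    rw [h] at htr
    exact htr (isAlgebraic_zero)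
  have ha0 : a ≠ 0 := by
    rintro rfl
    exact hu0 (map_zero _)
  have := finiteType_sections hU
  have := functionField_isFractionRing_of_isAffineOpen X.X U hU
  have hone : Ring.KrullDimLE 1 Γ(X.X, U) := by
    obtain ⟨m, h1, -, h2⟩ := X.exists_dim_eq
    rw [Ring.krullDimLE_iff, h2 U hU inferInstance, ← h1, hdim]
    rfl
  have hfr := finrank_quotient_eq_finrank_adjoin ℂ Γ(X.X, U) X.K a htr fun b =>
    isIntegral_of_mem hX (U := U) (fun x hx => germ_mem_localRing hx b) hout
  rw [show algebraMap Γ(X.X, U) X.K a = u from rfl] at hfr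
  obtain ⟨hfin, hmf, hlen⟩ := length_quotient_eq_sum_ord ℂ Γ(X.X, U) ha0
  let P (m : MaximalSpectrum (Γ(X.X, U) ⧸ Ideal.span {a})) : Spec Γ(X.X, U) :=
    ⟨m.asIdeal.comap (Ideal.Quotient.mk (Ideal.span {a})), inferInstance⟩
  -- The range of `e` is the set of zeros of `a` in `U`.
  let e (m : MaximalSpectrum (Γ(X.X, U) ⧸ Ideal.span {a})) : X.X := hU.fromSpec (P m)
  have hPinj : Function.Injective P := by
    intro m m' h
    have h1 : m.asIdeal.comap (Ideal.Quotient.mk (Ideal.span {a})) =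
      m'.asIdeal.comap (Ideal.Quotient.mk (Ideal.span {a})) := congrArg PrimeSpectrum.asIdeal h
    exact MaximalSpectrum.ext (Ideal.comap_injective_of_surjective _ Ideal.Quotient.mk_surjective h1)
  have heinj : Function.Injective e := hU.fromSpec.isOpenEmbedding.injective.comp hPinj
  have heU (m) : e m ∈ U := by
    have : e m ∈ Set.range hU.fromSpec := ⟨P m, rfl⟩
    rwa [hU.range_fromSpec] at this
  have hPe (m) : hU.primeIdealOf ⟨e m, heU m⟩ = P m := by
    apply hU.fromSpec.isOpenEmbedding.injective
    exact hU.fromSpec_primeIdealOf ⟨e m, heU m⟩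
  have haP (m) : a ∈ (hU.primeIdealOf ⟨e m, heU m⟩).asIdeal := by
    rw [hPe]
    change Ideal.Quotient.mk (Ideal.span {a}) a ∈ m.asIdeal
    rw [Ideal.Quotient.eq_zero_iff_mem.2 (Ideal.mem_span_singleton_self a)]
    exact zero_mem _
  have hco (m) : coheight (e m) = 1 := by
    refine coheight_eq_one_of_dim_eq_one hdim fun h => ?_
    refine (inv_germ_mem_localRing_iff hU (heU m) ha0).not.2 (not_not.2 (haP m)) ?_
    rw [h, localRing_generic]
    trivial
  have hord (m) : ((Scheme.ord u (e m)).toNat : ℕ∞) =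
      Module.length (Localization.AtPrime m.asIdeal) (Localization.AtPrime m.asIdeal) := by
    let := X.X.presheaf.algebra_section_stalk ⟨e m, heU m⟩
    have hloc := hU.isLocalization_stalk ⟨e m, heU m⟩
    have hP : (hU.primeIdealOf ⟨e m, heU m⟩).asIdeal =
        m.asIdeal.comap (Ideal.Quotient.mk (Ideal.span {a})) :=
      congrArg PrimeSpectrum.asIdeal (hPe m)
    have hloc' : IsLocalization.AtPrime (X.X.presheaf.stalk (e m))
        (m.asIdeal.comap (Ideal.Quotient.mk (Ideal.span {a}))) := by
      simp only [← hP]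
      exact hloc
    rw [← ord_localization_eq_length a m.asIdeal (X.X.presheaf.stalk (e m))]
    have hu' : algebraMap (X.X.presheaf.stalk (e m)) X.K (algebraMap Γ(X.X, U) _ a) = u :=
      Scheme.algebraMap_germ_eq_germToFunctionField X.X (heU m) a
    rw [ord_algebraMap (hco m), hu']
    intro h
    rw [h, map_zero] at hu'
    exact hu0 hu'.symm
  have hsupp : (U : Set X.X) ∩ Function.support (fun x => Scheme.ord u x) =
      Set.range e ∩ Function.support (fun x => Scheme.ord u x) := by
    ext x
    refine and_congr_left fun hx => ⟨fun hxU => ?_, ?_⟩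
    · have hxu : a ∈ (hU.primeIdealOf ⟨x, hxU⟩).asIdeal := by
        by_contra h
        exact hx (ord_eq_zero (germ_mem_localRing hxU a)
          ((inv_germ_mem_localRing_iff hU hxU ha0).2 h))
      have hle : Ideal.span {a} ≤ (hU.primeIdealOf ⟨x, hxU⟩).asIdeal := by
        rwa [Ideal.span_le, Set.singleton_subset_iff]
      have hmax : (hU.primeIdealOf ⟨x, hxU⟩).asIdeal.IsMaximal :=
        Ideal.IsPrime.isMaximal_of_ne_bot inferInstance fun h => ha0 (by rwa [h] at hxu)
      have hcm : ((hU.primeIdealOf ⟨x, hxU⟩).asIdeal.map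
          (Ideal.Quotient.mk (Ideal.span {a}))).comap (Ideal.Quotient.mk (Ideal.span {a})) =
          (hU.primeIdealOf ⟨x, hxU⟩).asIdeal := by
        rw [Ideal.comap_map_of_surjective' _ Ideal.Quotient.mk_surjective, Ideal.mk_ker]
        exact sup_eq_left.2 hle
      refine ⟨⟨(hU.primeIdealOf ⟨x, hxU⟩).asIdeal.map (Ideal.Quotient.mk _), ?_⟩, ?_⟩
      · refine (Ideal.map_eq_top_or_isMaximal_of_surjective _ Ideal.Quotient.mk_surjective hmax).resolve_left ?_
        intro h
        rw [h, Ideal.comap_top] at hcm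
        exact hmax.ne_top hcm.symm
      · refine Eq.trans ?_ (hU.fromSpec_primeIdealOf ⟨x, hxU⟩)
        exact congrArg hU.fromSpec (PrimeSpectrum.ext hcm)
    · rintro ⟨m, rfl⟩
      exact heU m
  rw [← finsum_mem_inter_support, hsupp, finsum_mem_inter_support, finsum_mem_range heinj]
  have := Fintype.ofFinite (MaximalSpectrum (Γ(X.X, U) ⧸ Ideal.span {a}))
  rw [finsum_eq_sum_of_fintype]
  simp only [← hord] at hlen
  rw [finsum_eq_sum_of_fintype, Module.length_eq_finrank, hfr, ← Nat.cast_sum, Nat.cast_inj] at hlen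
  rw [hlen, Nat.cast_sum]
  refine Finset.sum_congr rfl fun m _ => ?_
  rw [Int.toNat_of_nonneg (ord_nonneg (germ_mem_localRing (heU m) a))]

end MoriFibre.Variety

/-! ### Principal divisors on a projective curve. -/

namespace MoriFibre.Variety

attribute [local instance] sectionsAlgebra MvPolynomial.gradedAlgebra

variable {X : Variety}

theorem ord_algebraMap_complex (x : X.X) (c : ℂ) : Scheme.ord (algebraMap ℂ X.K c) x = 0 := by
  refine ord_eq_zero (algebraMap_mem_localRing x c) ?_
  rw [← map_inv₀]
  exact algebraMap_mem_localRing x _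

/-- A linear form that does not vanish at finitely many given points. -/
theorem exists_linear_notMem_primeOf {n : ℕ} (i : X.X ⟶ projSpace n) {S : Set X.X} (hS : S.Finite) :
    ∃ L ∈ forms n 1, ∀ x ∈ S, L ∉ primeOf i x := by
  classical
  let p (x : X.X) : Submodule ℂ (forms n 1) :=
    ((primeOf i x).restrictScalars ℂ).comap (forms n 1).subtype
  have hp (x) : p x ≠ ⊤ := by
    intro h
    obtain ⟨j, hj⟩ := exists_X_notMem_primeOf i x
    have : (⟨MvPolynomial.X j, MvPolynomial.isHomogeneous_X ℂ j⟩ : forms n 1) ∈ p x := by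
      rw [h]; trivial
    exact hj this
  -- A vector space over an infinite field is not a finite union of proper subspaces.
  have h := Subspace.biUnion_ne_univ_of_top_notMem (k := ℂ) (s := hS.toFinset.image p) (by
    intro hmem
    obtain ⟨x, -, hx⟩ := Finset.mem_image.1 hmem
    exact hp x hx)
  obtain ⟨L, hL⟩ := (Set.ne_univ_iff_exists_notMem _).1 h
  refine ⟨L, L.2, fun x hx hLx => hL ?_⟩
  exact Set.mem_biUnion (Finset.mem_coe.2 (Finset.mem_image_of_mem p (hS.mem_toFinset.2 hx))) hLx

theorem IsCoordinates.exists_section {n : ℕ} {i : X.X ⟶ projSpace n} {t : Fin (n + 1) → X.K}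
    (ht : IsCoordinates i t) {d : ℕ} {F G : MvPolynomial (Fin (n + 1)) ℂ}
    (hF : F ∈ forms n d) (hG : G ∈ forms n d) [Nonempty (i ⁻¹ᵁ Proj.basicOpen (forms n) G)] :
    ∃ a : Γ(X.X, i ⁻¹ᵁ Proj.basicOpen (forms n) G), X.X.germToFunctionField _ a =
      MvPolynomial.aeval t F / MvPolynomial.aeval t G := by
  obtain ⟨x, hx⟩ := ‹Nonempty (i ⁻¹ᵁ Proj.basicOpen (forms n) G)›
  let z : HomogeneousLocalization.Away (forms n) G :=
    HomogeneousLocalization.mk ⟨d, ⟨F, hF⟩, ⟨G, hG⟩, ⟨1, pow_one G⟩⟩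
  have h2 := stalkHom_mapId i hx z
  refine ⟨(i.app (Proj.basicOpen (forms n) G)).hom ((Proj.awayToSection (forms n) G).hom z), ?_⟩
  rw [← Scheme.algebraMap_germ_eq_germToFunctionField X.X (x := x) hx, ← (ht x d F G hF hG hx).2]
  exact (congrArg _ h2).symm

/-- When `F` and `G` have no common zero, the zeros of `u = F / G` lie in the affine locus `G ≠ 0`
and its poles in the affine locus `F ≠ 0`. For nonconstant `u` both counts equal `[K : ℂ(u)] = [K :
ℂ(u⁻¹)]`. -/
theorem sum_ord_div_eq_zero (hX : X.IsProjective) (hdim : X.dim = 1) {n : ℕ} {i : X.X ⟶ projSpace n}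
    [IsClosedImmersion i] {t : Fin (n + 1) → X.K} (ht : IsCoordinates i t) {d : ℕ} (hd : 0 < d)
    {F G : MvPolynomial (Fin (n + 1)) ℂ} (hF : F ∈ forms n d) (hG : G ∈ forms n d)
    (hFη : F ∉ primeOf i (genericPoint X.X)) (hGη : G ∉ primeOf i (genericPoint X.X))
    (hFG : ∀ x, F ∈ primeOf i x → G ∉ primeOf i x) :
    ∑ᶠ x, Scheme.ord (MvPolynomial.aeval t F / MvPolynomial.aeval t G) x = 0 := by
  set u := MvPolynomial.aeval t F / MvPolynomial.aeval t G with hu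
  have hF0 := ht.aeval_ne_zero hF hFη
  have hG0 := ht.aeval_ne_zero hG hGη
  have hu0 : u ≠ 0 := div_ne_zero hF0 hG0
  by_cases halg : IsAlgebraic ℂ u
  · obtain ⟨c, hc⟩ := exists_algebraMap_eq_of_isAlgebraic halg
    simp only [← hc, ord_algebraMap_complex, finsum_zero]
  have hinv : u⁻¹ = MvPolynomial.aeval t G / MvPolynomial.aeval t F := inv_div _ _
  let U := i ⁻¹ᵁ Proj.basicOpen (forms n) G
  let U' := i ⁻¹ᵁ Proj.basicOpen (forms n) F
  have : Nonempty U := ⟨⟨_, hGη⟩⟩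
  have : Nonempty U' := ⟨⟨_, hFη⟩⟩
  have memU (x) : x ∈ (U : Set X.X) ↔ G ∉ primeOf i x := Iff.rfl
  have memU' (x) : x ∈ (U' : Set X.X) ↔ F ∉ primeOf i x := Iff.rfl
  obtain ⟨a, ha⟩ := ht.exists_section hF hG
  obtain ⟨b, hb⟩ := ht.exists_section hG hF
  have houtU : ∀ x ∉ (U : Set X.X), u⁻¹ ∈ X.localRing x ∧ u ∉ X.localRing x := by
    intro x hx
    rw [memU, not_not] at hx
    have hFx : F ∉ primeOf i x := fun h => hFG x h hx
    have h2 := ht.inv_div_notMem_localRing hG hF hFx hx hG0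
    rw [inv_div] at h2
    exact ⟨hinv ▸ ht.div_mem_localRing hG hF hFx, h2⟩
  have houtU' : ∀ x ∉ (U' : Set X.X), u ∈ X.localRing x ∧ u⁻¹ ∉ X.localRing x := by
    intro x hx
    rw [memU', not_not] at hx
    exact ⟨ht.div_mem_localRing hF hG (hFG x hx), ht.inv_div_notMem_localRing hF hG (hFG x hx) hx hF0⟩
  have s1 := sum_ord_eq_finrank hX hdim (isAffineOpen_preimage_basicOpen (i := i) hG hd) a
    (by rw [ha]; exact halg) (by rw [ha]; exact houtU)
  have s2 := sum_ord_eq_finrank hX hdim (isAffineOpen_preimage_basicOpen (i := i) hF hd) b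
    (by rw [hb, ← hinv]; exact fun h => halg (by simpa using h.inv)) (by
      rw [hb, ← hinv, inv_inv]; exact houtU')
  rw [ha, ← hu] at s1
  rw [hb, ← hinv] at s2
  have hadj : IntermediateField.adjoin ℂ {u⁻¹} = IntermediateField.adjoin ℂ {u} := by
    apply le_antisymm
    · rw [IntermediateField.adjoin_simple_le_iff]
      exact inv_mem (IntermediateField.mem_adjoin_simple_self ℂ u)
    · rw [IntermediateField.adjoin_simple_le_iff]
      have := inv_mem (IntermediateField.mem_adjoin_simple_self ℂ u⁻¹)
      rwa [inv_inv] at this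
  rw [hadj, ← s1] at s2
  have hfin := finite_setOf_ord_ne_zero hX hdim u
  rw [finsum_mem_def, finsum_mem_def] at s2
  -- Zeros minus poles. Where neither form vanishes, `u` is a unit and both terms are zero.
  have key : ∀ x, Scheme.ord u x = (U : Set X.X).indicator (fun x => Scheme.ord u x) x -
      (U' : Set X.X).indicator (fun x => Scheme.ord u⁻¹ x) x := by
    intro x
    by_cases hG' : G ∈ primeOf i x
    · have hF' : F ∉ primeOf i x := fun h => hFG x h hG'
      rw [Set.indicator_of_notMem (show x ∉ (U : Set X.X) from fun h => h hG'), Set.indicator_of_mem (by exact hF'), ord_inv]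
      ring
    · rw [Set.indicator_of_mem (by exact hG')]
      by_cases hF' : F ∈ primeOf i x
      · rw [Set.indicator_of_notMem (show x ∉ (U' : Set X.X) from fun h => h hF'), sub_zero]
      · rw [Set.indicator_of_mem (by exact hF'), ord_inv, ord_eq_zero]
        · rfl
        · exact ht.div_mem_localRing hF hG hG'
        · rw [hinv]
          exact ht.div_mem_localRing hG hF hF'
  rw [finsum_congr key, finsum_sub_distrib, sub_eq_zero]
  · exact s2.symm
  · refine hfin.subset fun x hx => ?_
    exact (Set.mem_of_indicator_ne_zero hx |> fun hm => by
      rw [Function.mem_support, Set.indicator_of_mem hm] at hx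
      exact hx)
  · refine hfin.subset fun x hx => ?_
    have hm := Set.mem_of_indicator_ne_zero hx
    rw [Function.mem_support, Set.indicator_of_mem hm, ord_inv] at hx
    exact fun h => hx (by rw [h, neg_zero])

/-- A principal divisor on a projective curve has degree zero. -/
theorem sum_ord_eq_zero (hX : X.IsProjective) (hdim : X.dim = 1) {h : X.K} (h0 : h ≠ 0) :
    ∑ᶠ x, Scheme.ord h x = 0 := by
  obtain ⟨n, i, hi, hstr⟩ := id hX
  obtain ⟨t, ht⟩ := exists_coordinates i hstr
  have ht : IsCoordinates i t := ht
  obtain ⟨d, F, G, hd, hF, hG, hGη, rfl⟩ := ht.exists_eq_div (x := genericPoint X.X) (f := h)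
    (by rw [localRing_generic]; trivial)
  have hG0 := ht.aeval_ne_zero hG hGη
  have hF0 : MvPolynomial.aeval t F ≠ 0 := fun h => h0 (by rw [h, zero_div])
  have hFη : F ∉ primeOf i (genericPoint X.X) := by
    intro h
    refine ht.inv_div_notMem_localRing hF hG hGη h hF0 ?_
    rw [localRing_generic]
    trivial
  have fin (P : MvPolynomial (Fin (n + 1)) ℂ) (hP : P ∉ primeOf i (genericPoint X.X)) :
      {x | P ∈ primeOf i x}.Finite := by
    refine (finite_compl_of_dim_eq_one hX hdim (U := i ⁻¹ᵁ Proj.basicOpen (forms n) P) ⟨_, hP⟩).subset ?_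
    intro x hx hxU
    exact hxU hx
  -- `F` and `G` may have common zeros. Both are therefore compared with `L ^ d`, where `L` avoids
  -- the zeros of both and does not vanish identically.
  obtain ⟨L, hL, hLx⟩ := exists_linear_notMem_primeOf i
    (((fin F hFη).union (fin G hGη)).union (Set.finite_singleton (genericPoint X.X)))
  have hLd : L ^ d ∈ forms n d := by
    have := MvPolynomial.IsHomogeneous.pow (show MvPolynomial.IsHomogeneous L 1 from hL) d
    rwa [one_mul] at this
  have hpow {x} (hx : L ∉ primeOf i x) : L ^ d ∉ primeOf i x := fun h =>
    hx ((inferInstance : (primeOf i x).IsPrime).mem_of_pow_mem d h)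
  have hLη := hpow (hLx (genericPoint X.X) (Or.inr rfl))
  have hL0 := ht.aeval_ne_zero hLd hLη
  have e1 := sum_ord_div_eq_zero hX hdim ht hd hF hLd hFη hLη
    fun x hx => hpow (hLx x (Or.inl (Or.inl hx)))
  have e2 := sum_ord_div_eq_zero hX hdim ht hd hG hLd hGη hLη
    fun x hx => hpow (hLx x (Or.inl (Or.inr hx)))
  have key : ∀ x, Scheme.ord (MvPolynomial.aeval t F / MvPolynomial.aeval t G) x =
      Scheme.ord (MvPolynomial.aeval t F / MvPolynomial.aeval t (L ^ d)) x -
      Scheme.ord (MvPolynomial.aeval t G / MvPolynomial.aeval t (L ^ d)) x := by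
    intro x
    rw [← div_div_div_cancel_right₀ hL0, ord_div (div_ne_zero hF0 hL0) (div_ne_zero hG0 hL0)]
  rw [finsum_congr key, finsum_sub_distrib (finite_setOf_ord_ne_zero hX hdim _)
    (finite_setOf_ord_ne_zero hX hdim _), e1, e2, sub_zero]

end MoriFibre.Variety

/-! ### Curves in the fibres of a morphism. -/

namespace MoriFibre.Variety
attribute [local instance] sectionsAlgebra

variable {X Y Z : Variety}

/-- The closure of `c` with its reduced structure, built as the scheme-theoretic image of the
spectrum of the residue field. -/
theorem exists_closedImmersion_generic (Y : Variety) (c : Y.X) : ∃ (C : Variety) (ι : Hom C Y),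
    IsClosedImmersion ι.f ∧ ι.f (genericPoint C.X) = c := by
  let j := Y.X.fromSpecResidueField c
  have : IsSchemeTheoreticallyDominant j.toImage := by
    constructor
    refine Scheme.IdealSheafData.ext_of_iSup_eq_top
      (fun U : Y.X.affineOpens => ⟨j.imageι ⁻¹ᵁ U.1, U.2.preimage _⟩) ?_ fun U => ?_
    · rw [← Scheme.Hom.preimage_iSup, iSup_affineOpens_eq_top, Scheme.Hom.preimage_top]
    · rw [Scheme.Hom.ker_apply, Scheme.IdealSheafData.ideal_bot, Pi.bot_apply,
        ← RingHom.injective_iff_ker_eq_bot]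
      exact j.toImage_app_injective U
  have hred : IsReduced j.image := IsSchemeTheoreticallyDominant.isReduced j.toImage
  have hdense : DenseRange j.toImage := j.toImage.denseRange
  have : Subsingleton (Spec (Y.X.residueField c)) := inferInstance
  let x0 : Spec (Y.X.residueField c) := IsLocalRing.closedPoint _
  have hr : Set.range j.toImage = {j.toImage x0} := by
    ext y
    constructor
    · rintro ⟨z, rfl⟩
      rw [Subsingleton.elim z x0]; rfl
    · rintro rfl
      exact ⟨x0, rfl⟩
  have hg : IsGenericPoint (j.toImage x0) (Set.univ : Set j.image) := by
    rw [IsGenericPoint, ← hr]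
    exact hdense.closure_range
  have : IrreducibleSpace j.image := by
    have h := hg.isIrreducible
    exact (irreducibleSpace_def _).2 h
  have hint : IsIntegral j.image := isIntegral_of_irreducibleSpace_of_isReduced _
  obtain ⟨n, i, hi, h⟩ := Y.quasiProjective
  refine ⟨⟨j.image, j.imageι ≫ Y.str, hint, inferInstance, inferInstance, n, j.imageι ≫ i,
    inferInstance, by rw [Category.assoc, h]⟩, ⟨j.imageι, rfl⟩, inferInstance, ?_⟩
  have h1 : genericPoint j.image = j.toImage x0 := ((genericPoint_spec j.image).eq hg)
  change j.imageι (genericPoint j.image) = c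
  rw [h1, ← Scheme.Hom.comp_apply, Scheme.Hom.toImage_imageι]
  exact Scheme.fromSpecResidueField_apply _ _

theorem IsProjective.of_isClosedImmersion (hY : Y.IsProjective) (f : Hom X Y) (hf : IsClosedImmersion f.f) :
    X.IsProjective := by
  obtain ⟨n, i, hi, h⟩ := hY
  exact ⟨n, f.f ≫ i, inferInstance, by rw [Category.assoc, h, f.comm]⟩

theorem dim_eq_of_isClosedImmersion (f : Hom X Y) [IsClosedImmersion f.f] {U : Y.X.Opens}
    (hU : IsAffineOpen U) (p : Spec Γ(Y.X, U)) (hp : f.f (genericPoint X.X) = hU.fromSpec p) :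
    X.dim = ringKrullDim (Γ(Y.X, U) ⧸ p.asIdeal) := by
  obtain ⟨n, h1, -, h3⟩ := exists_dim_eq X
  have hmem : genericPoint X.X ∈ f.f ⁻¹ᵁ U := by
    change f.f (genericPoint X.X) ∈ U
    rw [hp]
    exact hU.range_fromSpec.subset ⟨p, rfl⟩
  have hdim := h3 (f.f ⁻¹ᵁ U) (hU.preimage f.f) ⟨_, hmem⟩
  have hker : RingHom.ker (f.f.app U).hom = p.asIdeal := by
    ext a
    rw [RingHom.mem_ker]
    have h4 : a ∉ p.asIdeal ↔ genericPoint X.X ∈ X.X.basicOpen (f.f.app U a) := by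
      rw [← Scheme.preimage_basicOpen]
      change _ ↔ f.f (genericPoint X.X) ∈ Y.X.basicOpen a
      rw [hp]
      change _ ↔ p ∈ hU.fromSpec ⁻¹ᵁ Y.X.basicOpen a
      rw [hU.fromSpec_preimage_basicOpen]
      rfl
    rw [← not_iff_not, h4]
    have h5 := basicOpen_eq_bot_iff (f.f.app U a)
    change ¬ (f.f.app U a = 0) ↔ _
    rw [← h5]
    constructor
    · intro h
      obtain ⟨x, hx⟩ : ((X.X.basicOpen (f.f.app U a) : X.X.Opens) : Set X.X).Nonempty := by
        rw [Set.nonempty_iff_ne_empty]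
        exact fun h6 => h (SetLike.coe_injective h6)
      exact (genericPoint_specializes x).mem_open (X.X.basicOpen _).2 hx
    · intro h h6
      rw [h6] at h
      exact h
  rw [h1, ← hdim, ← hker]
  exact (ringKrullDim_eq_of_ringEquiv (RingHom.quotientKerEquivOfSurjective
    (f.f.app_surjective U hU))).symm

/-- A point closed in a chart is locally closed in `X`, and in a Jacobson space such a point is
closed. -/
theorem isClosed_singleton_of_isMaximal (X : Variety) {U : X.X.Opens} (hU : IsAffineOpen U)
    (p : Spec Γ(X.X, U)) (hp : p.asIdeal.IsMaximal) : IsClosed {hU.fromSpec p} := by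
  have : JacobsonSpace (Spec (.of ℂ)) :=
    PrimeSpectrum.isJacobsonRing_iff_jacobsonSpace.1 (inferInstanceAs (IsJacobsonRing ℂ))
  have : JacobsonSpace X.X := LocallyOfFiniteType.jacobsonSpace X.str
  have h1 : IsClosed {p} := (PrimeSpectrum.isClosed_singleton_iff_isMaximal p).2 hp
  apply isClosed_singleton_of_isLocallyClosed_singleton
  rw [← Set.image_singleton]
  exact h1.isLocallyClosed.image hU.fromSpec.isOpenEmbedding.isInducing
    hU.fromSpec.isOpenEmbedding.isOpen_range.isLocallyClosed

/-- The curve is the closure of a point of a chart inside `W`. The prime of that point contracts to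
a maximal ideal, so its image in `Z` is closed and all other points of the curve, as
specializations, have the same image. -/
theorem exists_curve_in_fibre (g : Hom Y Z) (h : Z.dim < Y.dim) {W : Y.X.Opens}
    (hW : genericPoint Y.X ∈ W) : ∃ C : Curve Y, (∃ z, ∀ p, g.f (C.ι.f p) = z) ∧
      C.ι.f (genericPoint C.C.X) ∈ W := by
  obtain ⟨V, hV, hgV⟩ := Z.exists_isAffineOpen_mem (g.f (genericPoint Y.X))
  obtain ⟨_, ⟨U, hU, rfl⟩, hyU, hle⟩ :=
    Y.X.isBasis_affineOpens.exists_subset_of_mem_open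
      (show genericPoint Y.X ∈ ((W ⊓ g.f ⁻¹ᵁ V : Y.X.Opens) : Set Y.X) from ⟨hW, hgV⟩)
      (W ⊓ g.f ⁻¹ᵁ V).2
  have hUV : U ≤ g.f ⁻¹ᵁ V := fun x hx => (hle hx).2
  have : Nonempty U := ⟨⟨_, hyU⟩⟩
  have : Nonempty V := ⟨⟨_, hgV⟩⟩
  let : Algebra Γ(Z.X, V) Γ(Y.X, U) := (g.f.appLE V U hUV).hom.toAlgebra
  have hcomp : Z.str.appTop ≫ Z.X.presheaf.map (homOfLE (le_top : V ≤ ⊤)).op ≫ g.f.appLE V U hUV =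
      Y.str.appTop ≫ Y.X.presheaf.map (homOfLE (le_top : U ≤ ⊤)).op := by
    rw [← g.comm, Scheme.Hom.comp_appTop, Category.assoc]
    congr 1
    rw [Scheme.Hom.map_appLE]
    rfl
  have : IsScalarTower ℂ Γ(Z.X, V) Γ(Y.X, U) := by
    refine IsScalarTower.of_algebraMap_eq fun c => ?_
    change ((Scheme.ΓSpecIso (.of ℂ)).inv ≫ Y.str.appTop ≫ Y.X.presheaf.map (homOfLE le_top).op).hom c
      = ((Scheme.ΓSpecIso (.of ℂ)).inv ≫ Z.str.appTop ≫ Z.X.presheaf.map (homOfLE le_top).op ≫ g.f.appLE V U hUV).hom c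
    rw [hcomp]
  have := finiteType_sections hU
  have := finiteType_sections hV
  obtain ⟨n, h3, -, h4⟩ := exists_dim_eq Y
  obtain ⟨m, h5, -, h6⟩ := exists_dim_eq Z
  obtain ⟨P, hP, hP1, hP2⟩ := exists_isPrime_ringKrullDim_quotient_eq_one ℂ Γ(Z.X, V) Γ(Y.X, U)
    (by rwa [h4 U hU inferInstance, h6 V hV inferInstance, ← h3, ← h5])
  let p : Spec Γ(Y.X, U) := ⟨P, hP⟩
  obtain ⟨C, ι, hι, hc⟩ := exists_closedImmersion_generic Y (hU.fromSpec p)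
  have hcU : ι.f (genericPoint C.X) ∈ U := by
    rw [hc]
    exact hU.range_fromSpec.subset ⟨p, rfl⟩
  refine ⟨⟨C, ι, hι, ?_⟩, ⟨g.f (hU.fromSpec p), fun q => ?_⟩, (hle hcU).1⟩
  · rw [dim_eq_of_isClosedImmersion ι hU p hc, hP2]
  · have h7 : g.f (hU.fromSpec p) = hV.fromSpec (Spec.map (g.f.appLE V U hUV) p) := by
      rw [← Scheme.Hom.comp_apply, ← Scheme.Hom.comp_apply, hV.SpecMap_appLE_fromSpec _ hU]
    have h8 := isClosed_singleton_of_isMaximal Z hV (Spec.map (g.f.appLE V U hUV) p) hP1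
    rw [← h7] at h8
    have h9 : g.f (hU.fromSpec p) ⤳ g.f (ι.f q) := by
      rw [← hc]
      exact ((genericPoint_specializes q).map ι.f.continuous).map g.f.continuous
    exact h9.mem_closed h8 rfl

end MoriFibre.Variety

/-! ### Degrees of Cartier divisors on curves, and classes of curves. -/

namespace MoriFibre.Variety
attribute [local instance] MvPolynomial.gradedAlgebra

variable {X Y : Variety}

theorem Curve.restrict_algebraMap (C : Curve Y)
    (u : Y.X.presheaf.stalk (C.ι.f (genericPoint C.C.X))) :
    C.restrict (algebraMap _ Y.K u) = (C.ι.f.stalkMap (genericPoint C.C.X)).hom u := by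
  have h : (Classical.epsilon fun v => algebraMap (Y.X.presheaf.stalk (C.ι.f (genericPoint C.C.X))) Y.K v =
      algebraMap _ Y.K u) = u :=
    IsFractionRing.injective (Y.X.presheaf.stalk (C.ι.f (genericPoint C.C.X))) Y.K
      (Classical.epsilon_spec (p := fun v => algebraMap (Y.X.presheaf.stalk (C.ι.f (genericPoint C.C.X))) Y.K v =
        algebraMap _ Y.K u) ⟨u, rfl⟩)
  rw [Curve.restrict, h]

theorem Curve.restrict_mul (C : Curve Y) {φ ψ : Y.K}
    (hφ : φ ∈ Y.localRing (C.ι.f (genericPoint C.C.X)))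
    (hψ : ψ ∈ Y.localRing (C.ι.f (genericPoint C.C.X))) :
    C.restrict (φ * ψ) = C.restrict φ * C.restrict ψ := by
  obtain ⟨u, rfl⟩ := hφ
  obtain ⟨v, rfl⟩ := hψ
  rw [← map_mul, restrict_algebraMap, restrict_algebraMap, restrict_algebraMap, map_mul]

theorem Curve.restrict_one (C : Curve Y) : C.restrict 1 = 1 := by
  rw [← map_one (algebraMap (Y.X.presheaf.stalk (C.ι.f (genericPoint C.C.X))) Y.K),
    restrict_algebraMap, map_one]

theorem Curve.restrict_pow (C : Curve Y) {φ : Y.K}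
    (hφ : φ ∈ Y.localRing (C.ι.f (genericPoint C.C.X))) (n : ℕ) :
    C.restrict (φ ^ n) = C.restrict φ ^ n := by
  obtain ⟨u, rfl⟩ := hφ
  rw [← map_pow, restrict_algebraMap, restrict_algebraMap, map_pow]

theorem Curve.restrict_ne_zero (C : Curve Y) {φ : Y.K} (h0 : φ ≠ 0)
    (hφ : φ ∈ Y.localRing (C.ι.f (genericPoint C.C.X)))
    (hφ' : φ⁻¹ ∈ Y.localRing (C.ι.f (genericPoint C.C.X))) : C.restrict φ ≠ 0 := by
  intro h
  have h1 := C.restrict_mul hφ hφ'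
  rw [mul_inv_cancel₀ h0, restrict_one, h, zero_mul] at h1
  exact one_ne_zero h1

theorem Curve.specializes (C : Curve Y) (p : C.C.X) :
    C.ι.f (genericPoint C.C.X) ⤳ C.ι.f p :=
  (genericPoint_specializes p).map C.ι.f.continuous

theorem Curve.exists_restrict_eq (C : Curve Y) (p : C.C.X) (v : Y.X.presheaf.stalk (C.ι.f p)) :
    C.restrict (algebraMap _ Y.K v) = algebraMap (C.C.X.presheaf.stalk p) C.C.K
      ((C.ι.f.stalkMap p).hom v) := by
  have h1 : algebraMap (Y.X.presheaf.stalk (C.ι.f p)) Y.K v =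
      algebraMap (Y.X.presheaf.stalk (C.ι.f (genericPoint C.C.X))) Y.K
        ((Y.X.presheaf.stalkSpecializes (C.specializes p)).hom v) := by
    change _ = (Y.X.presheaf.stalkSpecializes (C.specializes p) ≫ Y.X.presheaf.stalkSpecializes _).hom v
    rw [TopCat.Presheaf.stalkSpecializes_comp]
    rfl
  rw [h1, restrict_algebraMap]
  have h2 := Scheme.Hom.stalkSpecializes_stalkMap C.ι.f _ _ (genericPoint_specializes p)
  exact congrArg (fun g => g.hom v) h2

theorem Curve.restrict_mem_localRing (C : Curve Y) {p : C.C.X} {φ : Y.K}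
    (hφ : φ ∈ Y.localRing (C.ι.f p)) : C.restrict φ ∈ C.C.localRing p := by
  obtain ⟨v, rfl⟩ := hφ
  exact ⟨_, (C.exists_restrict_eq p v).symm⟩

theorem Curve.inv_restrict_notMem_localRing (C : Curve Y) {p : C.C.X} {φ : Y.K}
    (hφ : φ ∈ Y.localRing (C.ι.f p)) (hφ' : φ⁻¹ ∉ Y.localRing (C.ι.f p)) (h0 : C.restrict φ ≠ 0) :
    (C.restrict φ)⁻¹ ∉ C.C.localRing p := by
  obtain ⟨v, rfl⟩ := hφ
  rw [C.exists_restrict_eq] at h0 ⊢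
  intro h
  have h1 := isUnit_of_inv_mem (fun h => h0 (by rw [h, map_zero])) h
  have h2 : IsUnit v := (isUnit_map_iff (C.ι.f.stalkMap p).hom v).1 h1
  apply hφ'
  obtain ⟨w, rfl⟩ := h2
  exact ⟨((w⁻¹ : (Y.X.presheaf.stalk (C.ι.f p))ˣ) : Y.X.presheaf.stalk (C.ι.f p)), by
    exact eq_inv_of_mul_eq_one_left (by rw [← map_mul, Units.inv_mul, map_one])⟩

/-- The quotient has order zero along every prime divisor through `y`. By symmetry it is a unit, so
the choice made in `localEquation` is harmless. -/
theorem IsNormal.div_mem_localRing (hX : X.IsNormal) {D : X.PrimeDivisor → ℚ} {y : X.X} {φ ψ : X.K}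
    (hφ : X.IsLocalEquation D y φ) (hψ : X.IsLocalEquation D y ψ) : φ / ψ ∈ X.localRing y := by
  obtain ⟨h0, U, hU, h1⟩ := hφ
  obtain ⟨h0', V, hV, h2⟩ := hψ
  refine hX.mem_localRing_of_ord_nonneg y fun x hx hxy => ?_
  have h3 := h1 ⟨x, hx⟩ (hxy.mem_open U.2 hU)
  have h4 := h2 ⟨x, hx⟩ (hxy.mem_open V.2 hV)
  rw [ord_div h0 h0', sub_nonneg]
  rw [← h3] at h4
  exact (by exact_mod_cast h4 : Scheme.ord ψ x = Scheme.ord φ x).le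

theorem IsLocalEquation.of_mem {D : X.PrimeDivisor → ℚ} {y : X.X} {φ : X.K}
    (h : X.IsLocalEquation D y φ) : ∃ U : X.X.Opens, y ∈ U ∧ ∀ x ∈ U, X.IsLocalEquation D x φ := by
  obtain ⟨h0, U, hU, h1⟩ := h
  exact ⟨U, hU, fun x hx => ⟨h0, U, hx, h1⟩⟩

theorem IsLocalEquation.of_specializes {D : X.PrimeDivisor → ℚ} {x y : X.X} {φ : X.K}
    (h : X.IsLocalEquation D y φ) (hxy : x ⤳ y) : X.IsLocalEquation D x φ := by
  obtain ⟨U, hU, h1⟩ := h.of_mem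
  exact h1 x (hxy.mem_open U.2 hU)

theorem IsCartier.localEquation_spec {D : X.PrimeDivisor → ℚ} (hD : X.IsCartier D) (y : X.X) :
    X.IsLocalEquation D y (X.localEquation D y) := Classical.epsilon_spec (hD y)

theorem Curve.isProjective (C : Curve Y) (hproj : Y.IsProjective) : C.C.IsProjective :=
  hproj.of_isClosedImmersion C.ι C.closed

section Degree

variable (hY : Y.IsNormal) (hproj : Y.IsProjective) {D : Y.PrimeDivisor → ℚ} (hD : Y.IsCartier D)
  (C : Curve Y)
include hY hproj hD

/-- Finitely many of the chosen local equations serve for all points of `C`, up to units. Each of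
them, divided by the equation at the generic point of `C`, restricts to one rational function, which
has finite support. -/
theorem Curve.finite_support : {p : C.C.X | Scheme.ord (C.restrict
    (Y.localEquation D (C.ι.f p) / Y.localEquation D (C.ι.f (genericPoint C.C.X)))) p ≠ 0}.Finite := by
  set φ := Y.localEquation D
  set c := C.ι.f (genericPoint C.C.X) with hcd
  have hCp := C.isProjective hproj
  have : CompactSpace C.C.X := hCp.compactSpace
  have hφ : ∀ y, Y.IsLocalEquation D y (φ y) := hD.localEquation_spec
  choose U hU hU' using fun p : C.C.X => (hφ (C.ι.f p)).of_mem
  obtain ⟨t, ht⟩ := isCompact_univ.elim_finite_subcover (fun p => ((C.ι.f ⁻¹ᵁ U p : C.C.X.Opens) : Set C.C.X))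
    (fun p => (C.ι.f ⁻¹ᵁ U p).2) (fun p _ => Set.mem_iUnion.2 ⟨p, hU p⟩)
  refine (t.finite_toSet.biUnion fun p _ =>
    finite_setOf_ord_ne_zero hCp C.dim_eq (C.restrict (φ (C.ι.f p) / φ c))).subset fun q hq => ?_
  obtain ⟨p, hp, hqp⟩ := Set.mem_iUnion₂.1 (ht (Set.mem_univ q))
  refine Set.mem_iUnion₂.2 ⟨p, hp, ?_⟩
  have hq' := hU' p _ hqp
  have h0 := (hφ (C.ι.f q)).1
  have h0' := (hφ (C.ι.f p)).1
  have h0c := (hφ c).1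
  have h1 : φ (C.ι.f q) / φ (C.ι.f p) ∈ Y.localRing (C.ι.f q) := hY.div_mem_localRing (hφ _) hq'
  have h2 : (φ (C.ι.f q) / φ (C.ι.f p))⁻¹ ∈ Y.localRing (C.ι.f q) := by
    rw [inv_div]
    exact hY.div_mem_localRing hq' (hφ _)
  have h3 : φ (C.ι.f p) / φ c ∈ Y.localRing c :=
    hY.div_mem_localRing ((hφ _).of_specializes (C.specializes p)) (hφ c)
  have h3' : (φ (C.ι.f p) / φ c)⁻¹ ∈ Y.localRing c := by
    rw [inv_div]
    exact hY.div_mem_localRing (hφ c) ((hφ _).of_specializes (C.specializes p))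
  have h4 : φ (C.ι.f q) / φ c = φ (C.ι.f q) / φ (C.ι.f p) * (φ (C.ι.f p) / φ c) := by
    field_simp
  have h5 := localRing_mono (C.specializes q) h1
  have h6 := localRing_mono (C.specializes q) h2
  have h7 := C.restrict_ne_zero (div_ne_zero h0 h0') h5 h6
  have h8 := C.restrict_mem_localRing h1
  have h9 := C.restrict_mem_localRing h2
  have h10 : C.restrict (φ (C.ι.f q) / φ (C.ι.f p))⁻¹ = (C.restrict (φ (C.ι.f q) / φ (C.ι.f p)))⁻¹ := by
    exact eq_inv_of_mul_eq_one_right (by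
      rw [← C.restrict_mul h5 h6, mul_inv_cancel₀ (div_ne_zero h0 h0'), C.restrict_one])
  rw [h10] at h9
  simp only [Set.mem_ofPred_eq] at hq ⊢
  rw [h4, C.restrict_mul h5 h3, Scheme.ord_mul h7 (C.restrict_ne_zero (div_ne_zero h0' h0c) h3 h3'), ord_eq_zero h8 h9, zero_add] at hq
  exact hq

/-- The degree of `N D` may be computed with any `t` as reference function in place of the inverse
`N`-th power of the equation at the generic point: the two differ by a principal divisor on `C`, of
degree zero. -/
theorem Curve.mul_cartierDegree_eq (t : Y.K) (N : ℕ)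
    (ht0 : t ≠ 0)
    (hc : t * Y.localEquation D (C.ι.f (genericPoint C.C.X)) ^ N ∈
      Y.localRing (C.ι.f (genericPoint C.C.X)))
    (hc' : (t * Y.localEquation D (C.ι.f (genericPoint C.C.X)) ^ N)⁻¹ ∈
      Y.localRing (C.ι.f (genericPoint C.C.X))) :
    N * cartierDegree D C =
      ∑ᶠ p : C.C.X, Scheme.ord (C.restrict (t * Y.localEquation D (C.ι.f p) ^ N)) p ∧
    {p : C.C.X | Scheme.ord (C.restrict (t * Y.localEquation D (C.ι.f p) ^ N)) p ≠ 0}.Finite := by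
  have hfin := C.finite_support hY hproj hD
  rw [cartierDegree]
  set φ := Y.localEquation D
  set c := C.ι.f (genericPoint C.C.X) with hcd
  have hCp := C.isProjective hproj
  have hφ : ∀ y, Y.IsLocalEquation D y (φ y) := hD.localEquation_spec
  have h0c := (hφ c).1
  have hr0 := C.restrict_ne_zero (mul_ne_zero ht0 (pow_ne_zero N h0c)) ‹_› ‹_›
  have key : ∀ p, Scheme.ord (C.restrict (t * φ (C.ι.f p) ^ N)) p =
      Scheme.ord (C.restrict (t * φ c ^ N)) p + N * Scheme.ord (C.restrict (φ (C.ι.f p) / φ c)) p := by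
    intro p
    have h0' := (hφ (C.ι.f p)).1
    have h3 : φ (C.ι.f p) / φ c ∈ Y.localRing c :=
      hY.div_mem_localRing ((hφ _).of_specializes (C.specializes p)) (hφ c)
    have h3' : (φ (C.ι.f p) / φ c)⁻¹ ∈ Y.localRing c := by
      rw [inv_div]
      exact hY.div_mem_localRing (hφ c) ((hφ _).of_specializes (C.specializes p))
    have h4 : t * φ (C.ι.f p) ^ N = t * φ c ^ N * (φ (C.ι.f p) / φ c) ^ N := by
      rw [mul_assoc, ← mul_pow, mul_div_cancel₀ _ h0c]
    rw [h4, C.restrict_mul ‹_› (pow_mem h3 N), C.restrict_pow h3,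
      Scheme.ord_mul hr0 (pow_ne_zero _ (C.restrict_ne_zero (div_ne_zero h0' h0c) h3 h3')), ord_pow]
  have hfin2 := finite_setOf_ord_ne_zero hCp C.dim_eq (C.restrict (t * φ c ^ N))
  have hfin3 : (Function.support fun p => (N : ℤ) * Scheme.ord (C.restrict (φ (C.ι.f p) / φ c)) p).Finite :=
    hfin.subset fun p hp => right_ne_zero_of_mul hp
  constructor
  · rw [finsum_congr key, finsum_add_distrib hfin2 hfin3, sum_ord_eq_zero hCp C.dim_eq hr0, zero_add,
      mul_finsum]
  · refine (hfin2.union hfin3).subset fun p hp => ?_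
    simp only [Set.mem_ofPred_eq, key] at hp
    by_contra h
    simp only [Set.mem_union, Function.mem_support, Set.mem_ofPred_eq, not_or, not_not] at h
    exact hp (by rw [h.1, h.2, add_zero])

/-- Here `t` acts as a section of `N D` that is regular along `C` and does not vanish identically on
it. -/
theorem Curve.cartierDegree_nonneg (t : Y.K) {N : ℕ} (hN : 0 < N)
    (ht0 : t ≠ 0) (ht : ∀ p, t * Y.localEquation D (C.ι.f p) ^ N ∈ Y.localRing (C.ι.f p))
    (hc' : (t * Y.localEquation D (C.ι.f (genericPoint C.C.X)) ^ N)⁻¹ ∈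
      Y.localRing (C.ι.f (genericPoint C.C.X))) : 0 ≤ cartierDegree D C := by
  have h := (C.mul_cartierDegree_eq hY hproj hD t N ht0 (ht _) hc').1
  have h2 : 0 ≤ N * cartierDegree D C := by
    rw [h]
    exact finsum_nonneg fun p => ord_nonneg (C.restrict_mem_localRing (ht p))
  exact nonneg_of_mul_nonneg_right h2 (by exact_mod_cast hN)

/-- The case `t = 1`, `N = 1`: `D` is effective along `C`, does not contain `C`, and meets it at
`q`. -/
theorem Curve.cartierDegree_pos
    (ht : ∀ p, Y.localEquation D (C.ι.f p) ∈ Y.localRing (C.ι.f p))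
    (hc' : (Y.localEquation D (C.ι.f (genericPoint C.C.X)))⁻¹ ∈
      Y.localRing (C.ι.f (genericPoint C.C.X))) {q : C.C.X}
    (hq : (Y.localEquation D (C.ι.f q))⁻¹ ∉ Y.localRing (C.ι.f q)) : 0 < cartierDegree D C := by
  have h := C.mul_cartierDegree_eq hY hproj hD 1 1 one_ne_zero (by simpa using ht _) (by simpa using hc')
  simp only [Nat.cast_one, one_mul, pow_one] at h
  rw [h.1]
  have hqη : q ≠ genericPoint C.C.X := by
    rintro rfl
    exact hq hc'
  have hne : C.restrict (Y.localEquation D (C.ι.f q)) ≠ 0 := by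
    have hs := (hD.localEquation_spec (C.ι.f q)).of_specializes (C.specializes q)
    refine C.restrict_ne_zero hs.1 (localRing_mono (C.specializes q) (ht q)) ?_
    have h1 := mul_mem (hY.div_mem_localRing (hD.localEquation_spec _) hs) hc'
    rwa [div_mul_eq_mul_div, mul_inv_cancel₀ (hD.localEquation_spec _).1, one_div] at h1
  exact finsum_pos (fun p => ord_nonneg (C.restrict_mem_localRing (ht p)))
    ⟨q, ord_pos (coheight_eq_one_of_dim_eq_one C.dim_eq hqη) hne (C.restrict_mem_localRing (ht q))
      (C.inv_restrict_notMem_localRing (ht q) hq hne)⟩ h.2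

end Degree

theorem exists_mem_primeOf_notMem {n : ℕ} (i : X.X ⟶ projSpace n) [IsClosedImmersion i] {x y : X.X}
    (h : x ⤳ y) (hne : x ≠ y) : ∃ d, ∃ F ∈ forms n d, F ∈ primeOf i y ∧ F ∉ primeOf i x := by
  by_contra! hcon
  apply hne
  have hinj : Function.Injective i := i.isClosedEmbedding.injective
  apply hinj
  refine ProjectiveSpectrum.ext (HomogeneousIdeal.toIdeal_injective ?_)
  change primeOf i x = primeOf i y
  refine le_antisymm (fun F hF => ?_) (fun F hF => ?_)
  · by_contra h'
    exact notMem_primeOf_of_specializes i h h' hF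
  · rw [← DirectSum.sum_support_decompose (forms n) F]
    refine sum_mem fun d _ => hcon d _ (SetLike.coe_mem _) ?_
    exact (ProjectiveSpectrum.asHomogeneousIdeal (𝒜 := forms n) (i y)).2 d hF

/-- The divisor cut out by the form `F`. Different denominators give equations that differ by units
where neither denominator vanishes. -/
theorem IsCoordinates.exists_isLocalEquation {n : ℕ} {i : X.X ⟶ projSpace n} {t : Fin (n + 1) → X.K}
    (ht : IsCoordinates i t) {d : ℕ} {F : MvPolynomial (Fin (n + 1)) ℂ}
    (hF0 : MvPolynomial.aeval t F ≠ 0) : ∃ D : X.PrimeDivisor → ℚ, ∀ (y : X.X)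
      (G : MvPolynomial (Fin (n + 1)) ℂ), G ∈ forms n d → G ∉ primeOf i y →
      X.IsLocalEquation D y (MvPolynomial.aeval t F / MvPolynomial.aeval t G) := by
  choose j hj using exists_X_notMem_primeOf i
  have hj' : ∀ x, (MvPolynomial.X (j x) : MvPolynomial (Fin (n + 1)) ℂ) ^ d ∉ primeOf i x :=
    fun x h => hj x ((inferInstance : (primeOf i x).IsPrime).mem_of_pow_mem _ h)
  have hX : ∀ x, (MvPolynomial.X (j x) : MvPolynomial (Fin (n + 1)) ℂ) ^ d ∈ forms n d := fun x => by
    simpa using (MvPolynomial.isHomogeneous_X ℂ (j x)).pow d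
  refine ⟨fun x => Scheme.ord (MvPolynomial.aeval t F /
      MvPolynomial.aeval t ((MvPolynomial.X (j x.1) : MvPolynomial (Fin (n + 1)) ℂ) ^ d)) x.1,
    fun y G hG hGy => ⟨div_ne_zero hF0 (ht.aeval_ne_zero hG hGy),
      i ⁻¹ᵁ Proj.basicOpen (forms n) G, hGy, fun x hx => ?_⟩⟩
  have h1 := ht.aeval_ne_zero hG hGy
  have h2 := ht.aeval_ne_zero (hX x.1) (hj' x.1)
  have h3 := ord_eq_zero (ht.div_mem_localRing hG (hX x.1) (hj' x.1))
    (by rw [inv_div]; exact ht.div_mem_localRing (hX x.1) hG hx)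
  rw [ord_div h1 h2, sub_eq_zero] at h3
  beta_reduce
  rw [ord_div hF0 h1, ord_div hF0 h2, h3]

/-- A hypersurface through a closed point of `C` that does not contain `C` cuts out a Cartier
divisor of positive degree on `C`. -/
theorem Curve.cls_ne_zero (hY : Y.IsNormal) (hproj : Y.IsProjective) (C : Curve Y) : C.cls ≠ 0 := by
  obtain ⟨n, i, hi, hstr⟩ := id hproj
  obtain ⟨t, ht⟩ := exists_coordinates i hstr
  have ht : IsCoordinates i t := ht
  -- With only a generic point the curve would have dimension zero.
  have : ∃ q : C.C.X, q ≠ genericPoint C.C.X := by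
    by_contra! h
    have h1 := C.dim_eq
    rw [dim, topologicalKrullDim_eq_iSup_stalk] at h1
    have h2 : ⨆ x : C.C.X, ringKrullDim (C.C.X.presheaf.stalk x) ≤ 0 := iSup_le fun x => by
      rw [ringKrullDim_stalk_eq_coheight, coheight_eq_zero_iff.2 (h x)]
      rfl
    rw [h1] at h2
    exact absurd h2 (by decide)
  obtain ⟨q, hq⟩ := this
  have := C.closed
  have hne : C.ι.f (genericPoint C.C.X) ≠ C.ι.f q := fun h =>
    hq (C.ι.f.isClosedEmbedding.injective h).symm
  obtain ⟨d, F, hF, hFq, hFc⟩ := exists_mem_primeOf_notMem i (C.specializes q) hne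
  obtain ⟨D, hD⟩ := ht.exists_isLocalEquation (ht.aeval_ne_zero hF hFc)
  have hex : ∀ y : Y.X, ∃ G ∈ forms n d, G ∉ primeOf i y := fun y => by
    obtain ⟨j, hj⟩ := exists_X_notMem_primeOf i y
    exact ⟨MvPolynomial.X j ^ d, by simpa using (MvPolynomial.isHomogeneous_X ℂ j).pow d,
      fun h => hj ((inferInstance : (primeOf i y).IsPrime).mem_of_pow_mem _ h)⟩
  have hcart : Y.IsCartier D := fun y => by
    obtain ⟨G, hG, hGy⟩ := hex y
    exact ⟨_, hD y G hG hGy⟩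
  have hspec := hcart.localEquation_spec
  have hpos : 0 < cartierDegree D C := by
    refine C.cartierDegree_pos hY hproj hcart (fun p => ?_) ?_ (q := q) fun h => ?_
    · obtain ⟨G, hG, hGy⟩ := hex (C.ι.f p)
      have h1 := hY.div_mem_localRing (hspec _) (hD _ G hG hGy)
      have h2 := mul_mem h1 (ht.div_mem_localRing hF hG hGy)
      rwa [div_mul_cancel₀ _ (hD _ G hG hGy).1] at h2
    · obtain ⟨G, hG, hGy⟩ := hex (C.ι.f (genericPoint C.C.X))
      have h1 := hY.div_mem_localRing (hD _ G hG hGy) (hspec _)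
      have h2 := mul_mem h1 (ht.div_mem_localRing hG hF hFc)
      rwa [← inv_div (MvPolynomial.aeval t F) (MvPolynomial.aeval t G), div_mul_eq_mul_div,
        mul_inv_cancel₀ (hD _ G hG hGy).1, one_div] at h2
    · obtain ⟨G, hG, hGy⟩ := hex (C.ι.f q)
      refine ht.inv_div_notMem_localRing hF hG hGy hFq (ht.aeval_ne_zero hF hFc) ?_
      have h1 := hY.div_mem_localRing (hspec _) (hD _ G hG hGy)
      have h2 := mul_mem h1 h
      rwa [div_mul_eq_mul_div, mul_inv_cancel₀ (hspec _).1, one_div] at h2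
  have hidx : Y.cartierIndex D = 1 := by
    have h1 : (1 : ℕ) ∈ {m : ℕ | 0 < m ∧ Y.IsCartier (m • D)} := ⟨one_pos, by rwa [one_smul]⟩
    exact le_antisymm (Nat.sInf_le h1) (Nat.sInf_mem ⟨1, h1⟩).1
  intro h0
  have h1 : intersection D C = 0 := by
    have h2 := congrFun (congrArg Subtype.val h0) ⟨D, 1, one_pos, by rwa [one_smul]⟩
    simpa [Curve.cls, numericalClass] using h2
  rw [intersection, hidx, one_smul] at h1
  simp at h1
  exact hpos.ne' h1


end MoriFibre.Variety

/-! ### Regular top forms over a valuation ring. -/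

namespace MoriFibre

/-- In a line over `K`, of two generators one is a multiple of the other with coefficient in the
valuation ring `A`, so generators can be discarded one at a time. -/
theorem _root_.Submodule.FG.exists_eq_span_singleton_of_finrank_eq_one {K V : Type*} [Field K] [AddCommGroup V]
    [Module K V] (hV : Module.finrank K V = 1) {A : Subring K} (hA : ∀ f : K, f ∈ A ∨ f⁻¹ ∈ A)
    {P : Submodule A V} (hP : P.FG) : ∃ θ, P = Submodule.span A {θ} := by
  refine Submodule.fg_induction (motive := fun P _ => ∃ θ, P = Submodule.span A {θ})
    (fun x => ⟨x, rfl⟩) ?_ P hP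
  rintro _ _ - - ⟨a, rfl⟩ ⟨b, rfl⟩
  by_cases hb : b = 0
  · exact ⟨a, by simp [hb]⟩
  obtain ⟨c, rfl⟩ := (finrank_eq_one_iff_of_nonzero' b hb).1 hV a
  rcases hA c with h | h
  · refine ⟨b, sup_eq_right.2 ?_⟩
    rw [Submodule.span_singleton_le_iff_mem]
    exact Submodule.mem_span_singleton.2 ⟨⟨c, h⟩, rfl⟩
  · by_cases hc : c = 0
    · exact ⟨b, by simp [hc]⟩
    refine ⟨c • b, sup_eq_left.2 ?_⟩
    rw [Submodule.span_singleton_le_iff_mem]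
    exact Submodule.mem_span_singleton.2 ⟨⟨c⁻¹, h⟩, inv_smul_smul₀ hc b⟩

variable (k K : Type) [Field k] [Field K] [Algebra k K]

theorem finrank_form [Module.Finite K Ω[K⁄k]] :
    Module.finrank K (Form k K (Module.finrank K Ω[K⁄k])) = 1 := by
  rw [exteriorPower.finrank_eq, Nat.choose_self]

variable {k K}

/-- Since `df = -f² d(f⁻¹)`, the differentials of elements of `A` span all differentials over `K`,
so their wedge products cannot all vanish. -/
theorem exists_ιMulti_D_ne_zero {n : ℕ} (h : Module.finrank K (Form k K n) = 1) {A : Subring K}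
    (hA : ∀ f : K, f ∈ A ∨ f⁻¹ ∈ A) :
    ∃ a : Fin n → A, exteriorPower.ιMulti K n (fun i => KaehlerDifferential.D k K (a i : K)) ≠ 0 := by
  by_contra! hcon
  have key : ∀ f : K, ∃ (c : K) (a : A),
      KaehlerDifferential.D k K f = c • KaehlerDifferential.D k K (a : K) := by
    intro f
    rcases hA f with hf | hf
    · exact ⟨1, ⟨f, hf⟩, (one_smul _ _).symm⟩
    · by_cases h0 : f = 0
      · exact ⟨1, 0, by simp [h0]⟩
      refine ⟨- f ^ 2, ⟨f⁻¹, hf⟩, ?_⟩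
      rw [Derivation.leibniz_inv, smul_smul]
      have : -f ^ 2 * -(f⁻¹ ^ 2) = 1 := by field_simp
      rw [this, one_smul]
  have hspan := exteriorPower.ιMulti_span_of_span K n (Ω[K⁄k])
    (KaehlerDifferential.span_range_derivation k K)
  have hbot : (⊤ : Submodule K (Form k K n)) = ⊥ := by
    rw [← hspan, Submodule.span_eq_bot]
    rintro _ ⟨m, hm, rfl⟩
    have : ∀ i, ∃ (c : K) (a : A), m i = c • KaehlerDifferential.D k K (a : K) := by
      intro i
      obtain ⟨f, hf⟩ := hm ⟨i, rfl⟩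
      rw [← hf]
      exact key f
    choose c a hca using this
    rw [show m = fun i => c i • KaehlerDifferential.D k K (a i : K) from funext hca,
      AlternatingMap.map_smul_univ, hcon a, smul_zero]
  have := finrank_top K (Form k K n)
  rw [hbot, finrank_bot, h] at this
  exact zero_ne_one this

theorem exists_linearMap_ιMulti_D (n : ℕ) (A : Subring K) [Algebra k A] [IsScalarTower k A K] :
    ∃ Φ : ⋀[A]^n (Ω[A⁄k]) →ₗ[A] Form k K n, ∀ a : Fin n → A,
      Φ (exteriorPower.ιMulti A n fun i => KaehlerDifferential.D k A (a i)) =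
        exteriorPower.ιMulti K n fun i => KaehlerDifferential.D k K (a i : K) := by
  refine ⟨exteriorPower.alternatingMapLinearEquiv
    { (MultilinearMap.restrictScalars A (exteriorPower.ιMulti K n).toMultilinearMap).compLinearMap
        (fun _ => KaehlerDifferential.map k k A K) with
      map_eq_zero_of_eq' := fun v i j hij hne =>
        AlternatingMap.map_eq_zero_of_eq (exteriorPower.ιMulti K n) _ (by simp [hij]) hne },
    fun a => ?_⟩
  rw [exteriorPower.alternatingMapLinearEquiv_apply_ιMulti]
  exact congrArg (exteriorPower.ιMulti K n) (funext fun i => KaehlerDifferential.map_D k k A K (a i))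

/-- The regular forms are the image of the exterior power of the Kähler differentials of `A`, which
are finite because `A` is essentially of finite type. -/
theorem fg_regularForms (n : ℕ) (A : Subring K) [Algebra k A] [IsScalarTower k A K]
    [Algebra.EssFiniteType k A] : (regularForms k K n A).FG := by
  obtain ⟨Φ, hΦ⟩ := exists_linearMap_ιMulti_D (k := k) n A
  have h : regularForms k K n A = LinearMap.range Φ := by
    rw [← Submodule.map_top, ← exteriorPower.ιMulti_span_of_span A n (Ω[A⁄k])
      (KaehlerDifferential.span_range_derivation k A), Submodule.map_span, regularForms]
    congr 1
    ext ω
    constructor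
    · rintro ⟨a, rfl⟩
      refine ⟨_, ⟨fun i => KaehlerDifferential.D k A (a i), ?_, rfl⟩, hΦ a⟩
      rintro _ ⟨i, rfl⟩
      exact ⟨_, rfl⟩
    · rintro ⟨_, ⟨m, hm, rfl⟩, rfl⟩
      have : ∀ i, ∃ a : A, KaehlerDifferential.D k A a = m i := fun i => hm ⟨i, rfl⟩
      choose a ha using this
      obtain rfl : (fun i => KaehlerDifferential.D k A (a i)) = m := funext ha
      exact ⟨a, (hΦ a).symm⟩
  rw [h, LinearMap.range_eq_map]
  exact (Module.Finite.fg_top (R := A) (M := ⋀[A]^n (Ω[A⁄k]))).map Φ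

theorem exists_regularForms_eq_span {n : ℕ} (h : Module.finrank K (Form k K n) = 1) (A : Subring K)
    [Algebra k A] [IsScalarTower k A K] [Algebra.EssFiniteType k A]
    (hA : ∀ f : K, f ∈ A ∨ f⁻¹ ∈ A) :
    ∃ θ : Form k K n, θ ≠ 0 ∧ regularForms k K n A = Submodule.span A {θ} := by
  obtain ⟨θ, hθ⟩ := (fg_regularForms (k := k) n A).exists_eq_span_singleton_of_finrank_eq_one h hA
  refine ⟨θ, ?_, hθ⟩
  rintro rfl
  obtain ⟨a, ha⟩ := exists_ιMulti_D_ne_zero h hA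
  have h1 : exteriorPower.ιMulti K n (fun i => KaehlerDifferential.D k K (a i : K)) ∈
      regularForms k K n A := Submodule.subset_span ⟨a, rfl⟩
  rw [hθ] at h1
  exact ha (by simpa using h1)

end MoriFibre

/-! ### Orders of top forms along prime divisors. -/

namespace MoriFibre.Variety

/-- The inclusion of the constants in a local ring. -/
noncomputable abbrev localRingAlgebra (X : Variety) (x : X.X) : Algebra ℂ (X.localRing x) :=
  ((algebraMap ℂ X.K).codRestrict (X.localRing x) (algebraMap_mem_localRing x)).toAlgebra

attribute [local instance] sectionsAlgebra localRingAlgebra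

variable {X : Variety}

instance (x : X.X) : IsScalarTower ℂ (X.localRing x) X.K :=
  IsScalarTower.of_algebraMap_eq fun _ => rfl

theorem essFiniteType_localRing (x : X.X) : Algebra.EssFiniteType ℂ (X.localRing x) := by
  obtain ⟨U, hU, hx⟩ := X.exists_isAffineOpen_mem x
  have : Nonempty U := ⟨⟨x, hx⟩⟩
  have := finiteType_sections hU
  let := X.X.presheaf.algebra_section_stalk ⟨x, hx⟩
  have hloc := hU.isLocalization_stalk ⟨x, hx⟩
  let : Algebra ℂ (X.X.presheaf.stalk x) :=
    ((algebraMap Γ(X.X, U) (X.X.presheaf.stalk x)).comp (algebraMap ℂ Γ(X.X, U))).toAlgebra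
  have : IsScalarTower ℂ Γ(X.X, U) (X.X.presheaf.stalk x) := IsScalarTower.of_algebraMap_eq fun _ => rfl
  have h1 : Algebra.EssFiniteType Γ(X.X, U) (X.X.presheaf.stalk x) :=
    Algebra.EssFiniteType.of_isLocalization _ (hU.primeIdealOf ⟨x, hx⟩).asIdeal.primeCompl
  have h2 := Algebra.EssFiniteType.comp ℂ Γ(X.X, U) (X.X.presheaf.stalk x)
  let f : X.X.presheaf.stalk x →ₐ[ℂ] X.localRing x :=
    { (X.stalkToK x).rangeRestrict with
      commutes' := fun c => by
        apply Subtype.ext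
        change X.stalkToK x (X.X.presheaf.germ U x hx (algebraMap ℂ Γ(X.X, U) c)) = algebraMap ℂ X.K c
        rw [IsScalarTower.algebraMap_apply ℂ Γ(X.X, U) X.K]
        exact Scheme.algebraMap_germ_eq_germToFunctionField X.X hx _ }
  exact Algebra.EssFiniteType.of_surjective f (X.stalkToK x).rangeRestrict_surjective

theorem finite_kaehlerDifferential (X : Variety) : Module.Finite X.K (Ω[X.K⁄ℂ]) := by
  obtain ⟨U, hU, hx⟩ := X.exists_isAffineOpen_mem (genericPoint X.X)
  have : Nonempty U := ⟨⟨_, hx⟩⟩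
  have := finiteType_sections hU
  have := functionField_isFractionRing_of_isAffineOpen X.X U hU
  have h1 : Algebra.EssFiniteType Γ(X.X, U) X.K :=
    Algebra.EssFiniteType.of_isLocalization _ (nonZeroDivisors Γ(X.X, U))
  have h2 := Algebra.EssFiniteType.comp ℂ Γ(X.X, U) X.K
  infer_instance

theorem finrank_form_formDegree (X : Variety) : Module.finrank X.K (Form ℂ X.K X.formDegree) = 1 :=
  have := X.finite_kaehlerDifferential
  finrank_form ℂ X.K

theorem canonicalForm_ne_zero (X : Variety) : X.canonicalForm ≠ 0 := by
  have h := X.finrank_form_formDegree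
  have : Nontrivial (Form ℂ X.K X.formDegree) := Module.nontrivial_of_finrank_eq_succ h
  exact Classical.epsilon_spec (p := fun ω : Form ℂ X.K X.formDegree => ω ≠ 0) (exists_ne 0)

theorem IsNormal.mem_or_inv_mem (hX : X.IsNormal) {x : X.X} (hx : coheight x = 1) (f : X.K) :
    f ∈ X.localRing x ∨ f⁻¹ ∈ X.localRing x := by
  rw [hX.mem_localRing_iff hx, hX.mem_localRing_iff hx, ord_inv]
  lia

theorem IsNormal.exists_regularForms_eq_span (hX : X.IsNormal) {n : ℕ}
    (hn : Module.finrank X.K (Form ℂ X.K n) = 1) (x : X.PrimeDivisor) :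
    ∃ θ : Form ℂ X.K n, θ ≠ 0 ∧
      regularForms ℂ X.K n (X.localRing x.1) = Submodule.span (X.localRing x.1) {θ} :=
  have := essFiniteType_localRing x.1
  MoriFibre.exists_regularForms_eq_span hn _ (hX.mem_or_inv_mem x.2)

/-- Two generators of the regular forms differ by a unit of the local ring, so the choice inside
`formOrd` does not affect the order. -/
theorem formOrd_smul {n : ℕ} {x : X.PrimeDivisor} {θ : Form ℂ X.K n} (h0 : θ ≠ 0)
    (hθ : regularForms ℂ X.K n (X.localRing x.1) = Submodule.span (X.localRing x.1) {θ})
    (g : X.K) : X.formOrd (g • θ) x = Scheme.ord g x.1 := by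
  obtain ⟨θ', hθ', h1⟩ := Classical.epsilon_spec (p := fun g' : X.K => ∃ θ' : Form ℂ X.K n,
    regularForms ℂ X.K n (X.localRing x.1) = Submodule.span (X.localRing x.1) {θ'} ∧ g • θ = g' • θ')
    ⟨g, θ, hθ, rfl⟩
  rw [formOrd]
  set g' := Classical.epsilon (fun g' : X.K => ∃ θ' : Form ℂ X.K n,
    regularForms ℂ X.K n (X.localRing x.1) = Submodule.span (X.localRing x.1) {θ'} ∧ g • θ = g' • θ')
  have h2 : θ' ∈ Submodule.span (X.localRing x.1) {θ} := by
    rw [← hθ, hθ']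
    exact Submodule.mem_span_singleton_self _
  have h3 : θ ∈ Submodule.span (X.localRing x.1) {θ'} := by
    rw [← hθ', hθ]
    exact Submodule.mem_span_singleton_self _
  obtain ⟨u, rfl⟩ := Submodule.mem_span_singleton.1 h2
  obtain ⟨v, hv⟩ := Submodule.mem_span_singleton.1 h3
  have h4 : ((v : X.K) * (u : X.K)) • θ = (1 : X.K) • θ := by
    rw [one_smul, mul_smul]
    exact hv
  have h5 := smul_left_injective X.K h0 h4
  have h6 : g • θ = (g' * (u : X.K)) • θ := by
    rw [h1, mul_smul]
    rfl
  have h7 : g = g' * (u : X.K) := smul_left_injective X.K h0 h6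
  have hu : (u : X.K) ≠ 0 := right_ne_zero_of_mul (h5.trans_ne one_ne_zero)
  by_cases hg : g' = 0
  · rw [h7, hg, zero_mul]
  rw [h7, Scheme.ord_mul hg hu, ord_eq_zero u.2 (by rw [inv_eq_of_mul_eq_one_left h5]; exact v.2), add_zero]

end MoriFibre.Variety

/-! ### Transport of forms along an isomorphism of fields. -/

namespace MoriFibre

variable {k K L : Type} [Field k] [Field K] [Field L] [Algebra k K] [Algebra k L]

/-- An isomorphism is formally étale, so differentials commute with this base change. -/
theorem finrank_kaehlerDifferential_eq (e : K ≃ₐ[k] L) :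
    Module.finrank L (Ω[L⁄k]) = Module.finrank K (Ω[K⁄k]) := by
  let : Algebra K L := (e : K →+* L).toAlgebra
  have : IsScalarTower k K L := IsScalarTower.of_algebraMap_eq fun c => (e.commutes c).symm
  let e' : K ≃ₐ[K] L := AlgEquiv.ofRingEquiv (f := e.toRingEquiv) fun _ => rfl
  have : Algebra.FormallyEtale K L := Algebra.FormallyEtale.of_equiv e'
  rw [← (KaehlerDifferential.tensorKaehlerEquivOfFormallyEtale k K L).finrank_eq,
    Module.finrank_baseChange]

/-- `IsTransfer e Ψ` means that `Ψ` is the transport of differential forms along the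
isomorphism `e`. -/
structure IsTransfer (e : K ≃ₐ[k] L) {n : ℕ} (Ψ : Form k K n →+ Form k L n) : Prop where
  map_smul : ∀ (c : K) ω, Ψ (c • ω) = e c • Ψ ω
  map_ιMulti : ∀ a : Fin n → K, Ψ (exteriorPower.ιMulti K n fun i => KaehlerDifferential.D k K (a i)) =
    exteriorPower.ιMulti L n fun i => KaehlerDifferential.D k L (e (a i))

theorem exists_isTransfer (e : K ≃ₐ[k] L) (n : ℕ) :
    ∃ Ψ : Form k K n →+ Form k L n, IsTransfer e Ψ := by
  let : Algebra K L := (e : K →+* L).toAlgebra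
  have : IsScalarTower k K L := IsScalarTower.of_algebraMap_eq fun c => (e.commutes c).symm
  refine ⟨(formMap k K L n).toAddMonoidHom, fun c ω => ?_, fun a => ?_⟩
  · exact (formMap k K L n).map_smul c ω
  · change formMap k K L n _ = _
    rw [formMap, exteriorPower.alternatingMapLinearEquiv_apply_ιMulti]
    exact congrArg (exteriorPower.ιMulti L n) (funext fun i => KaehlerDifferential.map_D k k K L (a i))

namespace IsTransfer

variable {e : K ≃ₐ[k] L} {n : ℕ} {Ψ : Form k K n →+ Form k L n} (hΨ : IsTransfer e Ψ)
include hΨ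

theorem map_ne_zero (hK : Module.finrank K (Form k K n) = 1) (hL : Module.finrank L (Form k L n) = 1)
    {ω : Form k K n} (hω : ω ≠ 0) : Ψ ω ≠ 0 := by
  intro h
  obtain ⟨a, ha⟩ := exists_ιMulti_D_ne_zero (k := k) hL (A := ⊤) fun f => Or.inl trivial
  apply ha
  have h1 := hΨ.map_ιMulti fun i => e.symm (a i)
  simp only [AlgEquiv.apply_symm_apply] at h1
  obtain ⟨c, hc⟩ := (finrank_eq_one_iff_of_nonzero' ω hω).1 hK
    (exteriorPower.ιMulti K n fun i => KaehlerDifferential.D k K (e.symm (a i)))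
  rw [← h1, ← hc, hΨ.map_smul, h, smul_zero]

theorem regularForms_eq {A : Subring K} {A' : Subring L} (hA : ∀ a, a ∈ A ↔ e a ∈ A')
    {θ : Form k K n} (hθ : regularForms k K n A = Submodule.span A {θ}) :
    regularForms k L n A' = Submodule.span A' {Ψ θ} := by
  apply le_antisymm
  · refine Submodule.span_le.2 ?_
    rintro _ ⟨b, rfl⟩
    let a : Fin n → A := fun i => ⟨e.symm (b i), (hA _).2 (by simp)⟩
    have h1 : exteriorPower.ιMulti K n (fun i => KaehlerDifferential.D k K (a i : K)) ∈
        regularForms k K n A := Submodule.subset_span ⟨a, rfl⟩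
    rw [hθ] at h1
    obtain ⟨c, hc⟩ := Submodule.mem_span_singleton.1 h1
    have h2 := hΨ.map_ιMulti fun i => (a i : K)
    simp only [a, AlgEquiv.apply_symm_apply] at h2
    refine Submodule.mem_span_singleton.2 ⟨⟨e c, (hA _).1 c.2⟩, ?_⟩
    beta_reduce
    rw [← h2, ← hc]
    exact (hΨ.map_smul c θ).symm
  · rw [Submodule.span_singleton_le_iff_mem]
    have h1 : θ ∈ regularForms k K n A := by
      rw [hθ]
      exact Submodule.mem_span_singleton_self _
    rw [regularForms] at h1
    refine Submodule.span_induction (p := fun ω _ => Ψ ω ∈ regularForms k L n A') ?_ ?_ ?_ ?_ h1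
    · rintro _ ⟨a, rfl⟩
      rw [hΨ.map_ιMulti fun i => (a i : K)]
      exact Submodule.subset_span ⟨fun i => ⟨e (a i), (hA _).1 (a i).2⟩, rfl⟩
    · rw [map_zero]
      exact zero_mem _
    · intro x y _ _ hx hy
      rw [map_add]
      exact add_mem hx hy
    · intro a x _ hx
      change Ψ ((a : K) • x) ∈ _
      rw [hΨ.map_smul]
      exact Submodule.smul_mem _ (⟨e a, (hA _).1 a.2⟩ : A') hx

end IsTransfer

end MoriFibre

/-! ### Birational maps, function fields and valuations. -/

namespace MoriFibre.Variety

variable {X Y : Variety}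

theorem isIso_stalkSpecializes_of_eq (S : Scheme) {a b : S} (h : a = b) :
    IsIso (S.presheaf.stalkSpecializes (specializes_of_eq h)) := by
  subst h
  rw [TopCat.Presheaf.stalkSpecializes_refl]
  infer_instance

namespace Hom

theorem fieldMap_algebraMap_stalk (g : Hom X Y) [IsDominant g.f] (x : X.X)
    (v : Y.X.presheaf.stalk (g.f x)) : g.fieldMap (algebraMap _ Y.K v) =
      algebraMap (X.X.presheaf.stalk x) X.K ((g.f.stalkMap x).hom v) := by
  have h := Scheme.Hom.stalkSpecializes_stalkMap g.f _ _ (genericPoint_specializes x)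
  have h2 : Y.X.presheaf.stalkSpecializes (genericPoint_specializes (g.f x)) ≫
      Y.X.presheaf.stalkSpecializes (specializes_of_eq g.generic) ≫
        g.f.stalkMap (genericPoint X.X) =
      g.f.stalkMap x ≫ X.X.presheaf.stalkSpecializes (genericPoint_specializes x) := by
    rw [← h, ← Category.assoc]
    erw [TopCat.Presheaf.stalkSpecializes_comp]
  exact congrArg (fun k => k.hom v) h2

theorem fieldMap_mem_localRing (g : Hom X Y) [IsDominant g.f] {x : X.X} {f : Y.K}
    (hf : f ∈ Y.localRing (g.f x)) : g.fieldMap f ∈ X.localRing x := by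
  obtain ⟨v, rfl⟩ := hf
  exact ⟨_, (g.fieldMap_algebraMap_stalk x v).symm⟩

theorem inv_mem_localRing_of_fieldMap (g : Hom X Y) [IsDominant g.f] {x : X.X} {f : Y.K}
    (hf : f ∈ Y.localRing (g.f x)) (hf' : (g.fieldMap f)⁻¹ ∈ X.localRing x) :
    f⁻¹ ∈ Y.localRing (g.f x) := by
  by_cases h0 : f = 0
  · rw [h0, inv_zero]
    exact zero_mem _
  obtain ⟨v, rfl⟩ := hf
  have h1 : g.fieldMap (algebraMap _ Y.K v) ≠ 0 := by rwa [map_ne_zero]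
  rw [g.fieldMap_algebraMap_stalk] at hf' h1
  have h2 := isUnit_of_inv_mem (fun h => h1 (by rw [h, map_zero])) hf'
  obtain ⟨w, rfl⟩ := (isUnit_map_iff (g.f.stalkMap x).hom v).1 h2
  exact ⟨((w⁻¹ : (Y.X.presheaf.stalk (g.f x))ˣ) : Y.X.presheaf.stalk (g.f x)),
    eq_inv_of_mul_eq_one_left (by rw [← map_mul, Units.inv_mul, map_one])⟩

theorem fieldMap_mem_localRing_iff (g : Hom X Y) [IsDominant g.f] [IsOpenImmersion g.f] {x : X.X}
    {f : Y.K} : g.fieldMap f ∈ X.localRing x ↔ f ∈ Y.localRing (g.f x) := by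
  refine ⟨fun ⟨b, hb⟩ => ?_, g.fieldMap_mem_localRing⟩
  obtain ⟨v, rfl⟩ := (ConcreteCategory.bijective_of_isIso (g.f.stalkMap x)).2 b
  exact ⟨v, g.fieldMap.injective ((g.fieldMap_algebraMap_stalk x v).trans hb)⟩

/-- The image of `j` contains the generic point, where `g` therefore induces an isomorphism of local
rings. -/
theorem bijective_fieldMap (g : Hom X Y) [IsDominant g.f] {S : Scheme} [Nonempty S] (j : S ⟶ X.X)
    [IsOpenImmersion j] [IsOpenImmersion (j ≫ g.f)] : Function.Bijective g.fieldMap := by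
  obtain ⟨s, hs⟩ : genericPoint X.X ∈ j.opensRange :=
    (genericPoint_specializes (j (Classical.arbitrary S))).mem_open j.opensRange.2 ⟨_, rfl⟩
  have h1 : IsIso (g.f.stalkMap (j s) ≫ j.stalkMap s) := by
    have h : IsIso ((j ≫ g.f).stalkMap s) := inferInstance
    rwa [Scheme.Hom.stalkMap_comp] at h
  have h2 : IsIso (g.f.stalkMap (j s)) := IsIso.of_isIso_comp_right _ (j.stalkMap s)
  have h3 : IsIso (g.f.stalkMap (genericPoint X.X)) := hs ▸ h2
  have h4 := isIso_stalkSpecializes_of_eq Y.X g.generic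
  have h5 : IsIso (Y.X.presheaf.stalkSpecializes (specializes_of_eq g.generic) ≫
    g.f.stalkMap (genericPoint X.X)) := inferInstance
  exact ConcreteCategory.bijective_of_isIso _

end Hom

/-- On the domain of definition the local ring at `y` dominates the one at its image `x`. The latter
is a valuation ring, hence maximal for domination, and the two agree. -/
theorem exists_algEquiv_of_partialIso (p : Y.X.PartialIso X.X) (hp : p.IsOver Y.str X.str)
    (hX : X.IsNormal) : ∃ e : X.K ≃ₐ[ℂ] Y.K, ∀ (y : Y.X) (x : X.X), Sends p y x → coheight x = 1 →
      ∀ f, f ∈ X.localRing x ↔ e f ∈ Y.localRing y := by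
  have h1 : Function.Bijective (domainIncl p).fieldMap := by
    have : IsOpenImmersion (domainIncl p).f := inferInstanceAs (IsOpenImmersion (domain p).ι)
    have : Nonempty (Y.opens (domain p)).X := inferInstanceAs (Nonempty (domain p))
    exact (domainIncl p).bijective_fieldMap (𝟙 _)
  have h2 : Function.Bijective (domainHom p hp).fieldMap := by
    let j : p.source.toScheme ⟶ (Y.opens (domain p)).X :=
      Y.X.homOfLE p.toPartialMap.le_domain_toRationalMap
    have hj : IsOpenImmersion j :=
      inferInstanceAs (IsOpenImmersion (Y.X.homOfLE p.toPartialMap.le_domain_toRationalMap))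
    have hne : Nonempty p.source.toScheme := by
      obtain ⟨x, hx⟩ := p.dense_source.nonempty
      exact ⟨⟨x, hx⟩⟩
    have h3 : j ≫ (domainHom p hp).f = p.iso.hom ≫ p.target.ι :=
      p.toPartialMap.toPartialMap_toRationalMap_restrict
    have : IsOpenImmersion (j ≫ (domainHom p hp).f) := by
      rw [h3]
      infer_instance
    exact (domainHom p hp).bijective_fieldMap j
  let e₁ := RingEquiv.ofBijective _ h1
  let e₂ := RingEquiv.ofBijective _ h2
  let e : X.K ≃ₐ[ℂ] Y.K := AlgEquiv.ofRingEquiv (f := e₂.trans e₁.symm) fun c => by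
    apply e₁.injective
    rw [RingEquiv.trans_apply, RingEquiv.apply_symm_apply]
    exact ((domainHom p hp).fieldMap_algebraMap c).trans ((domainIncl p).fieldMap_algebraMap c).symm
  have he : ∀ f, (domainIncl p).fieldMap (e f) = (domainHom p hp).fieldMap f := fun f =>
    e₁.apply_symm_apply (e₂ f)
  refine ⟨e, fun y x ⟨hy, hyx⟩ hx f => ?_⟩
  have : IsOpenImmersion (domainIncl p).f := inferInstanceAs (IsOpenImmersion (domain p).ι)
  let w : (Y.opens (domain p)).X := ⟨y, hy⟩
  have h4 : e f ∈ Y.localRing y ↔ (domainHom p hp).fieldMap f ∈ (Y.opens (domain p)).localRing w := by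
    rw [← he]
    exact ((domainIncl p).fieldMap_mem_localRing_iff (x := w)).symm
  rw [h4]
  subst hyx
  refine ⟨fun hf => (domainHom p hp).fieldMap_mem_localRing (x := w) hf, fun hf => ?_⟩
  rcases hX.mem_or_inv_mem hx f with h | h
  · exact h
  · have h5 := (domainHom p hp).inv_mem_localRing_of_fieldMap (x := w) h
      (by rwa [map_inv₀, inv_inv])
    rwa [inv_inv] at h5

theorem IsNormal.exists_ord_eq_one (hX : X.IsNormal) {x : X.X} (hx : coheight x = 1) :
    ∃ f : X.K, f ≠ 0 ∧ Scheme.ord f x = 1 := by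
  have := hX.isDiscreteValuationRing hx
  obtain ⟨ϖ, hϖ⟩ := IsDiscreteValuationRing.exists_irreducible (X.X.presheaf.stalk x)
  have h1 := ord_algebraMap hx hϖ.ne_zero
  rw [Ring.ord_of_irreducible hϖ] at h1
  have h2 : (Scheme.ord (algebraMap (X.X.presheaf.stalk x) X.K ϖ) x).toNat = 1 := by
    exact_mod_cast h1.symm
  refine ⟨algebraMap (X.X.presheaf.stalk x) X.K ϖ, fun h => hϖ.ne_zero ?_, by lia⟩
  exact IsFractionRing.injective (X.X.presheaf.stalk x) X.K (h.trans (map_zero _).symm)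

/-- Valuations with the same valuation ring are proportional; as both take the value `1`, the factor
`Scheme.ord (e π) y` is `1`. -/
theorem ord_apply_eq (hX : X.IsNormal) (hY : Y.IsNormal) {x : X.X} {y : Y.X} (hx : coheight x = 1)
    (hy : coheight y = 1) (e : X.K ≃+* Y.K) (he : ∀ f, f ∈ X.localRing x ↔ e f ∈ Y.localRing y)
    {f : X.K} (hf : f ≠ 0) : Scheme.ord (e f) y = Scheme.ord f x := by
  obtain ⟨π, hπ0, hπ⟩ := hX.exists_ord_eq_one hx
  obtain ⟨ρ', hρ0', hρ⟩ := hY.exists_ord_eq_one hy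
  obtain ⟨ρ, rfl⟩ := e.surjective ρ'
  have hρ0 : ρ ≠ 0 := fun h => hρ0' (by rw [h, map_zero])
  have he' : ∀ f, 0 ≤ Scheme.ord f x ↔ 0 ≤ Scheme.ord (e f) y := fun f => by
    rw [← hX.mem_localRing_iff hx, he, hY.mem_localRing_iff hy]
  have key : ∀ f, f ≠ 0 → Scheme.ord (e f) y = Scheme.ord f x * Scheme.ord (e π) y := by
    intro f hf
    have h1 : ∀ z : ℤ, Scheme.ord (π ^ z) x = z ∧ Scheme.ord (e (π ^ z)) y = z * Scheme.ord (e π) y := by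
      intro z
      obtain ⟨n, rfl | rfl⟩ := z.eq_nat_or_neg
      · rw [zpow_natCast, map_pow, ord_pow, ord_pow, hπ, mul_one]
        exact ⟨rfl, rfl⟩
      · rw [zpow_neg, zpow_natCast, map_inv₀, map_pow, ord_inv, ord_inv, ord_pow, ord_pow, hπ, mul_one,
          neg_mul]
        exact ⟨rfl, rfl⟩
    have hz := zpow_ne_zero (Scheme.ord f x) hπ0
    have h2 : Scheme.ord (f / π ^ Scheme.ord f x) x = 0 := by
      rw [ord_div hf hz, (h1 _).1, sub_self]
    have h3 : Scheme.ord (e (f / π ^ Scheme.ord f x)) y = 0 := by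
      have h4 := (he' _).1 h2.ge
      have h5 := (he' (f / π ^ Scheme.ord f x)⁻¹).1 (by rw [ord_inv, h2, neg_zero])
      rw [map_inv₀, ord_inv] at h5
      lia
    rw [map_div₀, ord_div (by rwa [map_ne_zero]) (by rwa [map_ne_zero]), (h1 _).2] at h3
    lia
  have h1 := key ρ hρ0
  rw [hρ] at h1
  have h2 : 0 ≤ Scheme.ord (e π) y := (he' π).1 (by rw [hπ]; exact zero_le_one)
  rw [key f hf, Int.eq_one_of_mul_eq_one_left h2 h1.symm, mul_one]

end MoriFibre.Variety

/-! ### Transfer of sections to `Y`, and their vanishing on a Mori fibration. -/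

namespace MoriFibre.Variety

variable {X Y Z : Variety}

/-- `h` is the ratio of `η` to the transport of `ω`, so one function serves all corresponding pairs
of divisors. -/
theorem exists_formOrd_eq (hX : X.IsNormal) (hY : Y.IsNormal) (e : X.K ≃ₐ[ℂ] Y.K) {m n : ℕ}
    (hmn : m = n) (hm : Module.finrank X.K (Form ℂ X.K m) = 1)
    (hn : Module.finrank Y.K (Form ℂ Y.K n) = 1) {ω : Form ℂ X.K m} (hω : ω ≠ 0)
    {η : Form ℂ Y.K n} (hη : η ≠ 0) : ∃ h : Y.K, h ≠ 0 ∧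
      ∀ (x : X.PrimeDivisor) (y : Y.PrimeDivisor),
        (∀ f, f ∈ X.localRing x.1 ↔ e f ∈ Y.localRing y.1) →
          Y.formOrd η y = Scheme.ord h y.1 + X.formOrd ω x := by
  subst hmn
  obtain ⟨Ψ, hΨ⟩ := exists_isTransfer e m
  have hΨω := hΨ.map_ne_zero hm hn hω
  obtain ⟨h, rfl⟩ := (finrank_eq_one_iff_of_nonzero' (Ψ ω) hΨω).1 hn η
  have h0 : h ≠ 0 := fun h0 => hη (by rw [h0, zero_smul])
  refine ⟨h, h0, fun x y hxy => ?_⟩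
  obtain ⟨θ, hθ0, hθ⟩ := hX.exists_regularForms_eq_span hm x
  obtain ⟨g, rfl⟩ := (finrank_eq_one_iff_of_nonzero' θ hθ0).1 hm ω
  have hg : g ≠ 0 := fun h0 => hω (by rw [h0, zero_smul])
  rw [hΨ.map_smul, ← mul_smul, formOrd_smul (hΨ.map_ne_zero hm hn hθ0) (hΨ.regularForms_eq hxy hθ),
    formOrd_smul hθ0 hθ, Scheme.ord_mul h0 (by rwa [map_ne_zero])]
  congr 1
  exact ord_apply_eq hX hY x.2 y.2 e.toRingEquiv hxy hg

/-- `K_X` is integral and `B` has finite support, so the product of the denominators of `B` works.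
Some witness is needed because the infimum of the empty set would be `0`. -/
theorem denominator_logDivisor_pos (B : X.PrimeDivisor →₀ ℚ) : 0 < X.denominator (X.logDivisor B) := by
  have h : (∏ x ∈ B.support, (B x).den) ∈
      {l : ℕ | 0 < l ∧ ∀ x, ∃ z : ℤ, (l • X.logDivisor B) x = z} := by
    refine ⟨Finset.prod_pos fun x _ => (B x).den_pos, fun x => ?_⟩
    have h1 : ∃ z : ℤ, ((∏ x ∈ B.support, (B x).den : ℕ) : ℚ) * B x = z := by
      by_cases hx : x ∈ B.support
      · obtain ⟨c, hc⟩ := Finset.dvd_prod_of_mem (fun x => (B x).den) hx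
        refine ⟨c * (B x).num, ?_⟩
        rw [hc]
        push_cast
        rw [mul_right_comm, Rat.den_mul_eq_num, mul_comm]
      · exact ⟨0, by rw [Finsupp.notMem_support_iff.1 hx, mul_zero, Int.cast_zero]⟩
    obtain ⟨z, hz⟩ := h1
    refine ⟨(∏ x ∈ B.support, (B x).den : ℕ) * X.formOrd X.canonicalForm x + z, ?_⟩
    rw [Pi.smul_apply, nsmul_eq_mul, logDivisor, mul_add, hz, canonicalDivisor]
    push_cast
    rfl
  exact (Nat.sInf_mem ⟨_, h⟩).1

theorem IsNormal.exists_curve_intersection_nonneg (hY : Y.IsNormal) (hproj : Y.IsProjective)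
    {D : Y.PrimeDivisor → ℚ} (hD : Y.IsQCartier D) {N : ℕ} (hN : 0 < N) {f : Y.K} (hf : f ≠ 0)
    (hfD : f ∈ Y.sections (N • D)) (g : Hom Y Z) (hdim : Z.dim < Y.dim) :
    ∃ C : Curve Y, (∃ z, ∀ p, g.f (C.ι.f p) = z) ∧ 0 ≤ intersection D C := by
  obtain ⟨hM, hMD⟩ : 0 < Y.cartierIndex D ∧ Y.IsCartier (Y.cartierIndex D • D) := Nat.sInf_mem hD
  set M := Y.cartierIndex D with hMdef
  set φ := Y.localEquation (M • D)
  have hφ : ∀ y, Y.IsLocalEquation (M • D) y (φ y) := hMD.localEquation_spec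
  -- `f ^ M` is a section of `M N D`, and `φ y ^ N` is an equation of that divisor near `y`.
  have hreg : ∀ y, f ^ M * φ y ^ N ∈ Y.localRing y := by
    intro y
    obtain ⟨h0, U, hU, h1⟩ := hφ y
    refine hY.mem_localRing_of_ord_nonneg y fun x hx hxy => ?_
    have h2 := h1 ⟨x, hx⟩ (hxy.mem_open U.2 hU)
    have h3 := hfD hf ⟨x, hx⟩
    rw [Pi.smul_apply, nsmul_eq_mul] at h2 h3
    rw [Scheme.ord_mul (pow_ne_zero _ hf) (pow_ne_zero _ h0), ord_pow, ord_pow]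
    have h4 : (0 : ℚ) ≤ ((M * Scheme.ord f x + N * Scheme.ord (φ y) x : ℤ) : ℚ) := by
      push_cast
      rw [h2]
      have h5 := mul_nonneg (Nat.cast_nonneg (α := ℚ) M) h3
      linarith
    exact_mod_cast h4
  -- On `U` the equation at the generic point remains a local equation; on `V` the section does not
  -- vanish with respect to it. A curve whose generic point is in both is not contained in the zero
  -- divisor of the section.
  obtain ⟨U, hU, hU'⟩ := (hφ (genericPoint Y.X)).of_mem
  obtain ⟨V, hV, hV'⟩ := exists_opens_mem_localRing (X := Y) (x := genericPoint Y.X)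
    (f := (f ^ M * φ (genericPoint Y.X) ^ N)⁻¹) (by rw [localRing_generic]; trivial)
  obtain ⟨C, hC, hCW⟩ := exists_curve_in_fibre g hdim (W := U ⊓ V) ⟨hU, hV⟩
  refine ⟨C, hC, ?_⟩
  have h1 : (f ^ M * φ (C.ι.f (genericPoint C.C.X)) ^ N)⁻¹ ∈
      Y.localRing (C.ι.f (genericPoint C.C.X)) := by
    have h2 := mul_mem (hV' _ hCW.2) (pow_mem (hY.div_mem_localRing (hU' _ hCW.1) (hφ _)) N)
    have h3 := (hφ (genericPoint Y.X)).1
    have h4 := (hφ (C.ι.f (genericPoint C.C.X))).1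
    convert h2 using 1
    rw [div_pow]
    field_simp
  have h2 := C.cartierDegree_nonneg hY hproj hMD (f ^ M) hN (pow_ne_zero _ hf) (fun p => hreg _) h1
  exact div_nonneg (by exact_mod_cast h2) (Nat.cast_nonneg _)

theorem IsMoriFibration.sections_eq_zero {BY : Y.PrimeDivisor →₀ ℚ} {g : Hom Y Z}
    (hg : IsMoriFibration BY g) {N : ℕ} (hN : 0 < N) {f : Y.K}
    (hf : f ∈ Y.sections (N • Y.logDivisor BY)) : f = 0 := by
  by_contra h0
  have hY := hg.lc.1.normal
  obtain ⟨C, hC, hnonneg⟩ := hY.exists_curve_intersection_nonneg hg.projective hg.lc.1.qCartier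
    hN h0 hf g hg.dim_lt
  obtain ⟨R, -, hR, hcont⟩ := hg.extremal
  have h1 := hR _ ((hcont.2 C).1 hC) (C.cls_ne_zero hY hg.projective)
  have h2 : C.cls.1 ⟨Y.logDivisor BY, hg.lc.1.qCartier⟩ = (intersection (Y.logDivisor BY) C : ℝ) := by
    simp [Curve.cls, numericalClass]
  rw [h2] at h1
  have h3 : intersection (Y.logDivisor BY) C < 0 := by exact_mod_cast h1
  exact h3.not_ge hnonneg

theorem IsMoriFibreSpaceFor.exists_section {B : X.PrimeDivisor →₀ ℚ} {BY : Y.PrimeDivisor →₀ ℚ}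
    {f : X.X.PartialIso Y.X} {g : Hom Y Z} (h : IsMoriFibreSpaceFor B BY f g) {N : ℕ} {s : X.K}
    (hs : s ∈ X.sections (N • X.logDivisor B)) (hs0 : s ≠ 0) :
    ∃ s' ∈ Y.sections (N • Y.logDivisor BY), s' ≠ 0 := by
  have hX := h.lc.1.normal
  have hY := h.fibration.lc.1.normal
  obtain ⟨e, he⟩ := exists_algEquiv_of_partialIso f.symm h.isOver.symm hX
  obtain ⟨k, hk0, hk⟩ := exists_formOrd_eq (m := X.formDegree) (n := Y.formDegree) hX hY e
    (finrank_kaehlerDifferential_eq e).symm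
    X.finrank_form_formDegree Y.finrank_form_formDegree X.canonicalForm_ne_zero
    Y.canonicalForm_ne_zero
  have hes : e s ≠ 0 := by rwa [map_ne_zero]
  -- Along corresponding divisors `K_Y` exceeds `K_X` by the order of `k`; dividing by `k ^ N`
  -- compensates for this in the `N`-th multiple.
  refine ⟨e s / k ^ N, fun _ y => ?_, div_ne_zero hes (pow_ne_zero _ hk0)⟩
  obtain ⟨x, hyx⟩ := h.inv_noContract y
  have h1 := he _ _ hyx x.2
  have h2 := hk x y h1
  have h3 := hs hs0 x
  have h4 : Scheme.ord (e s) y.1 = Scheme.ord s x.1 := ord_apply_eq hX hY x.2 y.2 e.toRingEquiv h1 hs0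
  rw [ord_div hes (pow_ne_zero _ hk0), ord_pow, h4]
  rw [Pi.smul_apply, nsmul_eq_mul, logDivisor, canonicalDivisor] at h3 ⊢
  rw [h2, h.push y x hyx]
  push_cast
  linarith

end MoriFibre.Variety

theorem mainTheorem11 (X : MoriFibre.Variety) (B : X.PrimeDivisor →₀ ℚ)
    (hproj : X.IsProjective) (hpair : X.IsPair B) (hM : X.HasMoriFibreSpace B) :
    X.kodairaDim (X.logDivisor B) = ⊥ := by
  obtain ⟨Y, Z, BY, f, g, h⟩ := hM
  refine iSup_eq_bot.2 fun m => iSup_eq_bot.2 fun ⟨hm, s, hs, hs0⟩ => ?_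
  -- `s` is a section of the multiple of `K_X + B` by `m` times the denominator, and this factor is
  -- positive.
  rw [← mul_smul] at hs
  obtain ⟨s', hs', hs0'⟩ := h.exists_section hs hs0
  exact absurd (h.fibration.sections_eq_zero
    (mul_pos hm (MoriFibre.Variety.denominator_logDivisor_pos B)) hs') hs0'
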